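/- **Model.** Fix $p$. Let $(X,\mathbf Z,\epsilon)$ take values in $\mathbb R\times\mathbb R^p\times\mathbb R$, let $\beta^*\in\mathbb R^p$, and let $Y=\mathrm{sign}(X+\mathbf Z^\top\beta^*+\epsilon)\in\{-1,+1\}$. Let $(y_i,x_i,\mathbf z_i,\epsilon_i)$, $i\ge1$, be i.i.d. copies of $(Y,X,\mathbf Z,\epsilon)$. Assume that $0$ is a median of $\epsilon$ given $(X,\mathbf Z)$; the support of $(X,\mathbf Z)$ is not contained in a proper linear subspace of $\mathbb R^{p+1}$; $0<\mathbb P(Y=-1\mid X,\mathbf Z)<1$ almost surely; and, given $\mathbf Z$, $X$ has an almost everywhere positive density. **Assumptions.** 1. $\alpha\ge2$ is an integer, and $H:\mathbb R\to\mathbb R$ is twice differentiable with $H''$ bounded and Lipschitz, $H(x)=1$ for $x>1$, $H(x)=0$ for $x<-1$, $\int_{-1}^1x^kH'(x)\,dx=0$ for $1\le k\le\alpha-1$, $\int_{-1}^1x^\alpha H'(x)\,dx\neq0$, and $\int_{-1}^1H'(x)^2\,dx<\infty$. 2. Given $\mathbf Z$, the variable $\zeta=X+\mathbf Z^\top\beta^*$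 has a density $\rho(\cdot\mid\mathbf Z)$ that is positive and bounded, and whose derivatives of orders $1,\dots,\alpha$ exist and are bounded in a neighbourhood of $0$, for almost every $\mathbf Z$ (bounds and neighbourhood not depending on $\mathbf Z$). 3. $\epsilon$ and $X$ are independent given $\mathbf Z$, and the derivatives of orders $1,\dots,\alpha+1$ of the conditional distribution function $F(\cdot\mid\mathbf Z)$ of $\epsilon$ exist and are bounded in a neighbourhood of $0$, for almost every $\mathbf Z$ (again uniformly in $\mathbf Z$). 4. All eigenvalues of $V=2\,\mathbb E[\rho(0\mid\mathbf Z)F'(0\mid\mathbf Z)\mathbf Z\mathbf Z^\top]$ lie in $(c_1^{-1},c_1)$ for some constant $c_1>0$. 5. $\|\mathbf Z\|_\infty\le\overline B$ almost surely for some constant $\overline B>0$. **Estimator.** The sample of size $n=Lm$ is split over $L\ge1$ machines $\mathcal H_1,\dots,\mathcal H_L$ with $m$ observations each. Fix $\lambda_h>0$ and, for $t=1,2,\dots$, put $h_t=\max\{(\lambda_h/n)^{1/(2\alpha+1)},\,m^{-2^t/(3\alpha)}\}$. From an initial estimator $\widehat\beta^{(0)}$ define $$\widehat\beta^{(t)}=\widehat\beta^{(t-1)}-\Big(\tfrac1L\sum_{\ell=1}^LV^{(t)}_{m,\ell}\Big)^{-1}\tfrac1L\sum_{\ell=1}^LU^{(t)}_{m,\ell},$$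 $$U^{(t)}_{m,\ell}=\frac1{mh_t}\sum_{i\in\mathcal H_\ell}(-y_i)H'\Big(\frac{x_i+\mathbf z_i^\top\widehat\beta^{(t-1)}}{h_t}\Big)\mathbf z_i,\qquad V^{(t)}_{m,\ell}=\frac1{mh_t^2}\sum_{i\in\mathcal H_\ell}(-y_i)H''\Big(\frac{x_i+\mathbf z_i^\top\widehat\beta^{(t-1)}}{h_t}\Big)\mathbf z_i\mathbf z_i^\top$$ (if the averaged Hessian is singular, the iterate is left unchanged). **Theorem.** Let $m\to\infty$, with $L\ge1$ varying arbitrarily, and suppose that $\|\widehat\beta^{(0)}-\beta^*\|_2=O_{\mathbb P}(m^{-1/3})$. Then: (i) for every fixed $t\ge1$, $$\|\widehat\beta^{(t)}-\beta^*\|_2=O_{\mathbb P}\Big(n^{-\frac{\alpha}{2\alpha+1}}+m^{-\frac{2^t}{3}}+m^{-\frac{2^{t-1}}{3}}n^{-\frac{\alpha-1}{2\alpha+1}}\sqrt{\log n}\Big);$$ (ii) for every choice of numbers of rounds $T$ (which may vary with $m$ and $L$) such that eventually $$T\ge\tau:=\log_2\Big(\frac{6\alpha}{2\alpha+1}\cdot\frac{\log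 n-\log\lambda_h}{\log m}\Big),$$ one has $\|\widehat\beta^{(T)}-\beta^*\|_2=O_{\mathbb P}\big(n^{-\frac{\alpha}{2\alpha+1}}\big)$; (iii) $\lceil\tau\rceil=O(\log\log n)$, so that the rate $n^{-\alpha/(2\alpha+1)}$ is reached after $O(\log\log n)$ rounds. -/

import Mathlib

open Filter Topology MeasureTheory ProbabilityTheory Set

namespace MultiRoundSMSE

noncomputable section

/-- The parameter space `ℝ^p` with the Euclidean norm. -/
abbrev Vec (p : ℕ) : Type := EuclideanSpace ℝ (Fin p)

/-- The space in which a triple `(X, Z, ε)` takes its values. -/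
abbrev Triple (p : ℕ) : Type := ℝ × Vec p × ℝ

/-! ### The binary response model, with `(X, Z, ε)` the coordinate variables -/

/-- The scalar covariate `X`. -/
def covX {p : ℕ} (w : Triple p) : ℝ := w.1

/-- The vector covariate `Z`. -/
def covZ {p : ℕ} (w : Triple p) : Vec p := w.2.1

/-- The noise `ε`. -/
def noise {p : ℕ} (w : Triple p) : ℝ := w.2.2

/-- The pair of covariates `(X, Z)`. -/
def covXZ {p : ℕ} (w : Triple p) : ℝ × Vec p := (covX w, covZ w)

/-- The index `ζ = X + Zᵀ β`. -/
def index {p : ℕ} (β : Vec p) (w : Triple p) : ℝ := covX w + inner ℝ (covZ w) β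

/-- The response `Y = sign (X + Zᵀ β + ε) ∈ {-1, +1}`. -/
def response {p : ℕ} (β : Vec p) (w : Triple p) : ℝ :=
  if 0 ≤ index β w + noise w then 1 else -1

/-- `F(· ∣ z)`: the conditional distribution function of the noise given `Z = z`. -/
def noiseCDF {p : ℕ} (P : Measure (Triple p)) [IsProbabilityMeasure P] (z : Vec p) (t : ℝ) : ℝ :=
  cdf (condDistrib noise covZ P z) t

/-- The identification conditions on the law `P` of `(X, Z, ε)` for the parameter `β`. -/
structure Identification {p : ℕ} (P : Measure (Triple p)) [IsProbabilityMeasure P]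
    (β : Vec p) : Prop where
  /-- `0` is a median of `ε` given `(X, Z)`. -/
  median_zero : ∀ᵐ w ∂(P.map covXZ),
    1 / 2 ≤ condDistrib noise covXZ P w (Iic 0) ∧ 1 / 2 ≤ condDistrib noise covXZ P w (Ici 0)
  /-- The support of `(X, Z)` is not contained in a proper linear subspace. -/
  full_support : ∀ S : Submodule ℝ (ℝ × Vec p), (P.map covXZ).support ⊆ (S : Set (ℝ × Vec p)) →
    S = ⊤
  /-- `0 < P(Y = -1 ∣ X, Z) < 1` almost surely. -/
  response_nondegenerate : ∀ᵐ w ∂(P.map covXZ),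
    0 < condDistrib (response β) covXZ P w {-1} ∧ condDistrib (response β) covXZ P w {-1} < 1
  /-- Given `Z`, the covariate `X` has an almost everywhere positive density. -/
  positive_density : ∀ᵐ z ∂(P.map covZ), ∃ f : ℝ → ENNReal, Measurable f ∧
    (∀ᵐ x ∂(volume : Measure ℝ), 0 < f x) ∧ condDistrib covX covZ P z = volume.withDensity f

/-- `H` is the integral of a kernel `H'` of order `α`, supported in `[-1, 1]`, with a bounded
Lipschitz derivative `H''`. -/
structure KernelAssumption (α : ℕ) (H : ℝ → ℝ) : Prop where
  two_le : 2 ≤ α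
  differentiable : Differentiable ℝ H
  differentiable_deriv : Differentiable ℝ (deriv H)
  moment_ne_zero : (∫ x in (-1 : ℝ)..1, x ^ α * deriv H x) ≠ 0
  moment_eq_zero : ∀ k : ℕ, 1 ≤ k → k ≤ α - 1 → (∫ x in (-1 : ℝ)..1, x ^ k * deriv H x) = 0
  square_integrable : IntervalIntegrable (fun x => (deriv H x) ^ 2) volume (-1) 1
  bounded_deriv2 : ∃ C : ℝ, ∀ x, |deriv (deriv H) x| ≤ C
  lipschitz_deriv2 : ∃ K : NNReal, LipschitzWith K (deriv (deriv H))
  eq_one : ∀ x, 1 < x → H x = 1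
  eq_zero : ∀ x, x < -1 → H x = 0

/-- On `(-r, r)` the derivatives of `f` of the orders `1, …, N` exist and are bounded by `C`. -/
def HasBoundedDerivs (f : ℝ → ℝ) (N : ℕ) (r C : ℝ) : Prop :=
  ∀ k : ℕ, k < N → ∀ t : ℝ, |t| < r →
    DifferentiableAt ℝ (iteratedDeriv k f) t ∧ |iteratedDeriv (k + 1) f t| ≤ C

/-- `ρ z` is the density of `ζ = X + Zᵀ β` given `Z = z`; it is positive and bounded, and it has
`α` bounded derivatives near `0`, for almost every `z`. -/
structure DensityAssumption {p : ℕ} (P : Measure (Triple p)) [IsProbabilityMeasure P]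
    (β : Vec p) (α : ℕ) (ρ : Vec p → ℝ → ℝ) : Prop where
  isDensity : ∀ᵐ z ∂(P.map covZ), Measurable (ρ z) ∧
    condDistrib (index β) covZ P z = volume.withDensity (fun t => ENNReal.ofReal (ρ z t))
  pos : ∀ᵐ z ∂(P.map covZ), ∀ t, 0 < ρ z t
  bounded : ∃ C : ℝ, ∀ᵐ z ∂(P.map covZ), ∀ t, ρ z t ≤ C
  bounded_derivs : ∃ r > 0, ∃ C : ℝ, ∀ᵐ z ∂(P.map covZ), HasBoundedDerivs (ρ z) α r C

lemma measurable_covX {p : ℕ} : Measurable (covX : Triple p → ℝ) := measurable_fst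

lemma measurable_covZ {p : ℕ} : Measurable (covZ : Triple p → Vec p) :=
  measurable_fst.comp measurable_snd

/-- `ε` and `X` are independent given `Z`, and `F(· ∣ z)` has `α + 1` bounded derivatives near `0`,
for almost every `z`. -/
structure NoiseAssumption {p : ℕ} (P : Measure (Triple p)) [IsProbabilityMeasure P]
    (α : ℕ) : Prop where
  condIndep : CondIndepFun (MeasurableSpace.comap covZ inferInstance) measurable_covZ.comap_le
    (noise : Triple p → ℝ) covX P
  bounded_derivs : ∃ r > 0, ∃ C : ℝ, ∀ᵐ z ∂(P.map covZ),
    HasBoundedDerivs (noiseCDF P z) (α + 1) r C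

/-- The matrix `V = 2 E[ρ(0 ∣ Z) F'(0 ∣ Z) Z Zᵀ]`. -/
def hessianLimit {p : ℕ} (P : Measure (Triple p)) [IsProbabilityMeasure P]
    (ρ : Vec p → ℝ → ℝ) : Matrix (Fin p) (Fin p) ℝ :=
  Matrix.of fun j k =>
    2 * ∫ w, ρ (covZ w) 0 * deriv (noiseCDF P (covZ w)) 0 * (covZ w j * covZ w k) ∂P

/-- The eigenvalues of `V` lie in `(1 / c, c)` for some `c > 0`. -/
def EigenvalueAssumption {p : ℕ} (P : Measure (Triple p)) [IsProbabilityMeasure P]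
    (ρ : Vec p → ℝ → ℝ) : Prop :=
  ∃ c : ℝ, 0 < c ∧ ∀ v : ℝ,
    Module.End.HasEigenvalue (Matrix.toLin' (hessianLimit P ρ)) v → c⁻¹ < v ∧ v < c

/-- The covariate `Z` is bounded in the sup norm. -/
def BoundedCovariates {p : ℕ} (P : Measure (Triple p)) : Prop :=
  ∃ B : ℝ, 0 < B ∧ ∀ᵐ w ∂P, ∀ j, |covZ w j| ≤ B

/-! ### The multi-round smoothed maximum score estimator -/

/-- One observation `(x, z, y)`. -/
structure Datum (p : ℕ) where
  x : ℝ
  z : Vec p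
  y : ℝ

/-- The observed part `(X, Z, Y)` of `(X, Z, ε)` when the parameter is `β`. -/
def observe {p : ℕ} (β : Vec p) (w : Triple p) : Datum p := ⟨covX w, covZ w, response β w⟩

/-- The gradient `U_{m,ℓ}` computed at `b` with bandwidth `h` on machine `ℓ`, which stores the
observations `ℓ m, …, ℓ m + m - 1`. -/
def localGradient {p : ℕ} (H : ℝ → ℝ) (h : ℝ) (m ℓ : ℕ) (data : ℕ → Datum p) (b : Vec p) :
    Fin p → ℝ :=
  fun j => 1 / ((m : ℝ) * h) * ∑ i ∈ Finset.Ico (ℓ * m) (ℓ * m + m),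
    -(data i).y * deriv H (((data i).x + inner ℝ (data i).z b) / h) * (data i).z j

/-- The Hessian `V_{m,ℓ}` computed at `b` with bandwidth `h` on machine `ℓ`. -/
def localHessian {p : ℕ} (H : ℝ → ℝ) (h : ℝ) (m ℓ : ℕ) (data : ℕ → Datum p) (b : Vec p) :
    Matrix (Fin p) (Fin p) ℝ :=
  Matrix.of fun j k => 1 / ((m : ℝ) * h ^ 2) * ∑ i ∈ Finset.Ico (ℓ * m) (ℓ * m + m),
    -(data i).y * deriv (deriv H) (((data i).x + inner ℝ (data i).z b) / h) *
      ((data i).z j * (data i).z k)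

/-- The average of the local gradients over the `L` machines. -/
def gradient {p : ℕ} (H : ℝ → ℝ) (h : ℝ) (m L : ℕ) (data : ℕ → Datum p) (b : Vec p) :
    Fin p → ℝ :=
  (1 / (L : ℝ)) • ∑ ℓ ∈ Finset.range L, localGradient H h m ℓ data b

/-- The average of the local Hessians over the `L` machines. -/
def hessian {p : ℕ} (H : ℝ → ℝ) (h : ℝ) (m L : ℕ) (data : ℕ → Datum p) (b : Vec p) :
    Matrix (Fin p) (Fin p) ℝ :=
  (1 / (L : ℝ)) • ∑ ℓ ∈ Finset.range L, localHessian H h m ℓ data b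

/-- The iterates of the estimator started at `b₀`, with bandwidth `h t` in round `t = 1, 2, …`.
By the convention for the inverse of a singular matrix, a round in which the averaged Hessian is
singular leaves the iterate unchanged. -/
def iterate {p : ℕ} (H : ℝ → ℝ) (h : ℕ → ℝ) (m L : ℕ) (data : ℕ → Datum p) (b₀ : Vec p) :
    ℕ → Vec p
  | 0 => b₀
  | t + 1 =>
    let b := iterate H h m L data b₀ t
    b - WithLp.toLp 2
      (Matrix.mulVec (hessian H (h (t + 1)) m L data b)⁻¹ (gradient H (h (t + 1)) m L data b))

/-- The bandwidth `h_t = max ((λ / n) ^ (1 / (2 α + 1))) (m ^ (-2 ^ t / (3 α)))`. -/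
def bandwidth (α : ℕ) (lam : ℝ) (n m t : ℕ) : ℝ :=
  max ((lam / (n : ℝ)) ^ (1 / (2 * (α : ℝ) + 1))) ((m : ℝ) ^ (-(2 : ℝ) ^ t / (3 * (α : ℝ))))

/-- The number `log₂ (6 α / (2 α + 1) * (log n - log λ) / log m)`. -/
def roundBound (α : ℕ) (lam : ℝ) (n m : ℕ) : ℝ :=
  Real.logb 2
    (6 * (α : ℝ) / (2 * (α : ℝ) + 1) * ((Real.log n - Real.log lam) / Real.log m))

/-! ### Stochastic order and sampling -/

/-- `A k = O_P(a k)` as `k → ∞`. -/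
def IsBigOP {Ω : Type*} [MeasurableSpace Ω] (μ : Measure Ω) (A : ℕ → Ω → ℝ) (a : ℕ → ℝ) : Prop :=
  ∀ ε : ℝ, 0 < ε → ∃ M : ℝ, ∀ᶠ k in atTop, μ {ω | M * a k < |A k ω|} ≤ ENNReal.ofReal ε

/-- `D 0, D 1, …` are independent with common law `P`. -/
structure IsSample {Ω : Type*} [MeasurableSpace Ω] (μ : Measure Ω) {p : ℕ}
    (D : ℕ → Ω → Triple p) (P : Measure (Triple p)) : Prop where
  measurable : ∀ i, Measurable (D i)
  indep : iIndepFun D μ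
  law : ∀ i, μ.map (D i) = P

end

end MultiRoundSMSE

/-! Write `d = b - β` for the current error and `g(t) = (2 F(-t | z) - 1) ρ(t | z)`
(`signedDensity`): the conditional mean of `-Y` at index value `t`, times the density of the index.
The median condition gives `g(0) = 0` and `-g'(0) = 2 ρ(0 | z) F'(0 | z)`. Given `Z = z`, with `s =
zᵀ d`, the gradient and the Hessian have means `z ∫ g(hu - s) H'(u) du` and `z zᵀ h⁻¹ ∫ g(hu - s)
H''(u) du`. Integration by parts turns the second integral into `-∫ g'(hu - s) H'(u) du`, so the
mean Hessian is close to `V`, and mean Hessian times `d` minus mean gradient is the average of `-z ∫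
(g + s g')(hu - s) H'(u) du`. Since `(g + s g')(hu - s) = g(hu) + O(s²)` and `H'` has vanishing
moments, this is `O(h^α + |d|²)`: a Newton step squares the error up to the smoothing bias
(`abs_smooth_newton_le`, `abs_newton_bias_le`).

The iterates depend on the data, so sampling errors are needed uniformly in `b`. For the Hessian,
Bernstein's inequality on a lattice and a Lipschitz bound give the order `x = n^(-(α-1)/(2α+1))
√(log n)`. For the gradient, Chebyshev's inequality at the single point `β` gives the order `Q =
n^(-α/(2α+1))` without a logarithm; the change from `β` to `b` integrates the Hessian deviation
along a segment and costs only `x |d|` (`abs_gradDev_sub_le`). Off a bad event the errors thus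
satisfy `e (t+1) ≤ C (Q + m^(-2^(t+1)/3) + e t ^ 2 + x * e t)` (`exists_round_bounds`).

Starting from order `m^(-1/3)`, `error_recursion` maintains `e t ≤ A Q + w t ^ 2 + w t * x` with `w
t = s (K m^(-1/6))^(2^t)`. It closes because `w t ^ 2` is proportional to `w (t+1)` and because `x³
= o(Q)`, which is where `α ≥ 2` enters. For fixed `t` this is (i). For a varying number of rounds
one bad event must serve all rounds: bandwidths above the floor `(λ/n)^(1/(2α+1))` at least halve
each time, so their failure probabilities sum geometrically, and the remaining rounds share a single
bandwidth (`measure_iUnion_bandwidth_le`). After `τ` rounds `w` is at most a multiple of `Q^(3/4)`,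
whence `w²` and `w x` are `O(Q)`, which is (ii). -/

namespace MultiRoundSMSE

noncomputable section

/-! ### Functions with bounded derivatives near the origin -/

/-- `f` is `N` times differentiable on `(-r, r)`, and `f` and its derivatives are bounded by `C`
there. The derivatives are given up to equality on `(-r, r)`. -/
def HasDerivBounds : ℕ → ℝ → ℝ → (ℝ → ℝ) → Prop
  | 0, r, C, f => ∀ t, |t| < r → |f t| ≤ C
  | N + 1, r, C, f => (∀ t, |t| < r → |f t| ≤ C) ∧
      ∃ f' : ℝ → ℝ, (∀ t, |t| < r → HasDerivAt f (f' t) t) ∧ HasDerivBounds N r C f'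

namespace HasDerivBounds

lemma bound {N : ℕ} {r C : ℝ} {f : ℝ → ℝ} (hf : HasDerivBounds N r C f) {t : ℝ} (ht : |t| < r) :
    |f t| ≤ C := by
  cases N with
  | zero => exact hf t ht
  | succ N => exact hf.1 t ht

lemma mono {N : ℕ} {r r' C C' : ℝ} {f : ℝ → ℝ} (hf : HasDerivBounds N r C f) (hr : r' ≤ r)
    (hC : C ≤ C') : HasDerivBounds N r' C' f := by
  induction N generalizing f with
  | zero => exact fun t ht => (hf t (ht.trans_le hr)).trans hC
  | succ N ih =>
    obtain ⟨h0, f', hf', hN⟩ := hf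
    exact ⟨fun t ht => (h0 t (ht.trans_le hr)).trans hC, f',
      fun t ht => hf' t (ht.trans_le hr), ih hN⟩

lemma of_succ {N : ℕ} {r C : ℝ} {f : ℝ → ℝ} (hf : HasDerivBounds (N + 1) r C f) :
    HasDerivBounds N r C f := by
  induction N generalizing f with
  | zero => exact hf.1
  | succ N ih =>
    obtain ⟨h0, f', hf', hN⟩ := hf
    exact ⟨h0, f', hf', ih hN⟩

lemma of_le {N N' : ℕ} {r C : ℝ} {f : ℝ → ℝ} (hf : HasDerivBounds N r C f) (h : N' ≤ N) :
    HasDerivBounds N' r C f := by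
  induction h with
  | refl => exact hf
  | step _ ih => exact ih hf.of_succ

lemma const (N : ℕ) (r c : ℝ) : HasDerivBounds N r |c| (fun _ => c) := by
  induction N generalizing c with
  | zero => exact fun _ _ => le_rfl
  | succ N ih =>
    exact ⟨fun _ _ => le_rfl, fun _ => 0, fun t _ => hasDerivAt_const t c,
      (ih 0).mono le_rfl (by simp)⟩

lemma add {N : ℕ} {r C₁ C₂ : ℝ} {f g : ℝ → ℝ} (hf : HasDerivBounds N r C₁ f)
    (hg : HasDerivBounds N r C₂ g) : HasDerivBounds N r (C₁ + C₂) (fun t => f t + g t) := by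
  induction N generalizing f g with
  | zero => exact fun t ht => (abs_add_le _ _).trans (add_le_add (hf t ht) (hg t ht))
  | succ N ih =>
    obtain ⟨hf0, f', hf', hfN⟩ := hf
    obtain ⟨hg0, g', hg', hgN⟩ := hg
    exact ⟨fun t ht => (abs_add_le _ _).trans (add_le_add (hf0 t ht) (hg0 t ht)),
      fun t => f' t + g' t, fun t ht => (hf' t ht).add (hg' t ht), ih hfN hgN⟩

/-- Each application of the product rule doubles the number of products, whence the factor `2 ^ N`.
-/
lemma mul {N : ℕ} {r C₁ C₂ : ℝ} {f g : ℝ → ℝ} (h₁ : 0 ≤ C₁) (h₂ : 0 ≤ C₂)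
    (hf : HasDerivBounds N r C₁ f) (hg : HasDerivBounds N r C₂ g) :
    HasDerivBounds N r (2 ^ N * (C₁ * C₂)) (fun t => f t * g t) := by
  have key : ∀ t, |t| < r → |f t * g t| ≤ C₁ * C₂ := fun t ht => by
    rw [abs_mul]
    exact mul_le_mul (hf.bound ht) (hg.bound ht) (abs_nonneg _) h₁
  induction N generalizing f g with
  | zero => simpa [HasDerivBounds] using key
  | succ N ih =>
    have hf1 := hf.of_succ
    have hg1 := hg.of_succ
    obtain ⟨hf0, f', hf', hfN⟩ := hf
    obtain ⟨hg0, g', hg', hgN⟩ := hg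
    refine ⟨fun t ht => (key t ht).trans ?_, fun t => f' t * g t + f t * g' t,
      fun t ht => (hf' t ht).mul (hg' t ht), ?_⟩
    · exact le_mul_of_one_le_left (mul_nonneg h₁ h₂) (one_le_pow₀ one_le_two)
    · have e1 := ih hfN hg1 fun t ht => by
        rw [abs_mul]; exact mul_le_mul (hfN.bound ht) (hg0 t ht) (abs_nonneg _) h₁
      have e2 := ih hf1 hgN fun t ht => by
        rw [abs_mul]; exact mul_le_mul (hf0 t ht) (hgN.bound ht) (abs_nonneg _) h₁
      refine (e1.add e2).mono le_rfl (le_of_eq ?_)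
      ring

lemma comp_neg {N : ℕ} {r C : ℝ} {f : ℝ → ℝ} (hC : 0 ≤ C) (hf : HasDerivBounds N r C f) :
    HasDerivBounds N r (2 ^ N * C) (fun t => f (-t)) := by
  induction N generalizing f with
  | zero => exact fun t ht => by simpa using hf (-t) (by rwa [abs_neg])
  | succ N ih =>
    obtain ⟨hf0, f', hf', hfN⟩ := hf
    refine ⟨fun t ht => (hf0 (-t) (by rwa [abs_neg])).trans
      (le_mul_of_one_le_left hC (one_le_pow₀ one_le_two)), fun t => -1 * f' (-t),
      fun t ht => ?_, ?_⟩
    · have := (hf' (-t) (by rwa [abs_neg])).comp t (hasDerivAt_neg t)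
      simpa [Function.comp_def] using this
    · have h1 := (const N r (-1)).mul (abs_nonneg _) (by positivity) (ih hfN)
      cases N with
      | zero => exact h1.mono le_rfl (by norm_num; linarith)
      | succ N =>
        clear h1
        have : ∀ (M : ℕ) (D : ℝ) (u : ℝ → ℝ), HasDerivBounds M r D u →
            HasDerivBounds M r D (fun t => -1 * u t) := by
          intro M D u hu
          induction M generalizing u with
          | zero => exact fun t ht => by simpa using hu t ht
          | succ M ihM =>
            obtain ⟨hu0, u', hu', huM⟩ := hu
            exact ⟨fun t ht => by simpa using hu0 t ht, fun t => -1 * u' t,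
              fun t ht => (hu' t ht).const_mul _, ihM _ huM⟩
        refine (this _ _ _ (ih hfN)).mono le_rfl ?_
        exact mul_le_mul_of_nonneg_right (pow_le_pow_right₀ one_le_two (Nat.le_succ _)) hC

lemma of_hasBoundedDerivs {f : ℝ → ℝ} {N : ℕ} {r C : ℝ} (hf : HasBoundedDerivs f N r C)
    (h0 : ∀ t, |t| < r → |f t| ≤ C) : HasDerivBounds N r C f := by
  have key : ∀ j k, j + k = N → (∀ t, |t| < r → |iteratedDeriv k f t| ≤ C) →
      HasDerivBounds j r C (iteratedDeriv k f) := by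
    intro j
    induction j with
    | zero => exact fun k _ h => h
    | succ j ih =>
      intro k hk h
      refine ⟨h, iteratedDeriv (k + 1) f, fun t ht => ?_, ih (k + 1) (by omega)
        fun t ht => (hf k (by omega) t ht).2⟩
      rw [iteratedDeriv_succ]
      exact (hf k (by omega) t ht).1.hasDerivAt
  simpa using key N 0 (by omega) (by simpa using h0)

/-- Taylor expansion at the origin. -/
lemma exists_taylor {N : ℕ} {r C : ℝ} {g : ℝ → ℝ} (hr : 0 < r) (hg : HasDerivBounds N r C g) :
    ∃ c : ℕ → ℝ, (0 < N → c 0 = g 0) ∧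
      ∀ t, |t| < r → |g t - ∑ k ∈ Finset.range N, c k * t ^ k| ≤ C * |t| ^ N := by
  induction N generalizing g with
  | zero => exact ⟨fun _ => 0, by simp, fun t ht => by simpa using hg t ht⟩
  | succ N ih =>
    have hC : 0 ≤ C := (abs_nonneg _).trans (hg.bound (t := 0) (by simpa using hr))
    obtain ⟨hg0, g', hg', hN⟩ := hg
    obtain ⟨c, -, hc⟩ := ih hN
    -- The expansion of `g'` is integrated term by term, so `c k` moves to degree `k + 1` with
    -- divisor `k + 1`. The mean value inequality for the remainder `D`, which vanishes at `0`, then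
    -- gains one power of `|t|`.
    refine ⟨fun k => if k = 0 then g 0 else c (k - 1) / k, by simp, fun t ht => ?_⟩
    set D : ℝ → ℝ := fun t => g t - ∑ k ∈ Finset.range (N + 1),
      (if k = 0 then g 0 else c (k - 1) / k) * t ^ k with hD
    have hD0 : D 0 = 0 := by
      simp [hD, Finset.sum_range_succ']
    have hDd : ∀ u, |u| < r → HasDerivAt D (g' u - ∑ k ∈ Finset.range N, c k * u ^ k) u := by
      intro u hu
      refine (hg' u hu).sub ?_
      have h1 : HasDerivAt (fun t : ℝ => ∑ k ∈ Finset.range (N + 1),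
          (if k = 0 then g 0 else c (k - 1) / k) * t ^ k)
          (∑ k ∈ Finset.range (N + 1), (if k = 0 then g 0 else c (k - 1) / k) *
            (k * u ^ (k - 1))) u :=
        HasDerivAt.fun_sum fun k _ => (hasDerivAt_pow k u).const_mul _
      convert! h1 using 1
      rw [Finset.sum_range_succ']
      simp only [Nat.add_eq_zero_iff, one_ne_zero, and_false, if_false, Nat.add_sub_cancel,
        Nat.cast_zero, zero_mul, mul_zero, add_zero]
      refine Finset.sum_congr rfl fun k _ => ?_
      have : ((k + 1 : ℕ) : ℝ) ≠ 0 := by positivity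
      field_simp
    have hseg : ∀ u ∈ uIcc 0 t, |u| ≤ |t| := fun u hu => by
      have := abs_sub_left_of_mem_uIcc hu
      simpa using this
    have := (convex_uIcc (0 : ℝ) t).norm_image_sub_le_of_norm_hasDerivWithin_le
      (f := D) (f' := fun u => g' u - ∑ k ∈ Finset.range N, c k * u ^ k) (C := C * |t| ^ N)
      (fun u hu => (hDd u ((hseg u hu).trans_lt ht)).hasDerivWithinAt)
      (fun u hu => by
        refine (hc u ((hseg u hu).trans_lt ht)).trans ?_
        exact mul_le_mul_of_nonneg_left (pow_le_pow_left₀ (abs_nonneg _) (hseg u hu) _) hC) left_mem_uIcc right_mem_uIcc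
    rw [hD0, sub_zero, sub_zero, Real.norm_eq_abs, Real.norm_eq_abs] at this
    rw [pow_succ, ← mul_assoc]
    exact this

end HasDerivBounds

/-! ### Properties of the smoothing kernel -/

/-- Continuity extends the vanishing to the endpoints `±1`; this removes the boundary terms in the
integration by parts. -/
lemma eq_zero_of_one_le_abs {f : ℝ → ℝ} (hf : Continuous f) (h : ∀ x, 1 < |x| → f x = 0)
    {x : ℝ} (hx : 1 ≤ |x|) : f x = 0 := by
  have hs : IsClosed {x | f x = 0} := isClosed_eq hf continuous_const
  have h1 : Ioi (1 : ℝ) ⊆ {x | f x = 0} := fun y hy => h y (lt_of_lt_of_le hy (le_abs_self y))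
  have h2 : Iio (-1 : ℝ) ⊆ {x | f x = 0} := fun y hy =>
    h y (by rw [lt_abs]; right; rw [mem_Iio] at hy; linarith)
  have h1' := hs.closure_subset_iff.2 h1
  have h2' := hs.closure_subset_iff.2 h2
  rw [closure_Ioi] at h1'
  rw [closure_Iio] at h2'
  rcases le_abs.1 hx with h | h
  · exact h1' h
  · exact h2' (by rw [mem_Iic]; linarith)

namespace KernelAssumption

variable {α : ℕ} {H : ℝ → ℝ}

lemma continuous_deriv (hH : KernelAssumption α H) : Continuous (deriv H) :=
  hH.differentiable_deriv.continuous

lemma continuous_deriv2 (hH : KernelAssumption α H) : Continuous (deriv (deriv H)) := by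
  obtain ⟨K, hK⟩ := hH.lipschitz_deriv2
  exact hK.continuous

lemma deriv_eq_zero (hH : KernelAssumption α H) {x : ℝ} (hx : 1 ≤ |x|) : deriv H x = 0 := by
  refine eq_zero_of_one_le_abs hH.continuous_deriv (fun y hy => ?_) hx
  rcases lt_abs.1 hy with h | h
  · have : H =ᶠ[𝓝 y] fun _ => 1 := by
      filter_upwards [lt_mem_nhds h] with z hz using hH.eq_one z hz
    rw [this.deriv_eq, deriv_const]
  · have : H =ᶠ[𝓝 y] fun _ => 0 := by
      filter_upwards [gt_mem_nhds (show y < -1 by linarith)] with z hz using hH.eq_zero z hz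
    rw [this.deriv_eq, deriv_const]

lemma deriv2_eq_zero (hH : KernelAssumption α H) {x : ℝ} (hx : 1 ≤ |x|) :
    deriv (deriv H) x = 0 := by
  refine eq_zero_of_one_le_abs hH.continuous_deriv2 (fun y hy => ?_) hx
  have : deriv H =ᶠ[𝓝 y] fun _ => 0 := by
    filter_upwards [(isOpen_lt continuous_const continuous_abs).mem_nhds hy] with z hz
      using hH.deriv_eq_zero (le_of_lt hz)
  rw [this.deriv_eq, deriv_const]

/-- A common bound for `H'`, `H''` and the Lipschitz constant of `H''`. -/
lemma exists_bound (hH : KernelAssumption α H) : ∃ K : ℝ, 0 < K ∧ (∀ x, |deriv H x| ≤ K) ∧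
    (∀ x, |deriv (deriv H) x| ≤ K) ∧
    ∀ x y, |deriv (deriv H) x - deriv (deriv H) y| ≤ K * |x - y| := by
  obtain ⟨C, hC⟩ := hH.bounded_deriv2
  obtain ⟨L, hL⟩ := hH.lipschitz_deriv2
  obtain ⟨D, hD⟩ := isCompact_Icc.exists_bound_of_continuousOn (s := Icc (-1 : ℝ) 1)
    hH.continuous_deriv.continuousOn
  refine ⟨|C| + L + |D| + 1, by positivity, fun x => ?_, fun x => ?_, fun x y => ?_⟩
  · have hLn := L.2
    by_cases hx : |x| ≤ 1
    · have := hD x (abs_le.1 hx)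
      rw [Real.norm_eq_abs] at this
      have := le_abs_self D
      have := abs_nonneg C
      simp only [NNReal.val_eq_coe] at hLn
      linarith
    · rw [hH.deriv_eq_zero (not_le.1 hx).le, abs_zero]
      positivity
  · have := hC x
    have := le_abs_self C
    have := abs_nonneg D
    have hLn : (0 : ℝ) ≤ L := L.2
    linarith
  · have h1 := hL.dist_le_mul x y
    rw [Real.dist_eq, Real.dist_eq] at h1
    refine h1.trans (mul_le_mul_of_nonneg_right ?_ (abs_nonneg _))
    have := abs_nonneg C
    have := abs_nonneg D
    linarith

lemma integral_deriv (hH : KernelAssumption α H) : ∫ x in (-1 : ℝ)..1, deriv H x = 1 := by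
  rw [intervalIntegral.integral_deriv_eq_sub (fun x _ => hH.differentiable x)
    (hH.continuous_deriv.intervalIntegrable _ _)]
  have hc := hH.differentiable.continuous
  have h1 : H 1 = 1 := by
    have hs : IsClosed {x | H x = 1} := isClosed_eq hc continuous_const
    have := hs.closure_subset_iff.2 (fun y (hy : y ∈ Ioi (1 : ℝ)) => hH.eq_one y hy)
    rw [closure_Ioi] at this
    exact this (mem_Ici.2 le_rfl)
  have h2 : H (-1) = 0 := by
    have hs : IsClosed {x | H x = 0} := isClosed_eq hc continuous_const
    have := hs.closure_subset_iff.2 (fun y (hy : y ∈ Iio (-1 : ℝ)) => hH.eq_zero y hy)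
    rw [closure_Iio] at this
    exact this (mem_Iic.2 le_rfl)
  rw [h1, h2, sub_zero]

end KernelAssumption

/-! ### Smoothing -/

lemma abs_sub_le_of_deriv_bound {g g' : ℝ → ℝ} {r C : ℝ}
    (hg : ∀ t, |t| < r → HasDerivAt g (g' t) t) (hg' : ∀ t, |t| < r → |g' t| ≤ C)
    {a b : ℝ} (ha : |a| < r) (hb : |b| < r) : |g b - g a| ≤ C * |b - a| := by
  have hs : ∀ u ∈ uIcc a b, |u| < r := fun u hu => by
    rw [abs_lt] at *
    rcases mem_uIcc.1 hu with h | h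
    · exact ⟨by linarith, by linarith⟩
    · exact ⟨by linarith, by linarith⟩
  exact (convex_uIcc a b).norm_image_sub_le_of_norm_hasDerivWithin_le
    (fun u hu => (hg u (hs u hu)).hasDerivWithinAt) (fun u hu => hg' u (hs u hu))
    left_mem_uIcc right_mem_uIcc

/-- Mean value inequality for `u ↦ g u - g' a * u`, whose derivative `g' u - g' a` is at most `C *
|b - a|`. The usual factor `1/2` is given up, and `g''` need not be continuous. -/
lemma abs_sub_sub_mul_le {g g' g'' : ℝ → ℝ} {r C : ℝ} (hC : 0 ≤ C)
    (hg : ∀ t, |t| < r → HasDerivAt g (g' t) t) (hg' : ∀ t, |t| < r → HasDerivAt g' (g'' t) t)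
    (hg'' : ∀ t, |t| < r → |g'' t| ≤ C) {a b : ℝ} (ha : |a| < r) (hb : |b| < r) :
    |g b - g a - g' a * (b - a)| ≤ C * |b - a| ^ 2 := by
  have hs : ∀ u ∈ uIcc a b, |u| < r := fun u hu => by
    rw [abs_lt] at *
    rcases mem_uIcc.1 hu with h | h
    · exact ⟨by linarith, by linarith⟩
    · exact ⟨by linarith, by linarith⟩
  have := (convex_uIcc a b).norm_image_sub_le_of_norm_hasDerivWithin_le
    (f := fun u => g u - g' a * u) (f' := fun u => g' u - g' a) (C := C * |b - a|)
    (fun u hu => by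
      have := ((hg u (hs u hu)).fun_sub ((hasDerivAt_id u).const_mul (g' a))).hasDerivWithinAt
        (s := uIcc a b)
      simpa using this)
    (fun u hu => by
      refine (abs_sub_le_of_deriv_bound hg' hg'' ha (hs u hu)).trans ?_
      exact mul_le_mul_of_nonneg_left (abs_sub_left_of_mem_uIcc hu) hC)
    left_mem_uIcc right_mem_uIcc
  rw [Real.norm_eq_abs, Real.norm_eq_abs] at this
  rw [pow_two, ← mul_assoc]
  convert! this using 2
  ring

lemma abs_scale_lt {h s r u : ℝ} (hh : 0 < h) (hr : h + |s| < r) (hu : u ∈ uIcc (-1 : ℝ) 1) :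
    |h * u - s| < r := by
  rw [uIcc_of_le (by norm_num)] at hu
  have h1 : |h * u| ≤ h := by
    rw [abs_mul, abs_of_pos hh]
    exact mul_le_of_le_one_right hh.le (abs_le.2 hu)
  exact ((abs_sub _ _).trans (by linarith)).trans_lt hr

lemma abs_integral_mul_le {f k : ℝ → ℝ} {A K : ℝ} (hA : 0 ≤ A)
    (hf : ∀ u ∈ uIcc (-1 : ℝ) 1, |f u| ≤ A) (hk : ∀ u, |k u| ≤ K) :
    |∫ u in (-1 : ℝ)..1, f u * k u| ≤ 2 * (A * K) := by
  have := intervalIntegral.norm_integral_le_of_norm_le_const (a := (-1 : ℝ)) (b := 1)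
    (f := fun u => f u * k u) (C := A * K) (fun u hu => by
      rw [Real.norm_eq_abs, abs_mul]
      exact mul_le_mul (hf u (uIoc_subset_uIcc hu)) (hk u) (abs_nonneg _) hA)
  rw [Real.norm_eq_abs] at this
  norm_num at this
  linarith

/-- Integration by parts against the kernel. -/
lemma integral_deriv2_eq {α : ℕ} {H : ℝ → ℝ} (hH : KernelAssumption α H) {g g' : ℝ → ℝ}
    {r h s : ℝ} (hh : 0 < h) (hr : h + |s| < r) (hg : ∀ t, |t| < r → HasDerivAt g (g' t) t)
    (hg' : ∀ t, |t| < r → ContinuousAt g' t) :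
    1 / h * ∫ u in (-1 : ℝ)..1, g (h * u - s) * deriv (deriv H) u =
      -∫ u in (-1 : ℝ)..1, g' (h * u - s) * deriv H u := by
  have hcomp : ∀ u, HasDerivAt (fun u : ℝ => h * u - s) h u := fun u => by
    simpa using ((hasDerivAt_id u).const_mul h).sub_const s
  have key := intervalIntegral.integral_mul_deriv_eq_deriv_mul (a := (-1 : ℝ)) (b := 1)
    (u := fun u => g (h * u - s)) (u' := fun u => g' (h * u - s) * h) (v := deriv H)
    (v' := deriv (deriv H))
    (fun u hu => (hg _ (abs_scale_lt hh hr hu)).comp u (hcomp u))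
    (fun u _ => (hH.differentiable_deriv u).hasDerivAt)
    (ContinuousOn.intervalIntegrable fun u hu => ContinuousAt.continuousWithinAt <|
      (ContinuousAt.comp (f := fun u : ℝ => h * u - s) (hg' _ (abs_scale_lt hh hr hu))
        (hcomp u).continuousAt).mul continuousAt_const)
    (hH.continuous_deriv2.intervalIntegrable _ _)
  rw [key, hH.deriv_eq_zero (x := 1) (by norm_num), hH.deriv_eq_zero (x := -1) (by norm_num)]
  have : (fun u => g' (h * u - s) * h * deriv H u) =
      fun u => h * (g' (h * u - s) * deriv H u) := by
    ext u; ring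
  rw [this, intervalIntegral.integral_const_mul]
  field_simp
  ring

/-- The smoothed second derivative is close to the derivative at the origin. -/
lemma abs_smooth_deriv2_add_le {α : ℕ} {H : ℝ → ℝ} (hH : KernelAssumption α H) {K : ℝ}
    (hK : ∀ x, |deriv H x| ≤ K) {g : ℝ → ℝ} {r C h s : ℝ} (hr0 : 0 < r) (hC : 0 ≤ C)
    (hg : HasDerivBounds 2 r C g) (hh : 0 < h) (hr : h + |s| < r) :
    |1 / h * (∫ u in (-1 : ℝ)..1, g (h * u - s) * deriv (deriv H) u) + deriv g 0| ≤
      2 * C * K * (h + |s|) := by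
  obtain ⟨-, g', hg', -, g'', hg'', hb⟩ := hg
  have hd0 : deriv g 0 = g' 0 := (hg' 0 (by simpa using hr0)).deriv
  rw [integral_deriv2_eq hH hh hr hg' fun t ht => (hg'' t ht).continuousAt, hd0]
  have hint : IntervalIntegrable (fun u => g' (h * u - s) * deriv H u) volume (-1) 1 := by
    refine ContinuousOn.intervalIntegrable fun u hu => ContinuousAt.continuousWithinAt ?_
    exact (ContinuousAt.comp (f := fun u : ℝ => h * u - s)
      (hg'' _ (abs_scale_lt hh hr hu)).continuousAt (by fun_prop)).mul
      hH.continuous_deriv.continuousAt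
  -- As `H'` has integral one, the constant `g' 0` can be taken under the integral, where the
  -- Lipschitz bound for `g'` applies.
  have h1 : -(∫ u in (-1 : ℝ)..1, g' (h * u - s) * deriv H u) + g' 0 =
      -∫ u in (-1 : ℝ)..1, (g' (h * u - s) - g' 0) * deriv H u := by
    have : (∫ u in (-1 : ℝ)..1, (g' (h * u - s) - g' 0) * deriv H u) =
        (∫ u in (-1 : ℝ)..1, g' (h * u - s) * deriv H u) - g' 0 := by
      simp_rw [sub_mul]
      rw [intervalIntegral.integral_sub hint
        ((hH.continuous_deriv.intervalIntegrable _ _).const_mul _),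
        intervalIntegral.integral_const_mul, hH.integral_deriv, mul_one]
    rw [this]; ring
  rw [h1, abs_neg]
  have := abs_integral_mul_le (f := fun u => g' (h * u - s) - g' 0) (k := deriv H)
    (A := C * (h + |s|)) (by positivity) (fun u hu => by
      refine (abs_sub_le_of_deriv_bound hg'' hb (by simpa using hr0)
        (abs_scale_lt hh hr hu)).trans ?_
      rw [sub_zero]
      refine mul_le_mul_of_nonneg_left ?_ hC
      rw [uIcc_of_le (by norm_num)] at hu
      have h1 : |h * u| ≤ h := by
        rw [abs_mul, abs_of_pos hh]
        exact mul_le_of_le_one_right hh.le (abs_le.2 hu)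
      exact (abs_sub _ _).trans (by linarith)) hK
  linarith

/-- The bias of a Newton step: a kernel of order `α` gains `h ^ α`, and the linearisation costs
`s ^ 2`. -/
lemma abs_smooth_newton_le {α : ℕ} {H : ℝ → ℝ} (hH : KernelAssumption α H) {K : ℝ}
    (hK : ∀ x, |deriv H x| ≤ K) {g : ℝ → ℝ} {r C h s : ℝ} (hr0 : 0 < r) (hC : 0 ≤ C)
    (hg : HasDerivBounds α r C g) (hg0 : g 0 = 0) (hh : 0 < h) (hr : h + |s| < r) :
    |s * (1 / h * ∫ u in (-1 : ℝ)..1, g (h * u - s) * deriv (deriv H) u) -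
      ∫ u in (-1 : ℝ)..1, g (h * u - s) * deriv H u| ≤ 2 * C * K * (h ^ α + s ^ 2) := by
  obtain ⟨c, hc0, hc⟩ := hg.exists_taylor hr0
  replace hc0 : c 0 = 0 := by rw [hc0 (by have := hH.two_le; omega), hg0]
  obtain ⟨-, g', hg', -, g'', hg'', hb⟩ := hg.of_le hH.two_le
  rw [integral_deriv2_eq hH hh hr hg' fun t ht => (hg'' t ht).continuousAt]
  have hr' : h + |(0 : ℝ)| < r := by
    rw [abs_zero]; have := abs_nonneg s; linarith
  have hcont : ∀ {f f' : ℝ → ℝ} {s : ℝ}, h + |s| < r → (∀ t, |t| < r → HasDerivAt f (f' t) t) →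
      ContinuousOn (fun u => f (h * u - s)) (uIcc (-1 : ℝ) 1) := fun hs hf u hu =>
    ContinuousAt.continuousWithinAt (ContinuousAt.comp (f := fun u : ℝ => h * u - _)
      (hf _ (abs_scale_lt hh hs hu)).continuousAt (by fun_prop))
  have hHc := hH.continuous_deriv.continuousOn (s := uIcc (-1 : ℝ) 1)
  have i1 : IntervalIntegrable (fun u => g' (h * u - s) * deriv H u) volume (-1) 1 :=
    ((hcont hr hg'').mul hHc).intervalIntegrable
  have i2 : IntervalIntegrable (fun u => g (h * u - s) * deriv H u) volume (-1) 1 :=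
    ((hcont hr hg').mul hHc).intervalIntegrable
  have i3 : IntervalIntegrable (fun u => g (h * u - 0) * deriv H u) volume (-1) 1 :=
    ((hcont hr' hg').mul hHc).intervalIntegrable
  have i4 : IntervalIntegrable (fun u => (∑ k ∈ Finset.range α, c k * (h * u - 0) ^ k) * deriv H u)
      volume (-1) 1 :=
    (ContinuousOn.mul (by fun_prop) hHc).intervalIntegrable
  -- The constant term vanishes because `g 0 = 0`, and the degrees `1, …, α - 1` because of the
  -- moment conditions on `H'`.
  have hpoly : ∫ u in (-1 : ℝ)..1, (∑ k ∈ Finset.range α, c k * (h * u - 0) ^ k) * deriv H u = 0 := by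
    simp_rw [Finset.sum_mul]
    rw [intervalIntegral.integral_finsetSum]
    · refine Finset.sum_eq_zero fun k hk => ?_
      rcases Nat.eq_zero_or_pos k with rfl | hk0
      · simp [hc0]
      · have : (fun u => c k * (h * u - 0) ^ k * deriv H u) =
            fun u => (c k * h ^ k) * (u ^ k * deriv H u) := by
          ext u; rw [sub_zero, mul_pow]; ring
        rw [this, intervalIntegral.integral_const_mul,
          hH.moment_eq_zero k hk0 (by have := Finset.mem_range.1 hk; omega), mul_zero]
    · intro k _
      exact (ContinuousOn.mul (by fun_prop) hHc).intervalIntegrable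
  -- `g (h * u)` is added and subtracted: the first integrand is the first-order Taylor remainder
  -- from `h * u - s` to `h * u`, of order `s ^ 2`; the second is the remainder of `g` at `0`, of
  -- order `h ^ α`.
  have hsplit : s * -(∫ u in (-1 : ℝ)..1, g' (h * u - s) * deriv H u) -
      ∫ u in (-1 : ℝ)..1, g (h * u - s) * deriv H u =
      (∫ u in (-1 : ℝ)..1, (g (h * u - 0) - g (h * u - s) -
        g' (h * u - s) * ((h * u - 0) - (h * u - s))) * deriv H u) -
      ∫ u in (-1 : ℝ)..1, (g (h * u - 0) - ∑ k ∈ Finset.range α, c k * (h * u - 0) ^ k) *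
        deriv H u := by
    have e1 : (fun u => (g (h * u - 0) - g (h * u - s) -
        g' (h * u - s) * ((h * u - 0) - (h * u - s))) * deriv H u) =
        fun u => (g (h * u - 0) * deriv H u - g (h * u - s) * deriv H u) -
          s * (g' (h * u - s) * deriv H u) := by
      ext u; ring
    have e2 : (fun u => (g (h * u - 0) - ∑ k ∈ Finset.range α, c k * (h * u - 0) ^ k) *
        deriv H u) = fun u => g (h * u - 0) * deriv H u -
          (∑ k ∈ Finset.range α, c k * (h * u - 0) ^ k) * deriv H u := by
      ext u; rw [sub_mul]
    rw [e1, e2, intervalIntegral.integral_sub (i3.sub i2) (i1.const_mul _),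
      intervalIntegral.integral_sub i3 i2, intervalIntegral.integral_sub i3 i4, hpoly,
      intervalIntegral.integral_const_mul]
    ring
  rw [hsplit]
  have b1 := abs_integral_mul_le (f := fun u => g (h * u - 0) - g (h * u - s) -
        g' (h * u - s) * ((h * u - 0) - (h * u - s))) (k := deriv H) (A := C * s ^ 2)
    (by positivity) (fun u hu => by
      refine (abs_sub_sub_mul_le hC hg' hg'' hb (abs_scale_lt hh hr hu)
        (abs_scale_lt hh hr' hu)).trans (le_of_eq ?_)
      rw [sq_abs]; ring) hK
  have b2 := abs_integral_mul_le (f := fun u => g (h * u - 0) -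
      ∑ k ∈ Finset.range α, c k * (h * u - 0) ^ k) (k := deriv H) (A := C * h ^ α)
    (by positivity) (fun u hu => by
      refine (hc _ (abs_scale_lt hh hr' hu)).trans ?_
      rw [uIcc_of_le (by norm_num)] at hu
      have h1 : |h * u - 0| ≤ h := by
        rw [sub_zero, abs_mul, abs_of_pos hh]
        exact mul_le_of_le_one_right hh.le (abs_le.2 hu)
      gcongr) hK
  refine (abs_sub _ _).trans ((add_le_add b1 b2).trans (le_of_eq ?_))
  ring

/-- Change of variables for a function supported in `[-1, 1]`. -/
lemma integral_mul_comp_div {g ψ : ℝ → ℝ} {h s : ℝ} (hh : 0 < h)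
    (hψ : ∀ x, 1 ≤ |x| → ψ x = 0) :
    ∫ t, g t * ψ ((t + s) / h) = h * ∫ u in (-1 : ℝ)..1, g (h * u - s) * ψ u := by
  have h1 : ∫ t, g t * ψ ((t + s) / h) = ∫ t, g (t - s) * ψ (t / h) := by
    rw [← integral_sub_right_eq_self _ s]
    simp
  have h2 : ∫ t, g (t - s) * ψ (t / h) = h * ∫ u, g (h * u - s) * ψ u := by
    have := Measure.integral_comp_mul_left (fun t => g (t - s) * ψ (t / h)) h
    rw [abs_of_pos (inv_pos.2 hh), smul_eq_mul] at this
    rw [show (fun u => g (h * u - s) * ψ u) = fun u => g (h * u - s) * ψ (h * u / h) by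
      ext u; rw [mul_div_cancel_left₀ _ hh.ne'], this, ← mul_assoc, mul_inv_cancel₀ hh.ne', one_mul]
  rw [h1, h2, intervalIntegral.integral_of_le (by norm_num),
    setIntegral_eq_integral_of_forall_compl_eq_zero]
  intro u hu
  rw [hψ u, mul_zero]
  by_contra hlt
  push Not at hlt
  rw [abs_lt] at hlt
  exact hu ⟨hlt.1, hlt.2.le⟩

/-! ### Conditional expectations in the model -/

section Model

variable {p : ℕ}

lemma measurable_noise : Measurable (noise : Triple p → ℝ) :=
  measurable_snd.comp measurable_snd

lemma measurable_covXZ : Measurable (covXZ : Triple p → ℝ × Vec p) :=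
  measurable_covX.prodMk measurable_covZ

lemma measurable_index (β : Vec p) : Measurable (index β) :=
  measurable_covX.add (measurable_covZ.inner measurable_const)

lemma measurable_response (β : Vec p) : Measurable (response β) :=
  Measurable.ite (measurableSet_le measurable_const ((measurable_index β).add measurable_noise))
    measurable_const measurable_const

lemma abs_response (β : Vec p) (w : Triple p) : |response β w| = 1 := by
  unfold response; split_ifs <;> simp

/-- The conditional mean of `-Y` given `Z = z` and `X + Zᵀ β = t`. -/
def negMean (P : Measure (Triple p)) [IsProbabilityMeasure P] (z : Vec p) (t : ℝ) : ℝ :=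
  2 * (condDistrib noise covZ P z).real (Iio (-t)) - 1

lemma abs_negMean_le (P : Measure (Triple p)) [IsProbabilityMeasure P] (z : Vec p) (t : ℝ) :
    |negMean P z t| ≤ 1 := by
  have h0 : 0 ≤ (condDistrib noise covZ P z).real (Iio (-t)) := measureReal_nonneg
  have h1 : (condDistrib noise covZ P z).real (Iio (-t)) ≤ 1 := measureReal_le_one
  rw [negMean, abs_le]
  constructor <;> linarith

lemma measurable_negMean (P : Measure (Triple p)) [IsProbabilityMeasure P] :
    Measurable fun x : Vec p × ℝ => negMean P x.1 x.2 := by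
  have hs : MeasurableSet {y : (Vec p × ℝ) × ℝ | y.2 < -y.1.2} :=
    measurableSet_lt measurable_snd (measurable_snd.comp measurable_fst).neg
  have := Kernel.measurable_kernel_prodMk_left
    (κ := (condDistrib noise covZ P).prodMkRight ℝ) hs
  have h2 : Measurable fun x : Vec p × ℝ => (condDistrib noise covZ P x.1) (Iio (-x.2)) := by
    exact this
  exact (h2.ennreal_toReal.const_mul 2).sub_const 1

variable (P : Measure (Triple p)) [IsProbabilityMeasure P] (β : Vec p)

lemma integral_sign (ν : Measure ℝ) [IsProbabilityMeasure ν] (t : ℝ) :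
    ∫ e, (-(if 0 ≤ t + e then (1 : ℝ) else -1)) ∂ν = 2 * ν.real (Iio (-t)) - 1 := by
  have : (fun e => (-(if 0 ≤ t + e then (1 : ℝ) else -1))) =
      fun e => (Iio (-t)).indicator (fun _ => (2 : ℝ)) e - 1 := by
    ext e
    by_cases h : 0 ≤ t + e
    · rw [if_pos h, indicator_of_notMem (by rw [mem_Iio]; linarith)]; norm_num
    · rw [if_neg h, indicator_of_mem (by rw [mem_Iio]; linarith)]; norm_num
  rw [this, integral_sub ((integrable_const _).indicator measurableSet_Iio) (integrable_const _),
    integral_indicator measurableSet_Iio]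
  simp
  ring

/-- Conditioning on the covariates replaces `-Y` by its conditional mean. -/
lemma integral_neg_response_mul (hci : CondIndepFun (MeasurableSpace.comap covZ inferInstance)
      measurable_covZ.comap_le (noise : Triple p → ℝ) covX P)
    {θ : Vec p × ℝ → ℝ} (hθ : Measurable θ)
    (hint : Integrable (fun w => θ (covZ w, index β w)) P) :
    ∫ w, -response β w * θ (covZ w, index β w) ∂P =
      ∫ w, negMean P (covZ w) (index β w) * θ (covZ w, index β w) ∂P := by
  -- Conditional independence: given `(Z, X)` the noise has the same law as given `Z` alone, so
  -- integrating it out leaves `negMean` evaluated at the index.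
  have hcd := (condIndepFun_iff_condDistrib_prod_ae_eq_prodMkRight (μ := P) (f := noise)
    (g := covX) measurable_noise measurable_covX measurable_covZ).1 hci.symm
  set κ := condDistrib noise (fun w : Triple p => (covZ w, covX w)) P with hκ
  have hZX : Measurable fun w : Triple p => (covZ w, covX w) :=
    measurable_covZ.prodMk measurable_covX
  let idx : Vec p × ℝ → ℝ := fun x => x.2 + inner ℝ x.1 β
  have hidx : Measurable idx := by
    exact measurable_snd.add (measurable_fst.inner measurable_const)
  let G : (Vec p × ℝ) × ℝ → ℝ := fun y =>
    -(if 0 ≤ idx y.1 + y.2 then (1 : ℝ) else -1) * θ (y.1.1, idx y.1)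
  have hG : Measurable G :=
    (Measurable.ite (measurableSet_le measurable_const
      ((hidx.comp measurable_fst).add measurable_snd)) measurable_const measurable_const).neg.mul
      (hθ.comp ((measurable_fst.comp measurable_fst).prodMk (hidx.comp measurable_fst)))
  have hmap := compProd_map_condDistrib (mβ := inferInstance) (μ := P) (X := fun w : Triple p => (covZ w, covX w))
    (Y := noise) measurable_noise.aemeasurable
  have hmeas : Measurable fun w : Triple p => ((covZ w, covX w), noise w) :=
    hZX.prodMk measurable_noise
  have hint' : Integrable (fun w => G ((covZ w, covX w), noise w)) P := by
    refine hint.mono (hG.comp hmeas).aestronglyMeasurable (ae_of_all _ fun w => ?_)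
    change ‖-response β w * θ (covZ w, index β w)‖ ≤ _
    rw [norm_mul, norm_neg, Real.norm_eq_abs, abs_response, one_mul]
  calc ∫ w, -response β w * θ (covZ w, index β w) ∂P
      = ∫ w, G ((covZ w, covX w), noise w) ∂P := rfl
    _ = ∫ y, G y ∂(P.map fun w => ((covZ w, covX w), noise w)) :=
        (integral_map hmeas.aemeasurable hG.aestronglyMeasurable).symm
    _ = ∫ y, G y ∂((P.map fun w => (covZ w, covX w)) ⊗ₘ κ) := by rw [hmap]
    _ = ∫ x, ∫ e, G (x, e) ∂κ x ∂(P.map fun w => (covZ w, covX w)) := by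
        refine Measure.integral_compProd ?_
        rw [hmap]
        exact (integrable_map_measure hG.aestronglyMeasurable hmeas.aemeasurable).2 hint'
    _ = ∫ x, negMean P x.1 (idx x) * θ (x.1, idx x) ∂(P.map fun w => (covZ w, covX w)) := by
        refine integral_congr_ae ?_
        filter_upwards [hcd] with x hx
        rw [hx, Kernel.prodMkRight_apply]
        simp only [G]
        rw [integral_mul_const, integral_sign, negMean]
    _ = _ := by
        rw [integral_map hZX.aemeasurable]
        · rfl
        · exact (((measurable_negMean P).comp (measurable_fst.prodMk hidx)).mul
            (hθ.comp (measurable_fst.prodMk hidx))).aestronglyMeasurable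

lemma integral_index {θ : Vec p × ℝ → ℝ} (hθ : Measurable θ)
    (hint : Integrable (fun w => θ (covZ w, index β w)) P) :
    ∫ w, θ (covZ w, index β w) ∂P =
      ∫ z, ∫ t, θ (z, t) ∂(condDistrib (index β) covZ P z) ∂(P.map covZ) := by
  have hmeas : Measurable fun w : Triple p => (covZ w, index β w) :=
    measurable_covZ.prodMk (measurable_index β)
  have hmap := compProd_map_condDistrib (mβ := inferInstance) (μ := P) (X := (covZ : Triple p → Vec p))
    (Y := index β) (measurable_index β).aemeasurable
  rw [← Measure.integral_compProd, hmap, integral_map hmeas.aemeasurable hθ.aestronglyMeasurable]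
  rw [hmap]
  exact (integrable_map_measure hθ.aestronglyMeasurable hmeas.aemeasurable).2 hint

/-- The expectation of `-Y` times a function of `Z` and the index, by conditioning on `Z`. -/
lemma integral_neg_response_eq (hci : CondIndepFun (MeasurableSpace.comap covZ inferInstance)
      measurable_covZ.comap_le (noise : Triple p → ℝ) covX P)
    {θ : Vec p × ℝ → ℝ} (hθ : Measurable θ)
    (hint : Integrable (fun w => θ (covZ w, index β w)) P) :
    ∫ w, -response β w * θ (covZ w, index β w) ∂P =
      ∫ z, ∫ t, negMean P z t * θ (z, t) ∂(condDistrib (index β) covZ P z) ∂(P.map covZ) := by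
  rw [integral_neg_response_mul P β hci hθ hint]
  refine integral_index P β (θ := fun x => negMean P x.1 x.2 * θ x)
    ((measurable_negMean P).mul hθ) ?_
  refine hint.mono ?_ (ae_of_all _ fun w => ?_)
  · exact (((measurable_negMean P).mul hθ).comp
      (measurable_covZ.prodMk (measurable_index β))).aestronglyMeasurable
  · rw [norm_mul, Real.norm_eq_abs]
    exact mul_le_of_le_one_left (norm_nonneg _) (abs_negMean_le P _ _)

/-- Small slabs around the index hyperplane have small probability. -/
lemma measure_slab_le {ρ : Vec p → ℝ → ℝ} {C : ℝ} (hC : 0 ≤ C)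
    (hd : ∀ᵐ z ∂(P.map covZ), Measurable (ρ z) ∧
      condDistrib (index β) covZ P z = volume.withDensity (fun t => ENNReal.ofReal (ρ z t)))
    (hb : ∀ᵐ z ∂(P.map covZ), ∀ t, ρ z t ≤ C) (Δ : Vec p) {h : ℝ} :
    P {w | |index β w + inner ℝ (covZ w) Δ| < h} ≤ ENNReal.ofReal (2 * C * h) := by
  have hmeas : Measurable fun w : Triple p => (covZ w, index β w) :=
    measurable_covZ.prodMk (measurable_index β)
  have hmap := compProd_map_condDistrib (mβ := inferInstance) (μ := P) (X := (covZ : Triple p → Vec p))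
    (Y := index β) (measurable_index β).aemeasurable
  have hS : MeasurableSet {x : Vec p × ℝ | |x.2 + inner ℝ x.1 Δ| < h} :=
    measurableSet_lt ((measurable_snd.add (measurable_fst.inner measurable_const)).abs)
      measurable_const
  have : P {w | |index β w + inner ℝ (covZ w) Δ| < h} =
      ((P.map covZ) ⊗ₘ condDistrib (index β) covZ P) {x | |x.2 + inner ℝ x.1 Δ| < h} := by
    rw [hmap, Measure.map_apply hmeas hS]
    rfl
  rw [this, Measure.compProd_apply hS]
  have hprob : IsProbabilityMeasure (P.map (covZ : Triple p → Vec p)) :=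
    Measure.isProbabilityMeasure_map measurable_covZ.aemeasurable
  calc _ ≤ ∫⁻ _, ENNReal.ofReal (2 * C * h) ∂(P.map (covZ : Triple p → Vec p)) := by
        refine lintegral_mono_ae ?_
        filter_upwards [hd, hb] with z hz hbz
        have hset : Prod.mk z ⁻¹' {x : Vec p × ℝ | |x.2 + inner ℝ x.1 Δ| < h} =
            Ioo (-inner ℝ z Δ - h) (-inner ℝ z Δ + h) := by
          ext t
          simp only [mem_preimage, mem_ofPred_eq, abs_lt, mem_Ioo]
          constructor <;> rintro ⟨h1, h2⟩ <;> constructor <;> linarith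
        rw [hset, hz.2, withDensity_apply _ measurableSet_Ioo]
        calc ∫⁻ t in Ioo (-inner ℝ z Δ - h) (-inner ℝ z Δ + h), ENNReal.ofReal (ρ z t)
            ≤ ∫⁻ _ in Ioo (-inner ℝ z Δ - h) (-inner ℝ z Δ + h), ENNReal.ofReal C :=
              lintegral_mono fun t => ENNReal.ofReal_le_ofReal (hbz t)
          _ = ENNReal.ofReal (2 * C * h) := by
              rw [setLIntegral_const, Real.volume_Ioo, ← ENNReal.ofReal_mul hC]
              congr 1; ring
    _ = _ := by simp

end Model

/-! ### The conditional law near the origin -/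

section Regular

variable {p : ℕ} (P : Measure (Triple p)) [IsProbabilityMeasure P]

/-- The product of the density of the index with the conditional mean of `-Y`. -/
def signedDensity (ρ : Vec p → ℝ → ℝ) (z : Vec p) (t : ℝ) : ℝ :=
  (2 * noiseCDF P z (-t) - 1) * ρ z t

lemma noiseCDF_nonneg (z : Vec p) (t : ℝ) : 0 ≤ noiseCDF P z t := cdf_nonneg _ _

lemma noiseCDF_le_one (z : Vec p) (t : ℝ) : noiseCDF P z t ≤ 1 := cdf_le_one _ _

/-- The response is `-1` for `ε < -t`, a strict inequality, while `F` counts `ε ≤ -t`; continuity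
rules out the atom that would separate them. -/
lemma real_Iio_eq_noiseCDF {z : Vec p} {t : ℝ} (h : ContinuousAt (noiseCDF P z) t) :
    (condDistrib noise covZ P z).real (Iio t) = noiseCDF P z t := by
  have h1 := StieltjesFunction.measure_Iio (cdf (condDistrib noise covZ P z))
    (tendsto_cdf_atBot _) t
  have h2 : Function.leftLim (cdf (condDistrib noise covZ P z)) t = noiseCDF P z t :=
    leftLim_eq_of_tendsto (h.tendsto.mono_left nhdsWithin_le_nhds)
  rw [measure_cdf, h2, sub_zero] at h1
  rw [measureReal_def, h1, ENNReal.toReal_ofReal (noiseCDF_nonneg P z t)]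

/-- The median is prescribed given `(X, Z)` but is needed given `Z` only. Averaging over `X`
preserves both inequalities; this is tested on the events `Z ∈ A`. -/
lemma ae_half_le {β : Vec p} (hId : Identification P β) :
    ∀ᵐ z ∂(P.map covZ), 1 / 2 ≤ condDistrib noise covZ P z (Iic 0) ∧
      1 / 2 ≤ condDistrib noise covZ P z (Ici 0) := by
  have key : ∀ S : Set ℝ, MeasurableSet S →
      (∀ᵐ w ∂(P.map covXZ), 1 / 2 ≤ condDistrib noise covXZ P w S) →
      ∀ᵐ z ∂(P.map covZ), 1 / 2 ≤ condDistrib noise covZ P z S := by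
    intro S hS h
    refine ae_le_of_forall_setLIntegral_le_of_sigmaFinite measurable_const fun A hA _ => ?_
    have e1 : ∫⁻ z in A, condDistrib noise covZ P z S ∂(P.map covZ) =
        P (covZ ⁻¹' A ∩ noise ⁻¹' S) := by
      rw [setLIntegral_map hA (Kernel.measurable_coe _ hS) measurable_covZ]
      exact setLIntegral_preimage_condDistrib measurable_covZ measurable_noise.aemeasurable hS hA
    have hA' : MeasurableSet (Prod.snd ⁻¹' A : Set (ℝ × Vec p)) := measurable_snd hA
    have e2 : ∫⁻ x in Prod.snd ⁻¹' A, condDistrib noise covXZ P x S ∂(P.map covXZ) =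
        P (covXZ ⁻¹' (Prod.snd ⁻¹' A) ∩ noise ⁻¹' S) := by
      rw [setLIntegral_map hA' (Kernel.measurable_coe _ hS) measurable_covXZ]
      exact setLIntegral_preimage_condDistrib measurable_covXZ measurable_noise.aemeasurable hS hA'
    have e3 : covXZ ⁻¹' (Prod.snd ⁻¹' A) = (covZ : Triple p → Vec p) ⁻¹' A := rfl
    rw [e1, ← e3, ← e2]
    calc ∫⁻ _ in A, 1 / 2 ∂(P.map covZ)
        = ∫⁻ _ in (Prod.snd ⁻¹' A : Set (ℝ × Vec p)), 1 / 2 ∂(P.map covXZ) := by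
          rw [setLIntegral_const, setLIntegral_const, Measure.map_apply measurable_covZ hA,
            Measure.map_apply measurable_covXZ hA']
          rfl
      _ ≤ _ := setLIntegral_mono_ae' hA' (by
          filter_upwards [h] with x hx _ using hx)
  filter_upwards [key _ measurableSet_Iic (hId.median_zero.mono fun _ h => h.1),
    key _ measurableSet_Ici (hId.median_zero.mono fun _ h => h.2)] with z h1 h2 using ⟨h1, h2⟩

lemma noiseCDF_zero {z : Vec p} (hc : ContinuousAt (noiseCDF P z) 0)
    (h1 : 1 / 2 ≤ condDistrib noise covZ P z (Iic 0))
    (h2 : 1 / 2 ≤ condDistrib noise covZ P z (Ici 0)) : noiseCDF P z 0 = 1 / 2 := by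
  have e1 : (1 / 2 : ℝ) ≤ noiseCDF P z 0 := by
    rw [noiseCDF, cdf_eq_real, measureReal_def]
    have := ENNReal.toReal_mono (measure_ne_top _ _) h1
    simpa using this
  have e2 : (1 / 2 : ℝ) ≤ (condDistrib noise covZ P z).real (Ici 0) := by
    rw [measureReal_def]
    have := ENNReal.toReal_mono (measure_ne_top _ _) h2
    simpa using this
  have e3 := real_Iio_eq_noiseCDF P hc
  have e4 : (condDistrib noise covZ P z).real (Iio 0) +
      (condDistrib noise covZ P z).real (Ici 0) = 1 := by
    rw [← compl_Iio, measureReal_compl measurableSet_Iio]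
    simp
  linarith

/-- The properties of the conditional law given `Z = z` which hold for almost every `z`. -/
structure RegularAt (β : Vec p) (α : ℕ) (ρ : Vec p → ℝ → ℝ) (r C : ℝ) (z : Vec p) : Prop where
  measurable : Measurable (ρ z)
  law : condDistrib (index β) covZ P z = volume.withDensity (fun t => ENNReal.ofReal (ρ z t))
  nonneg : ∀ t, 0 ≤ ρ z t
  bounded : ∀ t, ρ z t ≤ C
  negMean_eq : ∀ t, |t| < r → negMean P z t = 2 * noiseCDF P z (-t) - 1
  derivBounds : HasDerivBounds α r C (signedDensity P ρ z)
  signedDensity_zero : signedDensity P ρ z 0 = 0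
  deriv_signedDensity : deriv (signedDensity P ρ z) 0 = -(2 * (ρ z 0 * deriv (noiseCDF P z) 0))

/-- The point is uniformity: `r` and `C` serve almost every `z` at once. They come from the product
rule for `signedDensity`. As `F(0 | z) = 1/2`, the factor `2 F(-t) - 1` vanishes at `0`, so only the
term with `F'` survives in the derivative there. -/
lemma exists_regularAt {β : Vec p} {α : ℕ} {ρ : Vec p → ℝ → ℝ} (hα : 2 ≤ α)
    (hId : Identification P β) (hρ : DensityAssumption P β α ρ) (hF : NoiseAssumption P α) :
    ∃ r > 0, ∃ C > 0, ∀ᵐ z ∂(P.map covZ), RegularAt P β α ρ r C z := by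
  obtain ⟨C₁, hC₁⟩ := hρ.bounded
  obtain ⟨r₂, hr₂, C₂, hC₂⟩ := hρ.bounded_derivs
  obtain ⟨r₃, hr₃, C₃, hC₃⟩ := hF.bounded_derivs
  set r := min r₂ r₃ with hr
  have hr0 : 0 < r := lt_min hr₂ hr₃
  set A := |C₁| + |C₂| with hA
  set B := |C₃| + 1 with hB
  have hA0 : 0 ≤ A := by positivity
  have hB0 : 0 ≤ B := by positivity
  set D := 2 ^ α * ((2 ^ α * (|2| * (2 ^ α * B)) + |-1|) * A) with hD
  have hD0 : 0 ≤ D := by positivity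
  refine ⟨r, hr0, A + D + 1, by positivity, ?_⟩
  filter_upwards [hρ.isDensity, hρ.pos, hC₁, hC₂, hC₃, ae_half_le P hId] with
    z hd hpos hb1 hb2 hb3 hhalf
  have hρB : HasDerivBounds α r A (ρ z) := by
    have hb2' : HasBoundedDerivs (ρ z) α r₂ A := fun k hk t ht =>
      ⟨(hb2 k hk t ht).1, (hb2 k hk t ht).2.trans (by
        have := le_abs_self C₂; have := abs_nonneg C₁; linarith)⟩
    refine (HasDerivBounds.of_hasBoundedDerivs hb2' fun t _ => ?_).mono (min_le_left _ _) le_rfl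
    rw [abs_of_pos (hpos t)]
    refine (hb1 t).trans ?_
    have := le_abs_self C₁; have := abs_nonneg C₂; linarith
  have hFB : HasDerivBounds (α + 1) r B (noiseCDF P z) := by
    have hb3' : HasBoundedDerivs (noiseCDF P z) (α + 1) r₃ B := fun k hk t ht =>
      ⟨(hb3 k hk t ht).1, (hb3 k hk t ht).2.trans (by
        have := le_abs_self C₃; linarith)⟩
    refine (HasDerivBounds.of_hasBoundedDerivs hb3' fun t _ => ?_).mono (min_le_right _ _) le_rfl
    rw [abs_of_nonneg (noiseCDF_nonneg P z t)]
    refine (noiseCDF_le_one P z t).trans ?_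
    have := abs_nonneg C₃; linarith
  obtain ⟨-, F', hF', -⟩ := id hFB
  obtain ⟨-, ρ', hρ', -⟩ := hρB.of_le (show 1 ≤ α by omega)
  have hF0 : noiseCDF P z 0 = 1 / 2 :=
    noiseCDF_zero P (hF' 0 (by simpa using hr0)).continuousAt hhalf.1 hhalf.2
  have hlin : HasDerivBounds α r (2 ^ α * (|2| * (2 ^ α * B)) + |-1|)
      (fun t => 2 * noiseCDF P z (-t) + -1) :=
    ((HasDerivBounds.const α r 2).mul (abs_nonneg _) (by positivity)
      (hFB.of_succ.comp_neg hB0)).add (HasDerivBounds.const α r (-1))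
  have hg : HasDerivBounds α r D (signedDensity P ρ z) := by
    have := hlin.mul (by positivity) hA0 hρB
    exact this
  refine ⟨hd.1, hd.2, fun t => (hpos t).le, fun t => ?_, fun t ht => ?_,
    hg.mono le_rfl (by linarith), ?_, ?_⟩
  · refine (hb1 t).trans ?_
    have := le_abs_self C₁; have := abs_nonneg C₂; linarith
  · rw [negMean, real_Iio_eq_noiseCDF P (hF' (-t) (by rwa [abs_neg])).continuousAt]
  · rw [signedDensity, neg_zero, hF0]; ring
  · have h1 : HasDerivAt (fun t => noiseCDF P z (-t)) (-F' 0) 0 := by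
      have := (hF' (-0) (by simpa using hr0)).comp (0 : ℝ) (hasDerivAt_neg (0 : ℝ))
      simpa [Function.comp_def] using this
    have h2 := ((h1.const_mul 2).sub_const 1).mul (hρ' 0 (by simpa using hr0))
    have h3 : deriv (signedDensity P ρ z) 0 = _ := h2.deriv
    rw [h3, (hF' 0 (by simpa using hr0)).deriv, neg_zero, hF0]
    ring

/-- Conditional expectations as integrals against the kernel. -/
lemma RegularAt.integral_eq {β : Vec p} {α : ℕ} {ρ : Vec p → ℝ → ℝ} {r C : ℝ} {z : Vec p}
    {P : Measure (Triple p)} [IsProbabilityMeasure P]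
    (hz : RegularAt P β α ρ r C z) {ψ : ℝ → ℝ} (hψ : ∀ x, 1 ≤ |x| → ψ x = 0) {h s : ℝ}
    (hh : 0 < h) (hr : h + |s| < r) :
    ∫ t, negMean P z t * ψ ((t + s) / h) ∂(condDistrib (index β) covZ P z) =
      h * ∫ u in (-1 : ℝ)..1, signedDensity P ρ z (h * u - s) * ψ u := by
  rw [hz.law, integral_withDensity_eq_integral_toReal_smul
    (hz.measurable.ennreal_ofReal) (ae_of_all _ fun _ => ENNReal.ofReal_lt_top),
    ← integral_mul_comp_div hh hψ]
  congr 1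
  ext t
  rw [ENNReal.toReal_ofReal (hz.nonneg t), smul_eq_mul, signedDensity]
  by_cases ht : |t| < r
  · rw [hz.negMean_eq t ht]; ring
  -- Away from the origin `negMean` need not be expressed through `noiseCDF`, but `h + |s| < r` puts
  -- such `t` outside the support of the kernel.
  · have : 1 ≤ |(t + s) / h| := by
      rw [abs_div, abs_of_pos hh, le_div_iff₀ hh, one_mul]
      have h1 := abs_sub_abs_le_abs_sub t (-s)
      rw [sub_neg_eq_add, abs_neg] at h1
      linarith [not_lt.1 ht]
    rw [hψ _ this]; ring

end Regular

/-! ### Population gradient and Hessian -/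

section Population

variable {p : ℕ}

/-- The contribution of one observation to the gradient. -/
def gradTerm (H : ℝ → ℝ) (β : Vec p) (h : ℝ) (b : Vec p) (j : Fin p) (w : Triple p) : ℝ :=
  -response β w * (deriv H ((index β w + inner ℝ (covZ w) (b - β)) / h) * covZ w j / h)

/-- The contribution of one observation to the Hessian. -/
def hessTerm (H : ℝ → ℝ) (β : Vec p) (h : ℝ) (b : Vec p) (j k : Fin p) (w : Triple p) : ℝ :=
  -response β w * (deriv (deriv H) ((index β w + inner ℝ (covZ w) (b - β)) / h) *
    (covZ w j * covZ w k) / h ^ 2)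

lemma index_add_inner_sub (β b : Vec p) (w : Triple p) :
    index β w + inner ℝ (covZ w) (b - β) = covX w + inner ℝ (covZ w) b := by
  rw [index, inner_sub_right]; ring

lemma abs_apply_le_norm (z : Vec p) (j : Fin p) : |z j| ≤ ‖z‖ := by
  simpa using PiLp.norm_apply_le z j

lemma measurable_apply_vec (j : Fin p) : Measurable fun z : Vec p => z j :=
  (EuclideanSpace.proj (𝕜 := ℝ) j).continuous.measurable

lemma norm_le_of_abs_apply_le {z : Vec p} {B : ℝ} (hB : 0 ≤ B) (h : ∀ j, |z j| ≤ B) :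
    ‖z‖ ≤ p * B := by
  rw [EuclideanSpace.norm_eq]
  refine Real.sqrt_le_iff.2 ⟨by positivity, ?_⟩
  rcases Nat.eq_zero_or_pos p with rfl | hp
  · simp
  calc ∑ i, ‖z i‖ ^ 2 ≤ ∑ _i : Fin p, B ^ 2 := by
        refine Finset.sum_le_sum fun i _ => ?_
        rw [Real.norm_eq_abs]
        exact pow_le_pow_left₀ (abs_nonneg _) (h i) 2
    _ = p * B ^ 2 := by simp
    _ ≤ (p * B) ^ 2 := by
        rw [mul_pow]
        refine mul_le_mul_of_nonneg_right ?_ (sq_nonneg _)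
        have : (1 : ℝ) ≤ p := by exact_mod_cast hp
        nlinarith

lemma BoundedCovariates.exists_norm_le {P : Measure (Triple p)} (h : BoundedCovariates P) :
    ∃ B : ℝ, 0 < B ∧ ∀ᵐ w ∂P, ‖covZ w‖ ≤ B := by
  obtain ⟨B, hB, h⟩ := h
  -- The `+ 1` keeps the bound positive when `p = 0`.
  refine ⟨p * B + 1, by positivity, ?_⟩
  filter_upwards [h] with w hw
  have := norm_le_of_abs_apply_le hB.le hw
  linarith

lemma measurable_smoothed {f : ℝ → ℝ} (hf : Measurable f) (h : ℝ) (Δ : Vec p) :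
    Measurable fun x : Vec p × ℝ => f ((x.2 + inner ℝ x.1 Δ) / h) :=
  hf.comp ((measurable_snd.add (measurable_fst.inner measurable_const)).div_const h)

lemma measurable_gradTerm (H : ℝ → ℝ) (β : Vec p) (h : ℝ) (b : Vec p) (j : Fin p) :
    Measurable (gradTerm H β h b j) := by
  have h1 : Measurable fun w : Triple p =>
      deriv H ((index β w + inner ℝ (covZ w) (b - β)) / h) :=
    (measurable_smoothed (measurable_deriv H) h (b - β)).comp
      (measurable_covZ.prodMk (measurable_index β))
  exact (measurable_response β).neg.mul
    ((h1.mul ((measurable_apply_vec j).comp measurable_covZ)).div_const h)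

lemma measurable_hessTerm (H : ℝ → ℝ) (β : Vec p) (h : ℝ) (b : Vec p) (j k : Fin p) :
    Measurable (hessTerm H β h b j k) := by
  have h1 : Measurable fun w : Triple p =>
      deriv (deriv H) ((index β w + inner ℝ (covZ w) (b - β)) / h) :=
    (measurable_smoothed (measurable_deriv _) h (b - β)).comp
      (measurable_covZ.prodMk (measurable_index β))
  exact (measurable_response β).neg.mul
    ((h1.mul (((measurable_apply_vec j).comp measurable_covZ).mul
      ((measurable_apply_vec k).comp measurable_covZ))).div_const (h ^ 2))

lemma abs_gradTerm_le {H : ℝ → ℝ} {K B : ℝ} (hK : ∀ x, |deriv H x| ≤ K) (β : Vec p) {h : ℝ}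
    (hh : 0 < h) (b : Vec p) (j : Fin p) {w : Triple p} (hw : ‖covZ w‖ ≤ B) :
    |gradTerm H β h b j w| ≤ K * B / h := by
  rw [gradTerm, abs_mul, abs_neg, abs_response, one_mul, abs_div, abs_mul, abs_of_pos hh]
  have hK0 := (abs_nonneg _).trans (hK 0)
  gcongr
  · exact hK _
  · exact (abs_apply_le_norm _ j).trans hw

lemma abs_hessTerm_le {H : ℝ → ℝ} {K B : ℝ} (hK : ∀ x, |deriv (deriv H) x| ≤ K) (β : Vec p)
    {h : ℝ} (hh : 0 < h) (b : Vec p) (j k : Fin p) {w : Triple p} (hw : ‖covZ w‖ ≤ B) :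
    |hessTerm H β h b j k w| ≤ K * (B * B) / h ^ 2 := by
  rw [hessTerm, abs_mul, abs_neg, abs_response, one_mul, abs_div, abs_mul, abs_mul,
    abs_of_pos (pow_pos hh 2)]
  have hK0 := (abs_nonneg _).trans (hK 0)
  have hB0 := (norm_nonneg _).trans hw
  gcongr
  · exact hK _
  · exact (abs_apply_le_norm _ j).trans hw
  · exact (abs_apply_le_norm _ k).trans hw

variable {P : Measure (Triple p)} [IsProbabilityMeasure P]

lemma integrable_gradTerm {H : ℝ → ℝ} {K B : ℝ} (hK : ∀ x, |deriv H x| ≤ K)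
    (hB : ∀ᵐ w ∂P, ‖covZ w‖ ≤ B) (β : Vec p) {h : ℝ} (hh : 0 < h) (b : Vec p) (j : Fin p) :
    Integrable (gradTerm H β h b j) P :=
  Integrable.of_bound (measurable_gradTerm H β h b j).aestronglyMeasurable (K * B / h)
    (hB.mono fun _ hw => abs_gradTerm_le hK β hh b j hw)

lemma integrable_hessTerm {H : ℝ → ℝ} {K B : ℝ} (hK : ∀ x, |deriv (deriv H) x| ≤ K)
    (hB : ∀ᵐ w ∂P, ‖covZ w‖ ≤ B) (β : Vec p) {h : ℝ} (hh : 0 < h) (b : Vec p) (j k : Fin p) :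
    Integrable (hessTerm H β h b j k) P :=
  Integrable.of_bound (measurable_hessTerm H β h b j k).aestronglyMeasurable (K * (B * B) / h ^ 2)
    (hB.mono fun _ hw => abs_hessTerm_le hK β hh b j k hw)

/-- Second moments of bounded functions supported in a slab. -/
lemma integral_sq_le_of_slab {β : Vec p} {α : ℕ} {ρ : Vec p → ℝ → ℝ} {r C : ℝ}
    (hC : 0 ≤ C) (hreg : ∀ᵐ z ∂(P.map covZ), RegularAt P β α ρ r C z) {f : Triple p → ℝ} {A h : ℝ}
    (hh : 0 < h) (Δ : Vec p) (hA : ∀ᵐ w ∂P, |f w| ≤ A)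
    (hsupp : ∀ w, h ≤ |index β w + inner ℝ (covZ w) Δ| → f w = 0) :
    ∫ w, f w ^ 2 ∂P ≤ A ^ 2 * (2 * C * h) := by
  set S := {w : Triple p | |index β w + inner ℝ (covZ w) Δ| < h} with hS
  have hSm : MeasurableSet S := measurableSet_lt
    (((measurable_index β).add (measurable_covZ.inner measurable_const)).abs) measurable_const
  have hslab := measure_slab_le P β hC (hreg.mono fun z hz => ⟨hz.measurable, hz.law⟩)
    (hreg.mono fun z hz => hz.bounded) Δ (h := h)
  have h1 : ∫ w, f w ^ 2 ∂P ≤ ∫ w, S.indicator (fun _ => A ^ 2) w ∂P := by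
    refine integral_mono_of_nonneg (ae_of_all _ fun w => sq_nonneg _)
      ((integrable_const _).indicator hSm) ?_
    filter_upwards [hA] with w hw
    by_cases hwS : w ∈ S
    · rw [indicator_of_mem hwS]
      rw [← sq_abs]
      exact pow_le_pow_left₀ (abs_nonneg _) hw 2
    · rw [indicator_of_notMem hwS, hsupp w (not_lt.1 hwS)]
      norm_num
  refine h1.trans ?_
  rw [integral_indicator hSm, setIntegral_const, smul_eq_mul, mul_comm]
  refine mul_le_mul_of_nonneg_left ?_ (sq_nonneg A)
  rw [measureReal_def]
  exact ENNReal.toReal_le_of_le_ofReal (by positivity) hslab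

lemma one_le_abs_div {x h : ℝ} (hh : 0 < h) (hx : h ≤ |x|) : 1 ≤ |x / h| := by
  rw [abs_div, abs_of_pos hh, le_div_iff₀ hh, one_mul]
  exact hx

/-- The term is of size `1 / h` and lives on a slab of probability of order `h`, so a factor `h` is
saved over the trivial bound `1 / h ^ 2`. -/
lemma integral_gradTerm_sq_le {α : ℕ} {H : ℝ → ℝ} (hH : KernelAssumption α H) {K B : ℝ}
    (hK : ∀ x, |deriv H x| ≤ K) (hB : ∀ᵐ w ∂P, ‖covZ w‖ ≤ B) {β : Vec p} {ρ : Vec p → ℝ → ℝ}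
    {r C : ℝ} (hC : 0 ≤ C) (hreg : ∀ᵐ z ∂(P.map covZ), RegularAt P β α ρ r C z) {h : ℝ}
    (hh : 0 < h) (b : Vec p) (j : Fin p) :
    ∫ w, gradTerm H β h b j w ^ 2 ∂P ≤ 2 * C * (K * B) ^ 2 / h := by
  refine (integral_sq_le_of_slab hC hreg hh (b - β)
    (hB.mono fun _ hw => abs_gradTerm_le hK β hh b j hw) fun w hw => ?_).trans (le_of_eq ?_)
  · rw [gradTerm, hH.deriv_eq_zero (one_le_abs_div hh hw)]; simp
  · field_simp

/-- As for the gradient: size `1 / h ^ 2` on a slab of probability of order `h`. -/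
lemma integral_hessTerm_sq_le {α : ℕ} {H : ℝ → ℝ} (hH : KernelAssumption α H) {K B : ℝ}
    (hK : ∀ x, |deriv (deriv H) x| ≤ K) (hB : ∀ᵐ w ∂P, ‖covZ w‖ ≤ B) {β : Vec p}
    {ρ : Vec p → ℝ → ℝ}
    {r C : ℝ} (hC : 0 ≤ C) (hreg : ∀ᵐ z ∂(P.map covZ), RegularAt P β α ρ r C z) {h : ℝ}
    (hh : 0 < h) (b : Vec p) (j k : Fin p) :
    ∫ w, hessTerm H β h b j k w ^ 2 ∂P ≤ 2 * C * (K * (B * B)) ^ 2 / h ^ 3 := by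
  refine (integral_sq_le_of_slab hC hreg hh (b - β)
    (hB.mono fun _ hw => abs_hessTerm_le hK β hh b j k hw) fun w hw => ?_).trans (le_of_eq ?_)
  · rw [hessTerm, hH.deriv2_eq_zero (one_le_abs_div hh hw)]; simp
  · field_simp

lemma RegularAt.abs_deriv_le {β : Vec p} {α : ℕ} {ρ : Vec p → ℝ → ℝ} {r C : ℝ} {z : Vec p}
    (hα : 2 ≤ α) (hr : 0 < r) (hz : RegularAt P β α ρ r C z) :
    |deriv (signedDensity P ρ z) 0| ≤ C := by
  obtain ⟨-, g', hg', hb⟩ := hz.derivBounds.of_le (show 1 ≤ α by omega)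
  rw [(hg' 0 (by simpa using hr)).deriv]
  exact hb 0 (by simpa using hr)

lemma abs_inner_le {z Δ : Vec p} {B : ℝ} (hz : ‖z‖ ≤ B) : |inner ℝ z Δ| ≤ B * ‖Δ‖ :=
  (abs_real_inner_le_norm z Δ).trans (mul_le_mul_of_nonneg_right hz (norm_nonneg _))

/-- The limiting conditional Hessian is a measurable function of the covariate. -/
lemma aemeasurable_deriv_signedDensity {α : ℕ} {H : ℝ → ℝ} (hH : KernelAssumption α H)
    {β : Vec p} {ρ : Vec p → ℝ → ℝ} {r C : ℝ} (hr : 0 < r) (hC : 0 ≤ C)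
    (hreg : ∀ᵐ z ∂(P.map covZ), RegularAt P β α ρ r C z) :
    AEMeasurable (fun z => deriv (signedDensity P ρ z) 0) (P.map covZ) := by
  obtain ⟨K, hK0, hK, -, -⟩ := hH.exists_bound
  let hs : ℕ → ℝ := fun n => r / (n + 2)
  have hspos : ∀ n, 0 < hs n := fun n => by positivity
  have hslt : ∀ n, hs n + |(0 : ℝ)| < r := fun n => by
    rw [abs_zero, add_zero]
    exact div_lt_self hr (by linarith [(Nat.cast_nonneg n : (0 : ℝ) ≤ n)])
  have hslim : Tendsto hs atTop (𝓝 0) := by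
    have h1 : Tendsto (fun n : ℕ => (n : ℝ) + 2) atTop atTop :=
      tendsto_atTop_add_const_right _ _ tendsto_natCast_atTop_atTop
    exact tendsto_const_nhds.div_atTop h1
  -- No joint measurability of `ρ` is assumed. These smoothed derivatives (at `s = 0`, bandwidths
  -- tending to `0`) are measurable in `z`, being integrals against a kernel, and they converge to
  -- the derivative at almost every `z`.
  let Ψ : ℕ → Vec p → ℝ := fun n z => -(1 / hs n ^ 2 * ∫ t, negMean P z t *
    deriv (deriv H) ((t + 0) / hs n) ∂(condDistrib (index β) covZ P z))
  have hΨ : ∀ n, Measurable (Ψ n) := fun n => by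
    have hm : Measurable fun x : Vec p × ℝ =>
        negMean P x.1 x.2 * deriv (deriv H) ((x.2 + 0) / hs n) :=
      (measurable_negMean P).mul ((measurable_deriv _).comp
        ((measurable_snd.add_const 0).div_const _))
    exact ((StronglyMeasurable.integral_kernel_prod_right'
      (κ := condDistrib (index β) covZ P) hm.stronglyMeasurable).measurable.const_mul _).neg
  refine aemeasurable_of_tendsto_metrizable_ae atTop (fun n => (hΨ n).aemeasurable) ?_
  filter_upwards [hreg] with z hz
  rw [tendsto_iff_norm_sub_tendsto_zero]
  refine squeeze_zero (fun _ => norm_nonneg _) (fun n => ?_)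
    (g := fun n => 2 * C * K * (hs n + |(0 : ℝ)|)) ?_
  · have h1 := abs_smooth_deriv2_add_le hH hK hr hC (hz.derivBounds.of_le hH.two_le)
      (hspos n) (hslt n)
    have h2 : Ψ n z = -(1 / hs n * ∫ u in (-1 : ℝ)..1,
        signedDensity P ρ z (hs n * u - 0) * deriv (deriv H) u) := by
      simp only [Ψ]
      rw [hz.integral_eq (fun x hx => hH.deriv2_eq_zero hx) (hspos n) (hslt n)]
      have := (hspos n).ne'
      field_simp
    rw [h2, Real.norm_eq_abs, ← abs_neg]
    convert! h1 using 2
    ring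
  · have := ((hslim.add_const |(0 : ℝ)|).const_mul (2 * C * K))
    simpa using this

/-- Given `Z = z` the mean is `z j * z k` times the smoothed second derivative with shift `zᵀ (b -
β)`. By `abs_smooth_deriv2_add_le` it is within order `h + ‖b - β‖` of the integrand of
`hessianLimit`, uniformly in `z`, and this survives averaging. -/
lemma abs_integral_hessTerm_sub_le {α : ℕ} {H : ℝ → ℝ} (hH : KernelAssumption α H)
    (hci : CondIndepFun (MeasurableSpace.comap covZ inferInstance)
      measurable_covZ.comap_le (noise : Triple p → ℝ) covX P)
    {K B : ℝ} (hK : ∀ x, |deriv H x| ≤ K) (hK2 : ∀ x, |deriv (deriv H) x| ≤ K)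
    (hB : ∀ᵐ w ∂P, ‖covZ w‖ ≤ B)
    {β : Vec p} {ρ : Vec p → ℝ → ℝ} {r C : ℝ} (hr : 0 < r) (hC : 0 ≤ C)
    (hreg : ∀ᵐ z ∂(P.map covZ), RegularAt P β α ρ r C z) {h : ℝ} (hh : 0 < h) {b : Vec p}
    (hb : h + B * ‖b - β‖ < r) (j k : Fin p) :
    |∫ w, hessTerm H β h b j k w ∂P - hessianLimit P ρ j k| ≤
      2 * C * K * (h + B * ‖b - β‖) * (B * B) := by
  have hprob : IsProbabilityMeasure (P.map (covZ : Triple p → Vec p)) :=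
    Measure.isProbabilityMeasure_map measurable_covZ.aemeasurable
  have hBz : ∀ᵐ z ∂(P.map (covZ : Triple p → Vec p)), ‖z‖ ≤ B :=
    (ae_map_iff measurable_covZ.aemeasurable
      (measurableSet_le measurable_norm measurable_const)).2 hB
  have hK0 := (abs_nonneg _).trans (hK 0)
  let θ : Vec p × ℝ → ℝ := fun x => deriv (deriv H) ((x.2 + inner ℝ x.1 (b - β)) / h) *
    (x.1 j * x.1 k) / h ^ 2
  have hθ : Measurable θ :=
    ((measurable_smoothed (measurable_deriv _) h (b - β)).mul
      (((measurable_apply_vec j).comp measurable_fst).mul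
        ((measurable_apply_vec k).comp measurable_fst))).div_const _
  have hθint : Integrable (fun w => θ (covZ w, index β w)) P := by
    refine (integrable_hessTerm hK2 hB β hh b j k).mono
      (hθ.comp (measurable_covZ.prodMk (measurable_index β))).aestronglyMeasurable
      (ae_of_all _ fun w => ?_)
    rw [hessTerm, norm_mul, norm_neg, Real.norm_eq_abs (response β w), abs_response, one_mul]
  have e1 : ∫ w, hessTerm H β h b j k w ∂P = ∫ z, ∫ t, negMean P z t * θ (z, t)
      ∂(condDistrib (index β) covZ P z) ∂(P.map covZ) :=
    integral_neg_response_eq P β hci hθ hθint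
  set Ψ : Vec p → ℝ := fun z => ∫ t, negMean P z t * θ (z, t)
      ∂(condDistrib (index β) covZ P z) with hΨ
  have hΨm : Measurable Ψ := (StronglyMeasurable.integral_kernel_prod_right'
      (κ := condDistrib (index β) covZ P)
      ((measurable_negMean P).mul hθ).stronglyMeasurable).measurable
  set v : Vec p → ℝ := fun z => -deriv (signedDensity P ρ z) 0 * (z j * z k) with hv
  have hvm : AEMeasurable v (P.map covZ) :=
    (aemeasurable_deriv_signedDensity hH hr hC hreg).neg.mul
      ((measurable_apply_vec j).mul (measurable_apply_vec k)).aemeasurable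
  have e2 : hessianLimit P ρ j k = ∫ z, v z ∂(P.map covZ) := by
    rw [integral_map measurable_covZ.aemeasurable hvm.aestronglyMeasurable, hessianLimit,
      Matrix.of_apply, ← integral_const_mul]
    refine integral_congr_ae ?_
    filter_upwards [ae_of_ae_map measurable_covZ.aemeasurable hreg] with w hw
    simp only [hv]
    rw [hw.deriv_signedDensity]
    ring
  have hzz : ∀ z : Vec p, ‖z‖ ≤ B → |z j * z k| ≤ B * B := fun z hz => by
    rw [abs_mul]
    exact mul_le_mul ((abs_apply_le_norm z j).trans hz) ((abs_apply_le_norm z k).trans hz)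
      (abs_nonneg _) ((norm_nonneg _).trans hz)
  have hvint : Integrable v (P.map covZ) := by
    refine Integrable.of_bound hvm.aestronglyMeasurable (C * (B * B)) ?_
    filter_upwards [hreg, hBz] with z hz hzB
    simp only [hv]
    rw [Real.norm_eq_abs, abs_mul, abs_neg]
    exact mul_le_mul (hz.abs_deriv_le hH.two_le hr) (hzz z hzB) (abs_nonneg _) hC
  have hdiff : ∀ᵐ z ∂(P.map (covZ : Triple p → Vec p)),
      ‖Ψ z - v z‖ ≤ 2 * C * K * (h + B * ‖b - β‖) * (B * B) := by
    filter_upwards [hreg, hBz] with z hz hzB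
    have hs : |inner ℝ z (b - β)| ≤ B * ‖b - β‖ := abs_inner_le hzB
    have hlt : h + |inner ℝ z (b - β)| < r := by linarith
    have e3 : Ψ z = (1 / h * ∫ u in (-1 : ℝ)..1, signedDensity P ρ z (h * u - inner ℝ z (b - β)) *
        deriv (deriv H) u) * (z j * z k) := by
      have e4 : (fun t => negMean P z t * θ (z, t)) = fun t => (z j * z k / h ^ 2) *
          (negMean P z t * deriv (deriv H) ((t + inner ℝ z (b - β)) / h)) := by
        ext t; simp only [θ]; ring
      simp only [hΨ]
      rw [e4, integral_const_mul, hz.integral_eq (fun x hx => hH.deriv2_eq_zero hx) hh hlt]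
      field_simp
    rw [e3]
    simp only [hv]
    rw [neg_mul, sub_neg_eq_add, ← add_mul, Real.norm_eq_abs, abs_mul]
    refine mul_le_mul ((abs_smooth_deriv2_add_le hH hK hr hC (hz.derivBounds.of_le hH.two_le)
      hh hlt).trans ?_) (hzz z hzB) (abs_nonneg _) ?_
    · gcongr
    · have := (abs_nonneg _).trans hs
      positivity
  -- Integrability of `Ψ` comes from that of `v` and the uniform bound on the difference.
  have hΨint : Integrable Ψ (P.map covZ) := by
    have : Integrable (fun z => Ψ z - v z) (P.map covZ) :=
      Integrable.of_bound (hΨm.aestronglyMeasurable.sub hvm.aestronglyMeasurable) _ hdiff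
    have := this.add hvint
    refine this.congr (ae_of_all _ fun z => ?_)
    simp
  rw [e1, e2, ← integral_sub hΨint hvint]
  have := norm_integral_le_of_norm_le_const hdiff
  simpa using this

/-- Hessian and gradient are kept in one expectation: separately they are only accurate to first
order in `b - β`, and the cancellation in `abs_smooth_newton_le` takes place between them, for each
`z` with shift `s = zᵀ (b - β)`. -/
lemma abs_newton_bias_le {α : ℕ} {H : ℝ → ℝ} (hH : KernelAssumption α H)
    (hci : CondIndepFun (MeasurableSpace.comap covZ inferInstance)
      measurable_covZ.comap_le (noise : Triple p → ℝ) covX P)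
    {K B : ℝ} (hK : ∀ x, |deriv H x| ≤ K) (hK2 : ∀ x, |deriv (deriv H) x| ≤ K)
    (hB : ∀ᵐ w ∂P, ‖covZ w‖ ≤ B)
    {β : Vec p} {ρ : Vec p → ℝ → ℝ} {r C : ℝ} (hr : 0 < r) (hC : 0 ≤ C)
    (hreg : ∀ᵐ z ∂(P.map covZ), RegularAt P β α ρ r C z) {h : ℝ} (hh : 0 < h) {b : Vec p}
    (hb : h + B * ‖b - β‖ < r) (j : Fin p) :
    |∑ k, (∫ w, hessTerm H β h b j k w ∂P) * (b - β) k - ∫ w, gradTerm H β h b j w ∂P| ≤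
      2 * C * K * (h ^ α + (B * ‖b - β‖) ^ 2) * B := by
  have hprob : IsProbabilityMeasure (P.map (covZ : Triple p → Vec p)) :=
    Measure.isProbabilityMeasure_map measurable_covZ.aemeasurable
  have hBz : ∀ᵐ z ∂(P.map (covZ : Triple p → Vec p)), ‖z‖ ≤ B :=
    (ae_map_iff measurable_covZ.aemeasurable
      (measurableSet_le measurable_norm measurable_const)).2 hB
  have hK0 := (abs_nonneg _).trans (hK 0)
  let θ : Vec p × ℝ → ℝ := fun x => x.1 j *
    (inner ℝ x.1 (b - β) / h ^ 2 * deriv (deriv H) ((x.2 + inner ℝ x.1 (b - β)) / h) -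
      1 / h * deriv H ((x.2 + inner ℝ x.1 (b - β)) / h))
  have hθ : Measurable θ :=
    ((measurable_apply_vec j).comp measurable_fst).mul
      ((((measurable_fst.inner measurable_const).div_const _).mul
        (measurable_smoothed (measurable_deriv _) h (b - β))).sub
        ((measurable_smoothed (measurable_deriv _) h (b - β)).const_mul _))
  -- Contracting the second index of `z zᵀ` with `b - β` produces the scalar shift, so the whole
  -- expression is `-Y` times a function of `Z` and the index.
  have hrep : ∀ w, -response β w * θ (covZ w, index β w) =
      ∑ k, hessTerm H β h b j k w * (b - β) k - gradTerm H β h b j w := fun w => by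
    have hin : inner ℝ (covZ w) (b - β) = ∑ k, covZ w k * (b - β) k := by
      rw [PiLp.inner_apply]
      exact Finset.sum_congr rfl fun k _ => by simp [mul_comm]
    simp only [θ, hessTerm, gradTerm]
    have : ∀ k, -response β w * (deriv (deriv H) ((index β w + inner ℝ (covZ w) (b - β)) / h) *
        (covZ w j * covZ w k) / h ^ 2) * (b - β) k =
        (-response β w * deriv (deriv H) ((index β w + inner ℝ (covZ w) (b - β)) / h) *
        covZ w j / h ^ 2) * (covZ w k * (b - β) k) := fun k => by ring
    rw [Finset.sum_congr rfl fun k _ => this k, ← Finset.mul_sum, ← hin]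
    ring
  have hHint : ∀ k, Integrable (fun w => hessTerm H β h b j k w * (b - β) k) P := fun k =>
    (integrable_hessTerm hK2 hB β hh b j k).mul_const _
  have hsum : Integrable (fun w => ∑ k, hessTerm H β h b j k w * (b - β) k) P :=
    integrable_finsetSum _ fun k _ => hHint k
  have hGint := integrable_gradTerm hK hB β hh b j
  have hθint : Integrable (fun w => θ (covZ w, index β w)) P := by
    refine (hsum.sub hGint).mono
      (hθ.comp (measurable_covZ.prodMk (measurable_index β))).aestronglyMeasurable
      (ae_of_all _ fun w => ?_)
    rw [Pi.sub_apply, ← hrep w, norm_mul (-response β w), norm_neg,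
      Real.norm_eq_abs (response β w), abs_response, one_mul]
  have e1 : ∑ k, (∫ w, hessTerm H β h b j k w ∂P) * (b - β) k - ∫ w, gradTerm H β h b j w ∂P =
      ∫ z, ∫ t, negMean P z t * θ (z, t)
        ∂(condDistrib (index β) covZ P z) ∂(P.map covZ) := by
    rw [← integral_neg_response_eq P β hci hθ hθint]
    simp_rw [hrep]
    rw [integral_sub hsum hGint, integral_finsetSum _ fun k _ => hHint k]
    simp_rw [integral_mul_const]
  rw [e1]
  have hbound : ∀ᵐ z ∂(P.map (covZ : Triple p → Vec p)),
      ‖∫ t, negMean P z t * θ (z, t) ∂(condDistrib (index β) covZ P z)‖ ≤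
        2 * C * K * (h ^ α + (B * ‖b - β‖) ^ 2) * B := by
    filter_upwards [hreg, hBz] with z hz hzB
    set s : ℝ := inner ℝ z (b - β) with hsdef
    have hs : |s| ≤ B * ‖b - β‖ := abs_inner_le hzB
    have hlt : h + |s| < r := by linarith
    have hint : ∀ f : ℝ → ℝ, Measurable f → (∀ x, |f x| ≤ K) → Integrable
        (fun t => negMean P z t * f ((t + s) / h)) (condDistrib (index β) covZ P z) := by
      intro f hf hfK
      refine Integrable.of_bound (C := K) ?_ (ae_of_all _ fun t => ?_)
      · exact (((measurable_negMean P).comp (measurable_const.prodMk measurable_id)).mul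
          (hf.comp ((measurable_id.add_const s).div_const h))).aestronglyMeasurable
      · rw [norm_mul]
        exact (mul_le_of_le_one_left (norm_nonneg _) (abs_negMean_le P z t)).trans (hfK _)
    have e4 : (fun t => negMean P z t * θ (z, t)) = fun t =>
        (z j * s / h ^ 2) * (negMean P z t * deriv (deriv H) ((t + s) / h)) -
        (z j / h) * (negMean P z t * deriv H ((t + s) / h)) := by
      ext t; simp only [θ, ← hsdef]; ring
    rw [e4, integral_sub ((hint _ (measurable_deriv _) hK2).const_mul _)
      ((hint _ (measurable_deriv _) hK).const_mul _), integral_const_mul, integral_const_mul,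
      hz.integral_eq (fun x hx => hH.deriv2_eq_zero hx) hh hlt,
      hz.integral_eq (fun x hx => hH.deriv_eq_zero hx) hh hlt]
    have e5 : z j * s / h ^ 2 * (h * ∫ u in (-1 : ℝ)..1,
          signedDensity P ρ z (h * u - s) * deriv (deriv H) u) -
        z j / h * (h * ∫ u in (-1 : ℝ)..1, signedDensity P ρ z (h * u - s) * deriv H u) =
        (s * (1 / h * ∫ u in (-1 : ℝ)..1, signedDensity P ρ z (h * u - s) * deriv (deriv H) u) -
          ∫ u in (-1 : ℝ)..1, signedDensity P ρ z (h * u - s) * deriv H u) * z j := by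
      field_simp
    rw [e5, norm_mul]
    have hs2 : s ^ 2 ≤ (B * ‖b - β‖) ^ 2 := by
      rw [← sq_abs]
      exact pow_le_pow_left₀ (abs_nonneg _) hs 2
    refine mul_le_mul ((abs_smooth_newton_le hH hK hr hC hz.derivBounds hz.signedDensity_zero
      hh hlt).trans ?_) ((abs_apply_le_norm z j).trans hzB) (abs_nonneg _) (by positivity)
    gcongr
  have := norm_integral_le_of_norm_le_const hbound
  simpa using this

end Population

/-! ### Deviation inequalities for sample means -/

section Deviation

variable {p : ℕ} {Ω : Type*} {D : ℕ → Ω → Triple p}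

/-- The mean of `f` over the first `n` observations. -/
def sampleMean (n : ℕ) (D : ℕ → Ω → Triple p) (f : Triple p → ℝ) (ω : Ω) : ℝ :=
  1 / (n : ℝ) * ∑ i ∈ Finset.range n, f (D i ω)

lemma sampleMean_sub {n : ℕ} (hn : 0 < n) (f : Triple p → ℝ) (a : ℝ) (ω : Ω) :
    sampleMean n D f ω - a = 1 / (n : ℝ) * ∑ i ∈ Finset.range n, (f (D i ω) - a) := by
  have : (n : ℝ) ≠ 0 := by positivity
  rw [Finset.sum_sub_distrib, sampleMean]
  simp
  field_simp

variable [MeasurableSpace Ω] {μ : Measure Ω} {P : Measure (Triple p)}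

lemma IsSample.integral_comp (hD : IsSample μ D P) {f : Triple p → ℝ} (hf : Measurable f) (i : ℕ) :
    ∫ ω, f (D i ω) ∂μ = ∫ w, f w ∂P := by
  rw [← hD.law i, integral_map (hD.measurable i).aemeasurable hf.aestronglyMeasurable]

lemma IsSample.ae_comp (hD : IsSample μ D P) {q : Triple p → Prop} (hq : ∀ᵐ w ∂P, q w) (i : ℕ) :
    ∀ᵐ ω ∂μ, q (D i ω) := by
  rw [← hD.law i] at hq
  exact ae_of_ae_map (hD.measurable i).aemeasurable hq

lemma IsSample.iIndepFun_comp (hD : IsSample μ D P) {f : Triple p → ℝ} (hf : Measurable f) :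
    iIndepFun (fun i ω => f (D i ω)) μ :=
  hD.indep.comp (fun _ => f) fun _ => hf

/-- Chebyshev's inequality. -/
lemma IsSample.measure_dev_le_of_sq [IsProbabilityMeasure μ] [IsProbabilityMeasure P]
    (hD : IsSample μ D P) {f : Triple p → ℝ} (hf : Measurable f)
    {A σ η : ℝ} (hA : ∀ᵐ w ∂P, |f w| ≤ A) (hσ : ∫ w, f w ^ 2 ∂P ≤ σ) {n : ℕ} (hn : 0 < n)
    (hη : 0 < η) :
    μ {ω | η < |sampleMean n D f ω - ∫ w, f w ∂P|} ≤ ENNReal.ofReal (σ / (n * η ^ 2)) := by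
  have hn' : (0 : ℝ) < n := by exact_mod_cast hn
  let X : ℕ → Ω → ℝ := fun i ω => f (D i ω)
  have hXm : ∀ i, Measurable (X i) := fun i => hf.comp (hD.measurable i)
  have hL : ∀ i, MemLp (X i) 2 μ := fun i =>
    MemLp.of_bound (hXm i).aestronglyMeasurable A (hD.ae_comp hA i)
  have hvar : variance (∑ i ∈ Finset.range n, X i) μ ≤ n * σ := by
    rw [IndepFun.variance_sum (fun i _ => hL i)
      fun i _ j _ hij => (hD.iIndepFun_comp hf).indepFun hij]
    calc ∑ i ∈ Finset.range n, variance (X i) μ ≤ ∑ i ∈ Finset.range n, σ := by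
          refine Finset.sum_le_sum fun i _ => ?_
          refine (variance_le_expectation_sq (hXm i).aestronglyMeasurable).trans ?_
          refine le_trans (le_of_eq ?_) hσ
          exact hD.integral_comp (f := fun w => f w ^ 2) (hf.pow_const 2) i
      _ = n * σ := by simp
  have hmean : ∫ ω, (∑ i ∈ Finset.range n, X i) ω ∂μ = n * ∫ w, f w ∂P := by
    simp only [Finset.sum_apply]
    rw [integral_finsetSum _ fun i _ => (hL i).integrable one_le_two]
    simp only [X]
    simp_rw [hD.integral_comp hf]
    simp
  have hmem : MemLp (∑ i ∈ Finset.range n, X i) 2 μ := memLp_finsetSum' _ fun i _ => hL i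
  have key := meas_ge_le_variance_div_sq hmem (c := n * η) (by positivity)
  refine (measure_mono fun ω hω => ?_).trans (key.trans (ENNReal.ofReal_le_ofReal ?_))
  · rw [mem_ofPred_eq] at hω ⊢
    rw [hmean, Finset.sum_apply]
    have : ∑ i ∈ Finset.range n, X i ω - n * ∫ w, f w ∂P =
        n * (sampleMean n D f ω - ∫ w, f w ∂P) := by
      rw [sampleMean]; simp only [X]; field_simp
    rw [this, abs_mul, abs_of_pos hn']
    exact mul_le_mul_of_nonneg_left hω.le hn'.le
  · rw [mul_pow, div_le_div_iff₀ (by positivity) (by positivity)]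
    calc variance (∑ i ∈ Finset.range n, X i) μ * (n * η ^ 2) ≤ n * σ * (n * η ^ 2) := by gcongr
      _ = σ * (n ^ 2 * η ^ 2) := by ring

/-- Chernoff's method with `exp x ≤ 1 + x + x ^ 2` for `|x| ≤ 1`, which bounds the moment generating
function of the centred variable by `exp (θ ^ 2 * σ)`. -/
lemma IsSample.measure_upper_dev_le_exp [IsProbabilityMeasure μ] [IsProbabilityMeasure P]
    (hD : IsSample μ D P) {f : Triple p → ℝ}
    (hf : Measurable f) {A σ η : ℝ} (hA : ∀ᵐ w ∂P, |f w| ≤ A) (hσ0 : 0 < σ)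
    (hσ : ∫ w, f w ^ 2 ∂P ≤ σ) {n : ℕ} (hn : 0 < n) (hη : 0 < η) (hηA : η * A ≤ σ) :
    μ {ω | η < sampleMean n D f ω - ∫ w, f w ∂P} ≤
      ENNReal.ofReal (Real.exp (-(n * η ^ 2 / (4 * σ)))) := by
  have hn' : (0 : ℝ) < n := by exact_mod_cast hn
  set a := ∫ w, f w ∂P with ha
  have hint : Integrable f P := Integrable.of_bound hf.aestronglyMeasurable A hA
  have haA : |a| ≤ A := by
    have := norm_integral_le_of_norm_le_const (f := f) (μ := P) (C := A) hA
    simpa using this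
  let g : Triple p → ℝ := fun w => f w - a
  have hg : Measurable g := hf.sub_const a
  have hgA : ∀ᵐ w ∂P, |g w| ≤ 2 * A := by
    filter_upwards [hA] with w hw
    exact (abs_sub _ _).trans (by linarith)
  have hgint : Integrable g P := hint.sub (integrable_const a)
  have hg0 : ∫ w, g w ∂P = 0 := by
    simp only [g]
    rw [integral_sub hint (integrable_const a)]
    simp [ha]
  have hf2 : Integrable (fun w => f w ^ 2) P := by
    refine Integrable.of_bound (hf.pow_const 2).aestronglyMeasurable (A ^ 2) ?_
    filter_upwards [hA] with w hw
    rw [norm_pow, Real.norm_eq_abs]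
    exact pow_le_pow_left₀ (abs_nonneg _) hw 2
  have hg2i : Integrable (fun w => g w ^ 2) P := by
    refine Integrable.of_bound (hg.pow_const 2).aestronglyMeasurable ((2 * A) ^ 2) ?_
    filter_upwards [hgA] with w hw
    rw [norm_pow, Real.norm_eq_abs]
    exact pow_le_pow_left₀ (abs_nonneg _) hw 2
  have hg2 : ∫ w, g w ^ 2 ∂P ≤ σ := by
    have : (fun w => g w ^ 2) = fun w => f w ^ 2 - (2 * a) * f w + a ^ 2 := by
      ext w; simp only [g]; ring
    have hi : Integrable (fun w => f w ^ 2 - 2 * a * f w) P := hf2.sub (hint.const_mul _)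
    rw [this, integral_add hi (integrable_const _), integral_sub hf2 (hint.const_mul _), integral_const_mul, ← ha]
    simp only [integral_const, probReal_univ, one_smul]
    nlinarith [sq_nonneg a]
  -- The minimiser of `-θ * η + θ ^ 2 * σ`. The centred variable is at most `2 * A`, so `η * A ≤ σ`
  -- is exactly what keeps the exponent in `[-1, 1]`.
  set θ := η / (2 * σ) with hθ
  have hθ0 : 0 ≤ θ := by positivity
  have hθA : θ * (2 * A) ≤ 1 := by
    rw [hθ, div_mul_eq_mul_div, div_le_one (by positivity)]
    linarith
  let X : ℕ → Ω → ℝ := fun i ω => g (D i ω)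
  have hXm : ∀ i, Measurable (X i) := fun i => hg.comp (hD.measurable i)
  have hexp_int : ∀ i, Integrable (fun ω => Real.exp (θ * X i ω)) μ := fun i => by
    refine Integrable.of_bound ((hXm i).const_mul θ).exp.aestronglyMeasurable (Real.exp 1) ?_
    filter_upwards [hD.ae_comp hgA i] with ω hω
    rw [Real.norm_eq_abs, Real.abs_exp]
    refine Real.exp_le_exp.2 (le_trans ?_ hθA)
    exact mul_le_mul_of_nonneg_left ((le_abs_self _).trans hω) hθ0
  have hmgf : ∀ i, mgf (X i) μ θ ≤ Real.exp (θ ^ 2 * σ) := fun i => by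
    have e1 : mgf (X i) μ θ = ∫ w, Real.exp (θ * g w) ∂P :=
      hD.integral_comp (f := fun w => Real.exp (θ * g w)) (hg.const_mul θ).exp i
    rw [e1]
    have e2 : ∫ w, Real.exp (θ * g w) ∂P ≤ ∫ w, (1 + θ * g w + θ ^ 2 * g w ^ 2) ∂P := by
      refine integral_mono_of_nonneg (ae_of_all _ fun w => (Real.exp_pos _).le)
        (((integrable_const _).add (hgint.const_mul θ)).add (hg2i.const_mul _)) ?_
      filter_upwards [hgA] with w hw
      have h1 : |θ * g w| ≤ 1 := by
        rw [abs_mul, abs_of_nonneg hθ0]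
        exact (mul_le_mul_of_nonneg_left hw hθ0).trans hθA
      have h2 := (abs_le.1 (Real.abs_exp_sub_one_sub_id_le h1)).2
      rw [mul_pow] at h2
      linarith
    have e3 : ∫ w, (1 + θ * g w + θ ^ 2 * g w ^ 2) ∂P = 1 + θ ^ 2 * ∫ w, g w ^ 2 ∂P := by
      have hi : Integrable (fun w => 1 + θ * g w) P :=
        (integrable_const _).add (hgint.const_mul θ)
      rw [integral_add hi (hg2i.const_mul _),
        integral_add (integrable_const _) (hgint.const_mul θ), integral_const_mul,
        integral_const_mul, hg0]
      simp
    rw [e3] at e2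
    have e4 : 1 + θ ^ 2 * ∫ w, g w ^ 2 ∂P ≤ θ ^ 2 * σ + 1 := by
      have := mul_le_mul_of_nonneg_left hg2 (sq_nonneg θ)
      linarith
    exact e2.trans (e4.trans (Real.add_one_le_exp _))
  have hindep := hD.iIndepFun_comp hg
  have key := measure_ge_le_exp_mul_mgf (μ := μ) (X := ∑ i ∈ Finset.range n, X i) (n * η) hθ0
    (hindep.integrable_exp_mul_sum hXm fun i _ => hexp_int i)
  have hprod : mgf (∑ i ∈ Finset.range n, X i) μ θ ≤ Real.exp (n * (θ ^ 2 * σ)) := by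
    have e := hindep.mgf_sum hXm (Finset.range n) (t := θ)
    rw [e]
    refine (Finset.prod_le_prod (fun i _ => mgf_nonneg) fun i _ => hmgf i).trans (le_of_eq ?_)
    rw [Finset.prod_const, Finset.card_range, ← Real.exp_nat_mul]
  have hfin : μ.real {ω | (n : ℝ) * η ≤ (∑ i ∈ Finset.range n, X i) ω} ≤
      Real.exp (-(n * η ^ 2 / (4 * σ))) := by
    refine key.trans ((mul_le_mul_of_nonneg_left hprod (Real.exp_pos _).le).trans (le_of_eq ?_))
    rw [← Real.exp_add, hθ]
    congr 1
    field_simp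
    ring
  refine (measure_mono fun ω hω => ?_).trans
    ((ENNReal.le_ofReal_iff_toReal_le (measure_ne_top _ _) (Real.exp_pos _).le).2 hfin)
  rw [mem_ofPred_eq] at hω ⊢
  rw [sampleMean_sub hn] at hω
  rw [Finset.sum_apply]
  rw [one_div, inv_mul_eq_div, lt_div_iff₀ hn'] at hω
  simp only [X, g]
  linarith

/-- Bernstein's inequality. -/
lemma IsSample.measure_dev_le_exp [IsProbabilityMeasure μ] [IsProbabilityMeasure P]
    (hD : IsSample μ D P) {f : Triple p → ℝ}
    (hf : Measurable f) {A σ η : ℝ} (hA : ∀ᵐ w ∂P, |f w| ≤ A) (hσ0 : 0 < σ)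
    (hσ : ∫ w, f w ^ 2 ∂P ≤ σ) {n : ℕ} (hn : 0 < n) (hη : 0 < η) (hηA : η * A ≤ σ) :
    μ {ω | η < |sampleMean n D f ω - ∫ w, f w ∂P|} ≤
      ENNReal.ofReal (2 * Real.exp (-(n * η ^ 2 / (4 * σ)))) := by
  have h1 := hD.measure_upper_dev_le_exp hf hA hσ0 hσ hn hη hηA
  have h2 := hD.measure_upper_dev_le_exp hf.neg (A := A) (σ := σ) (η := η)
    (hA.mono fun w hw => by simpa using hw) hσ0 (by simpa using hσ) hn hη hηA
  have hneg : ∀ ω, sampleMean n D (-f) ω - ∫ w, (-f) w ∂P =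
      -(sampleMean n D f ω - ∫ w, f w ∂P) := fun ω => by
    simp only [sampleMean, Pi.neg_apply, Finset.sum_neg_distrib, integral_neg]
    ring
  rw [two_mul, ENNReal.ofReal_add (Real.exp_pos _).le (Real.exp_pos _).le]
  refine (measure_mono fun ω hω => ?_).trans ((measure_union_le _ _).trans (add_le_add h1 h2))
  rw [mem_ofPred_eq, lt_abs] at hω
  rcases hω with h | h
  · exact Or.inl h
  · right
    rw [mem_ofPred_eq, hneg]
    exact h

end Deviation

/-! ### Uniform deviation of the Hessian -/

section Uniform

variable {p : ℕ} {Ω : Type*} {D : ℕ → Ω → Triple p} {P : Measure (Triple p)}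
  [IsProbabilityMeasure P]

/-- The deviation of the averaged Hessian entry from its mean. -/
def hessDev (P : Measure (Triple p)) (n : ℕ) (D : ℕ → Ω → Triple p) (H : ℝ → ℝ) (β : Vec p) (h : ℝ)
    (b : Vec p) (j k : Fin p) (ω : Ω) : ℝ :=
  sampleMean n D (hessTerm H β h b j k) ω - ∫ w, hessTerm H β h b j k w ∂P

/-- The deviation of the averaged gradient entry from its mean. -/
def gradDev (P : Measure (Triple p)) (n : ℕ) (D : ℕ → Ω → Triple p) (H : ℝ → ℝ) (β : Vec p) (h : ℝ)
    (b : Vec p) (j : Fin p) (ω : Ω) : ℝ :=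
  sampleMean n D (gradTerm H β h b j) ω - ∫ w, gradTerm H β h b j w ∂P

/-- The third power of `1 / h` comes from the argument of the Lipschitz function `H''`, beyond the
prefactor `1 / h ^ 2`. -/
lemma abs_hessTerm_sub_le {H : ℝ → ℝ} {K B : ℝ} (hK0 : 0 ≤ K)
    (hK : ∀ x y, |deriv (deriv H) x - deriv (deriv H) y| ≤ K * |x - y|) (β : Vec p)
    {h : ℝ} (hh : 0 < h) (b b' : Vec p) (j k : Fin p) {w : Triple p} (hw : ‖covZ w‖ ≤ B) :
    |hessTerm H β h b j k w - hessTerm H β h b' j k w| ≤ K * B ^ 3 / h ^ 3 * ‖b - b'‖ := by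
  have hB0 := (norm_nonneg _).trans hw
  have e : hessTerm H β h b j k w - hessTerm H β h b' j k w = -response β w *
      ((deriv (deriv H) ((index β w + inner ℝ (covZ w) (b - β)) / h) -
        deriv (deriv H) ((index β w + inner ℝ (covZ w) (b' - β)) / h)) *
        (covZ w j * covZ w k) / h ^ 2) := by
    rw [hessTerm, hessTerm]; ring
  rw [e, abs_mul, abs_neg, abs_response, one_mul, abs_div, abs_mul, abs_mul,
    abs_of_pos (pow_pos hh 2)]
  have h1 : |deriv (deriv H) ((index β w + inner ℝ (covZ w) (b - β)) / h) -
        deriv (deriv H) ((index β w + inner ℝ (covZ w) (b' - β)) / h)| ≤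
        K * (B * ‖b - b'‖ / h) := by
    refine (hK _ _).trans (mul_le_mul_of_nonneg_left ?_ hK0)
    rw [← sub_div, abs_div, abs_of_pos hh]
    refine div_le_div_of_nonneg_right ?_ hh.le
    have : index β w + inner ℝ (covZ w) (b - β) - (index β w + inner ℝ (covZ w) (b' - β)) =
        inner ℝ (covZ w) (b - b') := by
      simp only [inner_sub_right]; ring
    rw [this]
    exact abs_inner_le hw
  calc _ ≤ K * (B * ‖b - b'‖ / h) * (B * B) / h ^ 2 := by
        gcongr
        · exact (abs_apply_le_norm _ j).trans hw
        · exact (abs_apply_le_norm _ k).trans hw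
    _ = K * B ^ 3 / h ^ 3 * ‖b - b'‖ := by field_simp

lemma abs_hessDev_sub_le {H : ℝ → ℝ} {K B : ℝ} (hK0 : 0 ≤ K)
    (hK2 : ∀ x, |deriv (deriv H) x| ≤ K)
    (hK : ∀ x y, |deriv (deriv H) x - deriv (deriv H) y| ≤ K * |x - y|)
    (hB : ∀ᵐ w ∂P, ‖covZ w‖ ≤ B) (β : Vec p)
    {h : ℝ} (hh : 0 < h) (b b' : Vec p) (j k : Fin p) {n : ℕ} (hn : 0 < n) {ω : Ω}
    (hω : ∀ i, ‖covZ (D i ω)‖ ≤ B) :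
    |hessDev P n D H β h b j k ω - hessDev P n D H β h b' j k ω| ≤
      2 * (K * B ^ 3 / h ^ 3 * ‖b - b'‖) := by
  have hn' : (0 : ℝ) < n := by exact_mod_cast hn
  have h1 : |sampleMean n D (hessTerm H β h b j k) ω - sampleMean n D (hessTerm H β h b' j k) ω| ≤
      K * B ^ 3 / h ^ 3 * ‖b - b'‖ := by
    rw [sampleMean, sampleMean, ← mul_sub, ← Finset.sum_sub_distrib, abs_mul,
      abs_of_nonneg (by positivity), one_div, inv_mul_le_iff₀ hn']
    refine (Finset.abs_sum_le_sum_abs _ _).trans ((Finset.sum_le_sum fun i _ =>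
      abs_hessTerm_sub_le hK0 hK β hh b b' j k (hω i)).trans (le_of_eq ?_))
    simp
  have h2 : |∫ w, hessTerm H β h b j k w ∂P - ∫ w, hessTerm H β h b' j k w ∂P| ≤
      K * B ^ 3 / h ^ 3 * ‖b - b'‖ := by
    rw [← integral_sub (integrable_hessTerm hK2 hB β hh b j k)
      (integrable_hessTerm hK2 hB β hh b' j k)]
    have := norm_integral_le_of_norm_le_const (μ := P)
      (f := fun w => hessTerm H β h b j k w - hessTerm H β h b' j k w)
      (hB.mono fun w hw => abs_hessTerm_sub_le hK0 hK β hh b b' j k hw)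
    simpa using this
  have e : hessDev P n D H β h b j k ω - hessDev P n D H β h b' j k ω =
      (sampleMean n D (hessTerm H β h b j k) ω - sampleMean n D (hessTerm H β h b' j k) ω) -
      (∫ w, hessTerm H β h b j k w ∂P - ∫ w, hessTerm H β h b' j k w ∂P) := by
    rw [hessDev, hessDev]; ring
  rw [e]
  exact (abs_sub _ _).trans (by linarith)

/-- The points of the lattice `(1 / N) ℤ ^ p`. -/
def latticePoint (N : ℕ) (g : Fin p → ℤ) : Vec p := WithLp.toLp 2 fun j => (g j : ℝ) / N

lemma exists_latticePoint {N : ℕ} (hN : 0 < N) {Δ : Vec p} (hΔ : ‖Δ‖ ≤ 1) :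
    ∃ g ∈ Fintype.piFinset fun _ : Fin p => Finset.Icc (-(N : ℤ)) N,
      ‖Δ - latticePoint N g‖ ≤ p * (1 / (N : ℝ)) := by
  have hN' : (0 : ℝ) < N := by exact_mod_cast hN
  refine ⟨fun j => ⌊Δ j * N⌋, ?_, norm_le_of_abs_apply_le (by positivity) fun j => ?_⟩
  · rw [Fintype.mem_piFinset]
    intro j
    have hj := abs_le.1 ((abs_apply_le_norm Δ j).trans hΔ)
    rw [Finset.mem_Icc]
    constructor
    · rw [Int.le_floor]
      push_cast
      nlinarith
    · have : (⌊Δ j * N⌋ : ℝ) ≤ (N : ℤ) := (Int.floor_le _).trans (by push_cast; nlinarith)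
      exact_mod_cast this
  · have h1 := Int.floor_le (Δ j * N)
    have h2 := Int.lt_floor_add_one (Δ j * N)
    have e : (Δ - latticePoint N fun j => ⌊Δ j * N⌋) j = (Δ j * N - ⌊Δ j * N⌋) / N := by
      simp only [latticePoint, PiLp.sub_apply]
      field_simp
    rw [e, abs_div, abs_of_pos hN', div_le_div_iff_of_pos_right hN', abs_le]
    constructor <;> linarith

/-- With high probability the averaged Hessian is uniformly close to its mean on a ball. -/
lemma measure_hessDev_le [MeasurableSpace Ω] {μ : Measure Ω} [IsProbabilityMeasure μ]
    (hD : IsSample μ D P) {α : ℕ} {H : ℝ → ℝ} (hH : KernelAssumption α H)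
    {K B : ℝ} (hK0 : 0 < K) (hB0 : 0 < B) (hK2 : ∀ x, |deriv (deriv H) x| ≤ K)
    (hK : ∀ x y, |deriv (deriv H) x - deriv (deriv H) y| ≤ K * |x - y|)
    (hB : ∀ᵐ w ∂P, ‖covZ w‖ ≤ B) {β : Vec p} {ρ : Vec p → ℝ → ℝ}
    {r C : ℝ} (hC : 0 < C) (hreg : ∀ᵐ z ∂(P.map covZ), RegularAt P β α ρ r C z) {h : ℝ}
    (hh : 0 < h) {η : ℝ} (hη : 0 < η) (hηh : η * h ≤ 2 * C * (K * (B * B))) {n N : ℕ} (hn : 0 < n)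
    (hN : 0 < N) :
    μ {ω | ¬ ∀ b : Vec p, ‖b - β‖ ≤ 1 → ∀ j k, |hessDev P n D H β h b j k ω| ≤
        η + 2 * (K * B ^ 3 / h ^ 3 * (p * (1 / (N : ℝ))))} ≤
      ENNReal.ofReal ((p * p * (2 * N + 1) ^ p : ℕ) *
        (2 * Real.exp (-(n * h ^ 3 * η ^ 2 / (8 * C * (K * (B * B)) ^ 2))))) := by
  set G := Fintype.piFinset fun _ : Fin p => Finset.Icc (-(N : ℤ)) N with hG
  set bad : (Fin p → ℤ) × (Fin p × Fin p) → Set Ω := fun x =>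
    {ω | η < |hessDev P n D H β h (β + latticePoint N x.1) x.2.1 x.2.2 ω|} with hbad
  -- Null set on which some observation violates the almost sure bound; outside it the Lipschitz
  -- estimate holds for every sample point.
  set Z : Set Ω := {ω | ¬ ∀ i, ‖covZ (D i ω)‖ ≤ B} with hZ
  have hZ0 : μ Z = 0 := by
    have : ∀ᵐ ω ∂μ, ∀ i, ‖covZ (D i ω)‖ ≤ B := ae_all_iff.2 fun i => hD.ae_comp hB i
    exact this
  have hsub : {ω | ¬ ∀ b : Vec p, ‖b - β‖ ≤ 1 → ∀ j k, |hessDev P n D H β h b j k ω| ≤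
        η + 2 * (K * B ^ 3 / h ^ 3 * (p * (1 / (N : ℝ))))} ⊆
      Z ∪ ⋃ x ∈ G ×ˢ (Finset.univ : Finset (Fin p × Fin p)), bad x := by
    intro ω hω
    by_contra hcon
    rw [mem_union, not_or] at hcon
    obtain ⟨h1, h2⟩ := hcon
    have h1' : ∀ i, ‖covZ (D i ω)‖ ≤ B := not_not.1 h1
    refine hω fun b hb j k => ?_
    obtain ⟨g, hg, hgd⟩ := exists_latticePoint hN hb
    have h3 : |hessDev P n D H β h (β + latticePoint N g) j k ω| ≤ η := by
      by_contra h4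
      refine h2 (mem_iUnion₂.2 ⟨(g, (j, k)), ?_, not_le.1 h4⟩)
      exact Finset.mem_product.2 ⟨hg, Finset.mem_univ _⟩
    have h4 := abs_hessDev_sub_le hK0.le hK2 hK hB β hh b (β + latticePoint N g) j k hn h1'
    have h5 : ‖b - (β + latticePoint N g)‖ ≤ p * (1 / (N : ℝ)) := by
      rwa [← sub_sub]
    have h6 : 2 * (K * B ^ 3 / h ^ 3 * ‖b - (β + latticePoint N g)‖) ≤
        2 * (K * B ^ 3 / h ^ 3 * (p * (1 / (N : ℝ)))) := by gcongr
    have h7 := abs_sub_abs_le_abs_sub (hessDev P n D H β h b j k ω)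
      (hessDev P n D H β h (β + latticePoint N g) j k ω)
    linarith
  have hσ0 : 0 < 2 * C * (K * (B * B)) ^ 2 / h ^ 3 := by positivity
  have hone : ∀ x, μ (bad x) ≤ ENNReal.ofReal
      (2 * Real.exp (-(n * h ^ 3 * η ^ 2 / (8 * C * (K * (B * B)) ^ 2)))) := fun x => by
    refine (hD.measure_dev_le_exp (measurable_hessTerm H β h (β + latticePoint N x.1) x.2.1 x.2.2)
      (hB.mono fun w hw => abs_hessTerm_le hK2 β hh _ _ _ hw) hσ0
      (integral_hessTerm_sq_le hH hK2 hB hC.le hreg hh _ _ _) hn hη ?_).trans (le_of_eq ?_)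
    -- Side condition `η * A ≤ σ` of Bernstein's inequality: with `A` of order `h⁻²` and `σ` of
    -- order `h⁻³` it reduces to `hηh`.
    · rw [← mul_div_assoc, div_le_div_iff₀ (by positivity) (by positivity)]
      have : 0 < K * (B * B) * h ^ 2 := by positivity
      nlinarith
    · congr 4
      field_simp
      ring
  calc _ ≤ μ Z + μ (⋃ x ∈ G ×ˢ (Finset.univ : Finset (Fin p × Fin p)), bad x) :=
        (measure_mono hsub).trans (measure_union_le _ _)
    _ ≤ 0 + ∑ x ∈ G ×ˢ (Finset.univ : Finset (Fin p × Fin p)), μ (bad x) := by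
        rw [hZ0]
        exact add_le_add le_rfl (measure_biUnion_finset_le _ _)
    _ ≤ ∑ x ∈ G ×ˢ (Finset.univ : Finset (Fin p × Fin p)), ENNReal.ofReal
      (2 * Real.exp (-(n * h ^ 3 * η ^ 2 / (8 * C * (K * (B * B)) ^ 2)))) := by
        rw [zero_add]
        exact Finset.sum_le_sum fun x _ => hone x
    _ = _ := by
        rw [Finset.sum_const, Finset.card_product, Finset.card_univ, hG, Fintype.card_piFinset,
          Finset.prod_const, Int.card_Icc, Finset.card_univ, Fintype.card_prod, Fintype.card_fin,
          ENNReal.ofReal_mul (Nat.cast_nonneg _), ENNReal.ofReal_natCast, nsmul_eq_mul]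
        congr 2
        have : ((N : ℤ) + 1 - -(N : ℤ)).toNat = 2 * N + 1 := by omega
        rw [this]
        ring

/-- The Hessian is the exact derivative of the gradient along a line. Hence a uniform bound on the
Hessian deviation transports a bound on the gradient deviation from `β` to a random point. -/
lemma hasDerivAt_gradTerm {α : ℕ} {H : ℝ → ℝ} (hH : KernelAssumption α H) (β : Vec p) (h : ℝ)
    (Δ : Vec p) (j : Fin p) (w : Triple p) (u : ℝ) :
    HasDerivAt (fun u : ℝ => gradTerm H β h (β + u • Δ) j w)
      (∑ k, hessTerm H β h (β + u • Δ) j k w * Δ k) u := by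
  have hin : inner ℝ (covZ w) Δ = ∑ k, covZ w k * Δ k := by
    rw [PiLp.inner_apply]
    exact Finset.sum_congr rfl fun k _ => by simp [mul_comm]
  have e : ∀ u : ℝ, index β w + inner ℝ (covZ w) (β + u • Δ - β) =
      index β w + u * inner ℝ (covZ w) Δ := fun u => by
    rw [add_sub_cancel_left, inner_smul_right]
  have h1 : HasDerivAt (fun u : ℝ => (index β w + u * inner ℝ (covZ w) Δ) / h)
      (inner ℝ (covZ w) Δ / h) u := by
    have := (((hasDerivAt_id u).mul_const (inner ℝ (covZ w) Δ)).const_add (index β w)).div_const h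
    simpa using this
  have h2 := (hH.differentiable_deriv ((index β w + u * inner ℝ (covZ w) Δ) / h)).hasDerivAt.comp
    u h1
  have h3 := ((h2.mul_const (covZ w j)).div_const h).const_mul (-response β w)
  simp only [gradTerm, hessTerm, e]
  convert! h3 using 1
  have : ∀ k, -response β w * (deriv (deriv H) ((index β w + u * inner ℝ (covZ w) Δ) / h) *
        (covZ w j * covZ w k) / h ^ 2) * Δ k =
        (-response β w * deriv (deriv H) ((index β w + u * inner ℝ (covZ w) Δ) / h) *
        covZ w j / h ^ 2) * (covZ w k * Δ k) := fun k => by ring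
  rw [Finset.sum_congr rfl fun k _ => this k, ← Finset.mul_sum, ← hin]
  ring

lemma hasDerivAt_gradDev {α : ℕ} {H : ℝ → ℝ} (hH : KernelAssumption α H) {K B : ℝ}
    (hK1 : ∀ x, |deriv H x| ≤ K) (hK2 : ∀ x, |deriv (deriv H) x| ≤ K)
    (hB : ∀ᵐ w ∂P, ‖covZ w‖ ≤ B) (β : Vec p) {h : ℝ} (hh : 0 < h)
    (Δ : Vec p) (j : Fin p) (n : ℕ) (ω : Ω) (u : ℝ) :
    HasDerivAt (fun u : ℝ => gradDev P n D H β h (β + u • Δ) j ω)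
      (∑ k, hessDev P n D H β h (β + u • Δ) j k ω * Δ k) u := by
  have h1 : HasDerivAt (fun u : ℝ => sampleMean n D (gradTerm H β h (β + u • Δ) j) ω)
      (1 / (n : ℝ) * ∑ i ∈ Finset.range n, ∑ k, hessTerm H β h (β + u • Δ) j k (D i ω) * Δ k) u :=
    (HasDerivAt.fun_sum fun i _ => hasDerivAt_gradTerm hH β h Δ j (D i ω) u).const_mul _
  have h2 := (hasDerivAt_integral_of_dominated_loc_of_deriv_le (μ := P) (s := univ) (x₀ := u)
    (F := fun (u : ℝ) w => gradTerm H β h (β + u • Δ) j w)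
    (F' := fun (u : ℝ) w => ∑ k, hessTerm H β h (β + u • Δ) j k w * Δ k)
    (bound := fun _ => ∑ k, K * (B * B) / h ^ 2 * |Δ k|)
    univ_mem (Eventually.of_forall fun u => (measurable_gradTerm H β h _ j).aestronglyMeasurable)
    (integrable_gradTerm hK1 hB β hh _ j)
    (Finset.measurable_sum _ fun k _ =>
      (measurable_hessTerm H β h _ j k).mul_const _).aestronglyMeasurable
    (hB.mono fun w hw u _ => by
      refine (Finset.abs_sum_le_sum_abs _ _).trans (Finset.sum_le_sum fun k _ => ?_)
      rw [abs_mul]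
      exact mul_le_mul_of_nonneg_right (abs_hessTerm_le hK2 β hh _ j k hw) (abs_nonneg _))
    (integrable_const _)
    (ae_of_all _ fun w u _ => hasDerivAt_gradTerm hH β h Δ j w u)).2
  have h3 := h1.fun_sub h2
  refine h3.congr_deriv ?_
  rw [integral_finsetSum _ fun k _ => (integrable_hessTerm hK2 hB β hh _ j k).mul_const _]
  simp_rw [integral_mul_const, hessDev, sampleMean, sub_mul]
  rw [Finset.sum_sub_distrib, Finset.sum_comm, Finset.mul_sum]
  congr 1
  refine Finset.sum_congr rfl fun k _ => ?_
  rw [← Finset.sum_mul, mul_assoc]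

/-- The deviation of the gradient varies by at most the deviation of the Hessian. -/
lemma abs_gradDev_sub_le {α : ℕ} {H : ℝ → ℝ} (hH : KernelAssumption α H) {K B : ℝ}
    (hK1 : ∀ x, |deriv H x| ≤ K) (hK2 : ∀ x, |deriv (deriv H) x| ≤ K)
    (hB : ∀ᵐ w ∂P, ‖covZ w‖ ≤ B) {β : Vec p} {h : ℝ} (hh : 0 < h) {n : ℕ} {ω : Ω} {η : ℝ}
    (hη : ∀ b : Vec p, ‖b - β‖ ≤ 1 → ∀ j k, |hessDev P n D H β h b j k ω| ≤ η) {b : Vec p}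
    (hb : ‖b - β‖ ≤ 1) (j : Fin p) :
    |gradDev P n D H β h b j ω - gradDev P n D H β h β j ω| ≤ p * η * ‖b - β‖ := by
  have key := (convex_Icc (0 : ℝ) 1).norm_image_sub_le_of_norm_hasDerivWithin_le
    (f := fun u : ℝ => gradDev P n D H β h (β + u • (b - β)) j ω)
    (f' := fun u : ℝ => ∑ k, hessDev P n D H β h (β + u • (b - β)) j k ω * (b - β) k)
    (C := p * η * ‖b - β‖)
    (fun u _ => (hasDerivAt_gradDev hH hK1 hK2 hB β hh (b - β) j n ω u).hasDerivWithinAt)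
    (fun u hu => by
      have hu' : ‖β + u • (b - β) - β‖ ≤ 1 := by
        rw [add_sub_cancel_left, norm_smul, Real.norm_eq_abs, abs_of_nonneg hu.1]
        exact mul_le_one₀ hu.2 (norm_nonneg _) hb
      refine (Finset.abs_sum_le_sum_abs _ _).trans ((Finset.sum_le_sum fun k _ =>
        (?_ : _ ≤ η * ‖b - β‖)).trans (le_of_eq ?_))
      · rw [abs_mul]
        exact mul_le_mul (hη _ hu' j k) (abs_apply_le_norm _ k) (abs_nonneg _)
          ((abs_nonneg _).trans (hη _ hu' j k))
      · simp [mul_assoc])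
    (left_mem_Icc.2 zero_le_one) (right_mem_Icc.2 zero_le_one)
  simpa using key

end Uniform

/-! ### One round of the estimator -/

section Step

variable {p : ℕ}

/-- The blocks of the machines tile `[0, L * m)`, so the averaged gradient and Hessian are
full-sample means. The split matters only through the bandwidths and the rate of the initial
estimator. -/
lemma sum_range_blocks (f : ℕ → ℝ) (m L : ℕ) :
    ∑ ℓ ∈ Finset.range L, ∑ i ∈ Finset.Ico (ℓ * m) (ℓ * m + m), f i =
      ∑ i ∈ Finset.range (L * m), f i := by
  induction L with
  | zero => simp
  | succ L ih =>
    rw [Finset.sum_range_succ, ih, Finset.range_eq_Ico, Finset.sum_Ico_consecutive _ (Nat.zero_le _)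
      (Nat.le_add_right _ _), Nat.succ_mul, Finset.range_eq_Ico]

lemma hessian_apply {Ω : Type*} (D : ℕ → Ω → Triple p) (H : ℝ → ℝ) (β : Vec p) (h : ℝ) (m L : ℕ)
    (b : Vec p) (ω : Ω) (j k : Fin p) :
    hessian H h m L (fun i => observe β (D i ω)) b j k =
      sampleMean (L * m) D (hessTerm H β h b j k) ω := by
  rw [hessian, sampleMean, ← sum_range_blocks, Matrix.smul_apply, Matrix.sum_apply, smul_eq_mul,
    Finset.mul_sum, Finset.mul_sum]
  refine Finset.sum_congr rfl fun ℓ _ => ?_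
  rw [localHessian, Matrix.of_apply, Finset.mul_sum, Finset.mul_sum, Finset.mul_sum]
  refine Finset.sum_congr rfl fun i _ => ?_
  rw [hessTerm, index_add_inner_sub]
  simp only [observe]
  push_cast
  simp only [div_eq_mul_inv, mul_inv]
  ring

lemma gradient_apply {Ω : Type*} (D : ℕ → Ω → Triple p) (H : ℝ → ℝ) (β : Vec p) (h : ℝ) (m L : ℕ)
    (b : Vec p) (ω : Ω) (j : Fin p) :
    gradient H h m L (fun i => observe β (D i ω)) b j =
      sampleMean (L * m) D (gradTerm H β h b j) ω := by
  rw [gradient, sampleMean, ← sum_range_blocks, Pi.smul_apply, Finset.sum_apply, smul_eq_mul,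
    Finset.mul_sum, Finset.mul_sum]
  refine Finset.sum_congr rfl fun ℓ _ => ?_
  rw [localGradient, Finset.mul_sum, Finset.mul_sum, Finset.mul_sum]
  refine Finset.sum_congr rfl fun i _ => ?_
  rw [gradTerm, index_add_inner_sub]
  simp only [observe]
  push_cast
  simp only [div_eq_mul_inv, mul_inv]
  ring

lemma norm_mulVec_le {M : Matrix (Fin p) (Fin p) ℝ} {c : ℝ} (hc : 0 ≤ c)
    (hM : ∀ j k, |M j k| ≤ c) (v : Fin p → ℝ) : ‖M.mulVec v‖ ≤ p * c * ‖v‖ := by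
  refine (pi_norm_le_iff_of_nonneg (by positivity)).2 fun j => ?_
  rw [Matrix.mulVec, dotProduct]
  refine (norm_sum_le _ _).trans ((Finset.sum_le_sum fun k _ => (?_ : _ ≤ c * ‖v‖)).trans
    (le_of_eq ?_))
  · rw [norm_mul]
    exact mul_le_mul (hM j k) (norm_le_pi_norm v k) (norm_nonneg _) hc
  · simp [mul_assoc]

/-- Matrices close to a nonsingular matrix are nonsingular with bounded inverse. -/
lemma exists_inverse_bound {V : Matrix (Fin p) (Fin p) ℝ} (hV : IsUnit V) :
    ∃ κ > 0, ∀ W : Matrix (Fin p) (Fin p) ℝ, (∀ j k, |W j k - V j k| ≤ κ) →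
      IsUnit W ∧ ∀ u : Fin p → ℝ, κ * ‖W⁻¹.mulVec u‖ ≤ ‖u‖ := by
  have hVdet : IsUnit V.det := (Matrix.isUnit_iff_isUnit_det V).1 hV
  set c := ∑ j, ∑ k, |V⁻¹ j k| with hc
  have hc0 : 0 ≤ c := Finset.sum_nonneg fun j _ => Finset.sum_nonneg fun k _ => abs_nonneg _
  have hentry : ∀ j k, |V⁻¹ j k| ≤ c := fun j k =>
    (Finset.single_le_sum (f := fun k => |V⁻¹ j k|) (fun k _ => abs_nonneg _)
      (Finset.mem_univ k)).trans
    (Finset.single_le_sum (f := fun j => ∑ k, |V⁻¹ j k|)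
      (fun j _ => Finset.sum_nonneg fun k _ => abs_nonneg _) (Finset.mem_univ j))
  set S := p * c + 1 with hS
  have hS0 : 0 < S := by positivity
  have hVlow : ∀ v, ‖v‖ ≤ S * ‖V.mulVec v‖ := fun v => by
    have h1 := norm_mulVec_le hc0 hentry (V.mulVec v)
    rw [Matrix.mulVec_mulVec, Matrix.nonsing_inv_mul V hVdet, Matrix.one_mulVec] at h1
    refine h1.trans (mul_le_mul_of_nonneg_right ?_ (norm_nonneg _))
    rw [hS]; linarith
  -- Chosen so that `1 / S = 2 * (p + 1) * κ`. An entrywise perturbation by `κ` costs at most `p *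
  -- κ` in the sup norm, so the lower bound `1 / S` for `V` leaves at least `κ` for `W`.
  set κ := 1 / (2 * S * (p + 1)) with hκ
  have hκ0 : 0 < κ := by positivity
  refine ⟨κ, hκ0, fun W hW => ?_⟩
  have hWlow : ∀ v, κ * ‖v‖ ≤ ‖W.mulVec v‖ := fun v => by
    have h1 : ‖(W - V).mulVec v‖ ≤ p * κ * ‖v‖ := norm_mulVec_le hκ0.le (by simpa using hW) v
    have h2 : V.mulVec v = W.mulVec v - (W - V).mulVec v := by
      rw [Matrix.sub_mulVec]; abel
    have h3 : ‖V.mulVec v‖ ≤ ‖W.mulVec v‖ + ‖(W - V).mulVec v‖ := by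
      rw [h2]; exact norm_sub_le _ _
    have h4 : ‖v‖ / S ≤ ‖V.mulVec v‖ := by
      rw [div_le_iff₀ hS0, mul_comm]; exact hVlow v
    have h5 : ‖v‖ / S = 2 * (p + 1) * κ * ‖v‖ := by rw [hκ]; field_simp
    have h6 : κ * ‖v‖ + p * κ * ‖v‖ ≤ 2 * (p + 1) * κ * ‖v‖ := by
      have : 0 ≤ (p + 1) * κ * ‖v‖ := by positivity
      linarith
    linarith
  have hunit : IsUnit W := by
    rw [← Matrix.mulVec_injective_iff_isUnit]
    intro v w hvw
    have h1 := hWlow (v - w)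
    rw [Matrix.mulVec_sub, sub_eq_zero.2 hvw, norm_zero] at h1
    have h2 : ‖v - w‖ ≤ 0 := by
      by_contra h
      have := mul_pos hκ0 (not_le.1 h)
      linarith
    exact sub_eq_zero.1 (norm_le_zero_iff.1 h2)
  refine ⟨hunit, fun u => ?_⟩
  have h1 := hWlow (W⁻¹.mulVec u)
  rwa [Matrix.mulVec_mulVec, Matrix.mul_nonsing_inv W ((Matrix.isUnit_iff_isUnit_det W).1 hunit),
    Matrix.one_mulVec] at h1

/-- A singular matrix has the eigenvalue `0`, which the lower bound `c⁻¹` excludes. -/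
lemma EigenvalueAssumption.isUnit {P : Measure (Triple p)} [IsProbabilityMeasure P]
    {ρ : Vec p → ℝ → ℝ} (h : EigenvalueAssumption P ρ) : IsUnit (hessianLimit P ρ) := by
  obtain ⟨c, hc, h⟩ := h
  rw [← Matrix.mulVec_injective_iff_isUnit]
  by_contra hinj
  have hker : LinearMap.ker (Matrix.toLin' (hessianLimit P ρ)) ≠ ⊥ := fun hbot => hinj <| by
    have := LinearMap.ker_eq_bot.1 hbot
    exact this
  have h0 : Module.End.HasEigenvalue (Matrix.toLin' (hessianLimit P ρ)) 0 := by
    rw [Module.End.HasEigenvalue, Module.End.HasUnifEigenvalue, Module.End.genEigenspace_one]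
    simpa using hker
  exact absurd (h 0 h0).1 (not_lt.2 (inv_nonneg.2 hc.le))

/-- One round from `b` with bandwidth `h`. -/
def newton (H : ℝ → ℝ) (h : ℝ) (m L : ℕ) (data : ℕ → Datum p) (b : Vec p) : Vec p :=
  b - WithLp.toLp 2 (Matrix.mulVec (hessian H h m L data b)⁻¹ (gradient H h m L data b))

/-- With `d = b - β` the new error is `W⁻¹ (W d - U)`. Here `W d - U` splits into the population
bias, the Hessian deviation applied to `d`, the change of the gradient deviation between `β` and
`b`, and the gradient deviation at `β`. -/
lemma norm_newton_sub_le {Ω : Type*} {D : ℕ → Ω → Triple p} {P : Measure (Triple p)}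
    [IsProbabilityMeasure P] {H : ℝ → ℝ} {α : ℕ}
    {β : Vec p} {ρ : Vec p → ℝ → ℝ} {κ : ℝ} (hκ0 : 0 < κ)
    (hκ : ∀ W : Matrix (Fin p) (Fin p) ℝ, (∀ j k, |W j k - hessianLimit P ρ j k| ≤ κ) →
      IsUnit W ∧ ∀ u : Fin p → ℝ, κ * ‖W⁻¹.mulVec u‖ ≤ ‖u‖)
    {m L : ℕ} {h η τ c : ℝ} {ω : Ω} {b : Vec p} (hη0 : 0 ≤ η) (hτ0 : 0 ≤ τ)
    (hc : 0 ≤ c) (hh : 0 ≤ h)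
    (hη : ∀ j k, |hessDev P (L * m) D H β h b j k ω| ≤ η)
    (hdiff : ∀ j, |gradDev P (L * m) D H β h b j ω - gradDev P (L * m) D H β h β j ω| ≤
      p * η * ‖b - β‖)
    (hτ : ∀ j, |gradDev P (L * m) D H β h β j ω| ≤ τ)
    (hpop : ∀ j k, |∫ w, hessTerm H β h b j k w ∂P - hessianLimit P ρ j k| ≤ c * (h + ‖b - β‖))
    (hbias : ∀ j, |∑ k, (∫ w, hessTerm H β h b j k w ∂P) * (b - β) k -
      ∫ w, gradTerm H β h b j w ∂P| ≤ c * (h ^ α + ‖b - β‖ ^ 2))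
    (hsmall : c * (h + ‖b - β‖) + η ≤ κ) :
    ‖newton H h m L (fun i => observe β (D i ω)) b - β‖ ≤
      p / κ * (c * (h ^ α + ‖b - β‖ ^ 2) + 2 * (p * η * ‖b - β‖) + τ) := by
  set W := hessian H h m L (fun i => observe β (D i ω)) b with hW
  set U := gradient H h m L (fun i => observe β (D i ω)) b with hU
  set R := c * (h ^ α + ‖b - β‖ ^ 2) + 2 * (p * η * ‖b - β‖) + τ with hR
  have hR0 : 0 ≤ R := by positivity
  have hWe : ∀ j k, W j k = hessDev P (L * m) D H β h b j k ω + ∫ w, hessTerm H β h b j k w ∂P :=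
    fun j k => by rw [hW, hessian_apply, hessDev]; ring
  have hUe : ∀ j, U j = gradDev P (L * m) D H β h b j ω + ∫ w, gradTerm H β h b j w ∂P :=
    fun j => by rw [hU, gradient_apply, gradDev]; ring
  obtain ⟨hWu, hWinv⟩ := hκ W fun j k => by
    rw [hWe, add_sub_assoc]
    exact (abs_add_le _ _).trans (by linarith [hη j k, hpop j k])
  have hdet := (Matrix.isUnit_iff_isUnit_det W).1 hWu
  let d : Fin p → ℝ := fun j => (b - β) j
  have hres : ‖W.mulVec d - U‖ ≤ R := by
    refine (pi_norm_le_iff_of_nonneg hR0).2 fun j => ?_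
    have e : (W.mulVec d - U) j = (∑ k, (∫ w, hessTerm H β h b j k w ∂P) * (b - β) k -
        ∫ w, gradTerm H β h b j w ∂P) + ∑ k, hessDev P (L * m) D H β h b j k ω * (b - β) k -
        (gradDev P (L * m) D H β h b j ω - gradDev P (L * m) D H β h β j ω) -
        gradDev P (L * m) D H β h β j ω := by
      rw [Pi.sub_apply, Matrix.mulVec, dotProduct, hUe]
      simp_rw [hWe, add_mul]
      rw [Finset.sum_add_distrib]
      ring
    have hsum : |∑ k, hessDev P (L * m) D H β h b j k ω * (b - β) k| ≤ p * η * ‖b - β‖ := by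
      refine (Finset.abs_sum_le_sum_abs _ _).trans ((Finset.sum_le_sum fun k _ =>
        (?_ : _ ≤ η * ‖b - β‖)).trans (le_of_eq ?_))
      · rw [abs_mul]
        exact mul_le_mul (hη j k) (abs_apply_le_norm _ k) (abs_nonneg _) hη0
      · simp [mul_assoc]
    rw [e, Real.norm_eq_abs]
    have h1 := abs_sub ((∑ k, (∫ w, hessTerm H β h b j k w ∂P) * (b - β) k -
        ∫ w, gradTerm H β h b j w ∂P) + ∑ k, hessDev P (L * m) D H β h b j k ω * (b - β) k -
        (gradDev P (L * m) D H β h b j ω - gradDev P (L * m) D H β h β j ω))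
        (gradDev P (L * m) D H β h β j ω)
    have h2 := abs_sub ((∑ k, (∫ w, hessTerm H β h b j k w ∂P) * (b - β) k -
        ∫ w, gradTerm H β h b j w ∂P) + ∑ k, hessDev P (L * m) D H β h b j k ω * (b - β) k)
        (gradDev P (L * m) D H β h b j ω - gradDev P (L * m) D H β h β j ω)
    have h3 := abs_add_le (∑ k, (∫ w, hessTerm H β h b j k w ∂P) * (b - β) k -
        ∫ w, gradTerm H β h b j w ∂P) (∑ k, hessDev P (L * m) D H β h b j k ω * (b - β) k)
    have h4 := hbias j
    have h5 := hdiff j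
    have h6 := hτ j
    rw [hR]
    linarith
  have hinv : ‖W⁻¹.mulVec (W.mulVec d - U)‖ ≤ R / κ := by
    rw [le_div_iff₀ hκ0, mul_comm]
    exact (hWinv _).trans hres
  have hnew : ∀ j, (newton H h m L (fun i => observe β (D i ω)) b - β) j =
      (W⁻¹.mulVec (W.mulVec d - U)) j := fun j => by
    rw [Matrix.mulVec_sub, Matrix.mulVec_mulVec, Matrix.nonsing_inv_mul W hdet,
      Matrix.one_mulVec]
    simp only [newton, d, PiLp.sub_apply, Pi.sub_apply]
    ring
  refine (norm_le_of_abs_apply_le (div_nonneg hR0 hκ0.le) fun j => ?_).trans (le_of_eq ?_)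
  · rw [hnew]
    exact (norm_le_pi_norm _ j).trans hinv
  · ring

lemma round_error_algebra {c q x y z τ : ℝ} (hc : 0 ≤ c) (hq : 0 ≤ q) (hx : 0 ≤ x) (hy : 0 ≤ y)
    (hτ : 0 ≤ τ) (hz : z = q * y) :
    c * x + 2 * z + τ ≤ (c + 2 * q + 1) * (x + y + τ) := by
  subst hz
  nlinarith [mul_nonneg hq hx, mul_nonneg hc hy, mul_nonneg hc hτ, mul_nonneg hq hτ]

/-- The facts about one round which the analysis of the iteration uses. -/
theorem exists_round_bounds {Ω : Type*} [MeasurableSpace Ω] (μ : Measure Ω)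
    [IsProbabilityMeasure μ] (P : Measure (Triple p)) [IsProbabilityMeasure P]
    (D : ℕ → Ω → Triple p) (hD : IsSample μ D P) (β : Vec p) (α : ℕ) (H : ℝ → ℝ)
    (ρ : Vec p → ℝ → ℝ) (hId : Identification P β) (hH : KernelAssumption α H)
    (hρ : DensityAssumption P β α ρ) (hF : NoiseAssumption P α) (hV : EigenvalueAssumption P ρ)
    (hZ : BoundedCovariates P) :
    ∃ C ≥ 1, ∃ r > 0, r ≤ 1 ∧
      (∀ (m L : ℕ) (h η τ : ℝ) (ω : Ω) (b : Vec p), 0 < h → h ≤ r → 0 ≤ η → η ≤ r → 0 ≤ τ →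
        ‖b - β‖ ≤ r →
        (∀ b' : Vec p, ‖b' - β‖ ≤ 1 → ∀ j k, |hessDev P (L * m) D H β h b' j k ω| ≤ η) →
        (∀ j, |gradDev P (L * m) D H β h β j ω| ≤ τ) →
        ‖newton H h m L (fun i => observe β (D i ω)) b - β‖ ≤
          C * (h ^ α + ‖b - β‖ ^ 2 + η * ‖b - β‖ + τ)) ∧
      (∀ (n : ℕ) (h η : ℝ), 0 < n → 0 < h → 0 < η → η * h ≤ r →
        μ {ω | ¬ ∀ b : Vec p, ‖b - β‖ ≤ 1 → ∀ j k, |hessDev P n D H β h b j k ω| ≤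
          η + C / (h ^ 3 * n)} ≤
        ENNReal.ofReal (C * (n : ℝ) ^ p * Real.exp (-(n * h ^ 3 * η ^ 2 / C)))) ∧
      (∀ (n : ℕ) (h τ : ℝ), 0 < n → 0 < h → 0 < τ →
        μ {ω | ¬ ∀ j, |gradDev P n D H β h β j ω| ≤ τ} ≤ ENNReal.ofReal (C / (n * h * τ ^ 2))) := by
  obtain ⟨r₁, hr₁, C₁, hC₁, hreg⟩ := exists_regularAt P hH.two_le hId hρ hF
  obtain ⟨B, hB0, hB⟩ := hZ.exists_norm_le
  obtain ⟨K, hK0, hK1, hK2, hK3⟩ := hH.exists_bound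
  obtain ⟨κ, hκ0, hκ⟩ := exists_inverse_bound hV.isUnit
  have hp0 : (0 : ℝ) ≤ p := Nat.cast_nonneg p
  obtain ⟨c, hc0, hca, hcb⟩ : ∃ c : ℝ, 0 < c ∧ 2 * C₁ * K * (1 + B) * (B * B) ≤ c ∧
      2 * C₁ * K * (1 + B ^ 2) * B ≤ c := by
    have h1 : 0 < 2 * C₁ * K * (1 + B) * (B * B) := by positivity
    have h2 : 0 < 2 * C₁ * K * (1 + B ^ 2) * B := by positivity
    exact ⟨_, add_pos h1 h2, by linarith, by linarith⟩
  have t4' : 0 < 8 * C₁ * (K * (B * B)) ^ 2 := by positivity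
  obtain ⟨C, hC1, hCa, hCb, hCc, hCd, hCe⟩ : ∃ C : ℝ, 1 ≤ C ∧ p / κ * (c + 2 * p + 1) ≤ C ∧
      2 * (K * B ^ 3 * p) ≤ C ∧ p * p * 3 ^ p * 2 ≤ C ∧ 8 * C₁ * (K * (B * B)) ^ 2 ≤ C ∧
      p * (2 * C₁ * (K * B) ^ 2) ≤ C := by
    have t1 : 0 ≤ p / κ * (c + 2 * p + 1) := by positivity
    have t2 : 0 ≤ 2 * (K * B ^ 3 * p) := by positivity
    have t3 : (0 : ℝ) ≤ p * p * 3 ^ p * 2 := by positivity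
    have t5 : 0 ≤ p * (2 * C₁ * (K * B) ^ 2) := by positivity
    exact ⟨1 + p / κ * (c + 2 * p + 1) + 2 * (K * B ^ 3 * p) + p * p * 3 ^ p * 2 +
      8 * C₁ * (K * (B * B)) ^ 2 + p * (2 * C₁ * (K * B) ^ 2), by linarith, by linarith,
      by linarith, by linarith, by linarith, by linarith⟩
  -- One radius for three needs: staying where the conditional law is regular, keeping the averaged
  -- Hessian within `κ` of its limit, and the range of `η * h` allowed in Bernstein's inequality.
  set r := min (min 1 (r₁ / (2 * (1 + B)) / 2)) (min (κ / (2 * c + 1)) (2 * C₁ * (K * (B * B))))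
    with hr
  have hr0 : 0 < r := by
    refine lt_min (lt_min one_pos (by positivity)) (lt_min (by positivity) (by positivity))
  have hrκ : r ≤ κ / (2 * c + 1) := (min_le_right _ _).trans (min_le_left _ _)
  have hr1 : r ≤ 1 := (min_le_left _ _).trans (min_le_left _ _)
  have hrr : r ≤ r₁ / (2 * (1 + B)) / 2 := (min_le_left _ _).trans (min_le_right _ _)
  have hrC : r ≤ 2 * C₁ * (K * (B * B)) := (min_le_right _ _).trans (min_le_right _ _)
  refine ⟨C, hC1, r, hr0, hr1, ?_, ?_, ?_⟩
  · intro m L h η τ ω b hh hhr hη0 hηr hτ0 hbr hdev hgrad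
    have hb1 : ‖b - β‖ ≤ 1 := hbr.trans hr1
    have hbd : h + B * ‖b - β‖ < r₁ := by
      have h1 : h + B * ‖b - β‖ ≤ (1 + B) * r := by nlinarith [norm_nonneg (b - β)]
      have h2 : (1 + B) * r ≤ (1 + B) * (r₁ / (2 * (1 + B)) / 2) := by gcongr
      have h3 : (1 + B) * (r₁ / (2 * (1 + B)) / 2) = r₁ / 4 := by field_simp; norm_num
      linarith
    have hpop : ∀ j k, |∫ w, hessTerm H β h b j k w ∂P - hessianLimit P ρ j k| ≤
        c * (h + ‖b - β‖) := fun j k => by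
      refine (abs_integral_hessTerm_sub_le hH hF.condIndep hK1 hK2 hB hr₁ hC₁.le hreg hh hbd
        j k).trans ?_
      have h1 : h + B * ‖b - β‖ ≤ (1 + B) * (h + ‖b - β‖) := by
        nlinarith [norm_nonneg (b - β), mul_nonneg hB0.le hh.le]
      calc 2 * C₁ * K * (h + B * ‖b - β‖) * (B * B)
          ≤ 2 * C₁ * K * ((1 + B) * (h + ‖b - β‖)) * (B * B) := by gcongr
        _ = 2 * C₁ * K * (1 + B) * (B * B) * (h + ‖b - β‖) := by ring
        _ ≤ c * (h + ‖b - β‖) := by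
          exact mul_le_mul_of_nonneg_right hca (by positivity)
    have hbias : ∀ j, |∑ k, (∫ w, hessTerm H β h b j k w ∂P) * (b - β) k -
        ∫ w, gradTerm H β h b j w ∂P| ≤ c * (h ^ α + ‖b - β‖ ^ 2) := fun j => by
      refine (abs_newton_bias_le hH hF.condIndep hK1 hK2 hB hr₁ hC₁.le hreg hh hbd j).trans ?_
      have h1 : h ^ α + (B * ‖b - β‖) ^ 2 ≤ (1 + B ^ 2) * (h ^ α + ‖b - β‖ ^ 2) := by
        have : 0 ≤ h ^ α := by positivity
        nlinarith [sq_nonneg ‖b - β‖, mul_nonneg (sq_nonneg B) this]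
      calc 2 * C₁ * K * (h ^ α + (B * ‖b - β‖) ^ 2) * B
          ≤ 2 * C₁ * K * ((1 + B ^ 2) * (h ^ α + ‖b - β‖ ^ 2)) * B := by gcongr
        _ = 2 * C₁ * K * (1 + B ^ 2) * B * (h ^ α + ‖b - β‖ ^ 2) := by ring
        _ ≤ c * (h ^ α + ‖b - β‖ ^ 2) := by
          exact mul_le_mul_of_nonneg_right hcb (by positivity)
    have hsmall : c * (h + ‖b - β‖) + η ≤ κ := by
      have h1 : r * (2 * c + 1) ≤ κ := by rwa [le_div_iff₀ (by positivity)] at hrκ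
      nlinarith
    refine (norm_newton_sub_le hκ0 hκ hη0 hτ0 hc0.le hh.le (hdev b hb1)
      (fun j => abs_gradDev_sub_le hH hK1 hK2 hB hh hdev hb1 j) hgrad hpop hbias hsmall).trans ?_
    have h1 : c * (h ^ α + ‖b - β‖ ^ 2) + 2 * (p * η * ‖b - β‖) + τ ≤
        (c + 2 * p + 1) * (h ^ α + ‖b - β‖ ^ 2 + η * ‖b - β‖ + τ) :=
       round_error_algebra hc0.le hp0 (by positivity) (by positivity) hτ0 (by ring)
    calc _ ≤ p / κ * ((c + 2 * p + 1) * (h ^ α + ‖b - β‖ ^ 2 + η * ‖b - β‖ + τ)) := by gcongr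
      _ = p / κ * (c + 2 * p + 1) * (h ^ α + ‖b - β‖ ^ 2 + η * ‖b - β‖ + τ) := by ring
      _ ≤ C * (h ^ α + ‖b - β‖ ^ 2 + η * ‖b - β‖ + τ) := by
        exact mul_le_mul_of_nonneg_right hCa (by positivity)
  · intro n h η hn hh hη hηh
    have hn' : (1 : ℝ) ≤ n := by exact_mod_cast hn
    have hn0 : (0 : ℝ) < n := by linarith
    -- Lattice mesh `1 / n`: the number of points is polynomial in `n`, which the exponential beats,
    -- and the discretisation error is of order `1 / (h ^ 3 * n)`.
    have key := measure_hessDev_le hD hH hK0 hB0 hK2 hK3 hB hC₁ hreg hh hη (hηh.trans hrC)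
      (n := n) (N := n) hn hn (β := β)
    refine (measure_mono ?_).trans (key.trans (ENNReal.ofReal_le_ofReal ?_))
    · intro ω hω hcon
      refine hω fun b hb j k => (hcon b hb j k).trans (add_le_add le_rfl ?_)
      have e : 2 * (K * B ^ 3 / h ^ 3 * (p * (1 / (n : ℝ)))) =
          2 * (K * B ^ 3 * p) / (h ^ 3 * n) := by field_simp
      rw [e]
      exact div_le_div_of_nonneg_right hCb (by positivity)
    · have e1 : ((p * p * (2 * n + 1) ^ p : ℕ) : ℝ) * 2 ≤ C * (n : ℝ) ^ p := by
        have h1 : ((2 * n + 1 : ℕ) : ℝ) ≤ 3 * n := by push_cast; linarith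
        have h2 : ((2 * n + 1 : ℕ) : ℝ) ^ p ≤ 3 ^ p * (n : ℝ) ^ p := by
          rw [← mul_pow]
          exact pow_le_pow_left₀ (by positivity) h1 p
        push_cast at h2 ⊢
        calc (p : ℝ) * p * (2 * n + 1) ^ p * 2 ≤ p * p * (3 ^ p * (n : ℝ) ^ p) * 2 := by gcongr
          _ = p * p * 3 ^ p * 2 * (n : ℝ) ^ p := by ring
          _ ≤ C * (n : ℝ) ^ p := by
            exact mul_le_mul_of_nonneg_right hCc (by positivity)
      rw [← mul_assoc]
      refine mul_le_mul e1 (Real.exp_le_exp.2 (neg_le_neg ?_)) (Real.exp_pos _).le (by positivity)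
      exact div_le_div_of_nonneg_left (by positivity) t4' hCd
  · intro n h τ hn hh hτ
    have hn0 : (0 : ℝ) < n := by exact_mod_cast hn
    have hone : ∀ j, μ {ω | τ < |gradDev P n D H β h β j ω|} ≤
        ENNReal.ofReal (2 * C₁ * (K * B) ^ 2 / h / (n * τ ^ 2)) := fun j =>
      hD.measure_dev_le_of_sq (measurable_gradTerm H β h β j)
        (hB.mono fun w hw => abs_gradTerm_le hK1 β hh β j hw)
        (integral_gradTerm_sq_le hH hK1 hB hC₁.le hreg hh β j) hn hτ
    have hsub : {ω | ¬ ∀ j, |gradDev P n D H β h β j ω| ≤ τ} ⊆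
        ⋃ j ∈ (Finset.univ : Finset (Fin p)), {ω | τ < |gradDev P n D H β h β j ω|} := by
      intro ω hω
      obtain ⟨j, hj⟩ := not_forall.1 hω
      exact mem_iUnion₂.2 ⟨j, Finset.mem_univ j, not_le.1 hj⟩
    refine (measure_mono hsub).trans ((measure_biUnion_finset_le _ _).trans
      ((Finset.sum_le_sum fun j _ => hone j).trans ?_))
    rw [Finset.sum_const, Finset.card_univ, Fintype.card_fin, nsmul_eq_mul,
      ← ENNReal.ofReal_natCast, ← ENNReal.ofReal_mul (Nat.cast_nonneg _)]
    refine ENNReal.ofReal_le_ofReal ?_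
    have e : (p : ℝ) * (2 * C₁ * (K * B) ^ 2 / h / (n * τ ^ 2)) =
        p * (2 * C₁ * (K * B) ^ 2) / (n * h * τ ^ 2) := by field_simp
    rw [e]
    exact div_le_div_of_nonneg_right hCe (by positivity)

end Step

/-! ### The error recursion -/

/-- One step of the invariant, with `y` and `z` the values of `w` before and after and `s * z = y ^
2`. With `C * s = 1 / 12`, the terms `C * y ^ 4` and `C * y ^ 2 * x` become small multiples of `z ^
2` and `z * x`. Terms containing `A * Q` are small since `Q` and `x` are. The equality `M₀ * Q + Q =
A * Q / 2` fixes `A` and leaves half of `A * Q` to spare. -/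
lemma error_recursion_step {C M₀ Q x s y z μ e e' A : ℝ} (hC : 1 ≤ C) (hM₀ : 0 ≤ M₀) (hQ : 0 < Q)
    (hx : 0 ≤ x) (hs : s = 1 / (12 * C)) (hA : A = 2 * (M₀ + 1)) (hQA : 24 * C * A * Q ≤ 1)
    (hCx : C * x ≤ 1 / 8) (hx3 : C * x ^ 3 ≤ 4 * Q) (hz : s * z = y ^ 2)
    (hμ : 2 * (C * μ) ≤ z ^ 2) (he0 : 0 ≤ e) (he : e ≤ A * Q + y ^ 2 + y * x)
    (he' : e' ≤ M₀ * Q + C * μ + C * e ^ 2 + C * (e * x)) : e' ≤ A * Q + z ^ 2 + z * x := by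
  have hA0 : 0 ≤ A := by rw [hA]; positivity
  have hs0 : 0 < s := by rw [hs]; positivity
  have hCs : C * s = 1 / 12 := by rw [hs]; field_simp
  have hz0 : 0 ≤ z := by
    by_contra h
    have : s * z < 0 := mul_neg_of_pos_of_neg hs0 (not_le.1 h)
    have := sq_nonneg y
    linarith
  have hs1 : s ≤ 1 / 12 := by
    rw [hs]; exact one_div_le_one_div_of_le (by norm_num) (by linarith)
  have hzx : 0 ≤ z * x := mul_nonneg hz0 hx
  -- the square of the error
  have hsq : C * e ^ 2 ≤ C * (3 * ((A * Q) ^ 2 + (y ^ 2) ^ 2 + (y * x) ^ 2)) := by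
    refine mul_le_mul_of_nonneg_left ?_ (by linarith)
    have h1 : e ^ 2 ≤ (A * Q + y ^ 2 + y * x) ^ 2 := pow_le_pow_left₀ he0 he 2
    nlinarith [sq_nonneg (A * Q - y ^ 2), sq_nonneg (A * Q - y * x), sq_nonneg (y ^ 2 - y * x)]
  have s1 : C * (3 * (A * Q) ^ 2) ≤ A * Q / 8 := by
    have h0 : 0 ≤ A * Q := by positivity
    have : C * (3 * (A * Q) ^ 2) = (24 * C * A * Q) * (A * Q / 8) := by ring
    rw [this]
    exact mul_le_of_le_one_left (by positivity) hQA
  have s2 : C * (3 * (y ^ 2) ^ 2) ≤ z ^ 2 / 48 := by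
    have : C * (3 * (y ^ 2) ^ 2) = 3 * (C * s) * s * z ^ 2 := by rw [← hz]; ring
    rw [this, hCs]
    nlinarith [sq_nonneg z]
  have s3 : C * (3 * (y * x) ^ 2) ≤ z * x / 32 := by
    have : C * (3 * (y * x) ^ 2) = 3 * (C * s) * (x * (z * x)) := by
      rw [mul_pow, ← hz]; ring
    rw [this, hCs]
    have hx8 : x ≤ 1 / 8 := by nlinarith
    nlinarith
  -- the product with `x`
  have hprod : C * (e * x) ≤ C * ((A * Q + y ^ 2 + y * x) * x) := by gcongr
  have p1 : C * (A * Q * x) ≤ A * Q / 8 := by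
    have h0 : 0 ≤ A * Q := by positivity
    have : C * (A * Q * x) = (C * x) * (A * Q) := by ring
    rw [this]
    nlinarith
  have p2 : C * (y ^ 2 * x) = z * x / 12 := by
    have : C * (y ^ 2 * x) = (C * s) * (z * x) := by rw [← hz]; ring
    rw [this, hCs]; ring
  -- The one term not matched by the invariant: `y * x ^ 2 ≤ x * y ^ 2 + x ^ 3 / 4`, and the cube is
  -- absorbed into `Q` by `hx3`.
  have p3 : C * (y * x * x) ≤ z * x / 12 + Q := by
    have h1 : C * (y * x * x) ≤ C * (x * (y ^ 2 + x ^ 2 / 4)) := by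
      have : y * x * x ≤ x * (y ^ 2 + x ^ 2 / 4) := by
        have : x * (y * x) ≤ x * (y ^ 2 + x ^ 2 / 4) :=
          mul_le_mul_of_nonneg_left (by nlinarith [sq_nonneg (y - x / 2)]) hx
        linarith
      gcongr
    have h2 : C * (x * (y ^ 2 + x ^ 2 / 4)) = C * (y ^ 2 * x) + C * x ^ 3 / 4 := by ring
    linarith
  have e1 : C * (3 * ((A * Q) ^ 2 + (y ^ 2) ^ 2 + (y * x) ^ 2)) =
      C * (3 * (A * Q) ^ 2) + C * (3 * (y ^ 2) ^ 2) + C * (3 * (y * x) ^ 2) := by ring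
  have e2 : C * ((A * Q + y ^ 2 + y * x) * x) =
      C * (A * Q * x) + C * (y ^ 2 * x) + C * (y * x * x) := by ring
  have e3 : M₀ * Q + Q = A * Q / 2 := by rw [hA]; ring
  have hAQ : 0 ≤ A * Q := by positivity
  have := sq_nonneg z
  linarith

/-- An error sequence whose steps are quadratic up to a rate `Q` and a factor `x`. -/
lemma error_recursion {C M₀ Q x s K v r A : ℝ} {e : ℕ → ℝ} (hC : 1 ≤ C) (hM₀ : 0 ≤ M₀) (hQ : 0 < Q)
    (hx : 0 ≤ x) (hs : s = 1 / (12 * C)) (hA : A = 2 * (M₀ + 1)) (hQA : 24 * C * A * Q ≤ 1)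
    (hCx : C * x ≤ 1 / 8) (hx3 : C * x ^ 3 ≤ 4 * Q) (hK1 : 1 ≤ K) (hK : 2 * C ≤ (s * K) ^ 2)
    (hv : 0 < v) (hKv : K * v ≤ 1) (hr : A * Q + (s * (K * v)) ^ 2 + s * (K * v) * x ≤ r)
    (he : ∀ t, 0 ≤ e t) (he0 : e 0 ≤ (s * (K * v)) ^ 2)
    (hstep : ∀ t, e t ≤ r → e (t + 1) ≤
      M₀ * Q + C * (v ^ 2 ^ (t + 1)) ^ 2 + C * e t ^ 2 + C * (e t * x)) (t : ℕ) :
    e t ≤ A * Q + (s * (K * v) ^ 2 ^ t) ^ 2 + s * (K * v) ^ 2 ^ t * x := by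
  have hA0 : 0 ≤ A := by rw [hA]; positivity
  have hs0 : 0 < s := by rw [hs]; positivity
  have hKv0 : 0 < K * v := by positivity
  induction t with
  | zero =>
    have : 0 ≤ A * Q := by positivity
    have : 0 ≤ s * (K * v) * x := by positivity
    simp only [pow_zero, pow_one]
    linarith
  | succ t ih =>
    have hle : s * (K * v) ^ 2 ^ t ≤ s * (K * v) :=
      mul_le_mul_of_nonneg_left (pow_le_of_le_one hKv0.le hKv (by positivity)) hs0.le
    have her : e t ≤ r := by
      refine ih.trans (le_trans ?_ hr)
      gcongr
    refine error_recursion_step (y := s * (K * v) ^ 2 ^ t) (μ := (v ^ 2 ^ (t + 1)) ^ 2) hC hM₀ hQ hx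
      hs hA hQA hCx hx3 ?_ ?_ (he t) ih (hstep t her)
    · rw [pow_succ 2 t, pow_mul]; ring
    -- The bandwidth bias carries the constant `C`, whereas `w` carries powers of `K`; enlarging `K`
    -- makes `w ^ 2` dominate in every round.
    · have h1 : K ≤ K ^ 2 ^ (t + 1) := le_self_pow₀ hK1 (by positivity)
      have h2 : (s * K) ^ 2 ≤ (s * K ^ 2 ^ (t + 1)) ^ 2 := by gcongr
      rw [mul_pow K v, ← mul_assoc, ← mul_assoc, mul_pow _ (v ^ 2 ^ (t + 1))]
      exact mul_le_mul_of_nonneg_right (hK.trans h2) (sq_nonneg _)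

/-! ### Union bound over the bandwidths -/

/-- By doubling, the sum of the terms before `N` is at most `a N`. A new term is added only if `a N
< 1`, so the total then stays below `2`. -/
lemma sum_lt_one_le_two {a : ℕ → ℝ} (h0 : ∀ t, 0 ≤ a t) (h2 : ∀ t, 2 * a t ≤ a (t + 1)) (N : ℕ) :
    ∑ t ∈ Finset.range N, (if a t < 1 then a t else 0) ≤ 2 := by
  have key : ∑ t ∈ Finset.range N, (if a t < 1 then a t else 0) ≤ min (a N) 2 := by
    induction N with
    | zero => simpa using h0 0
    | succ N ih =>
      rw [Finset.sum_range_succ]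
      have h3 := h2 N
      have h4 := h0 N
      rw [le_min_iff] at ih ⊢
      split_ifs with h
      · constructor <;> linarith
      · constructor <;> linarith
  exact key.trans (min_le_right _ _)

/-- If the probability of a bad event at bandwidth `h` is at most `δ * q / h`, then the bad events
at all bandwidths `max q (g t)`, with `g` halving at each step, have total probability at most
`3 * δ`. -/
lemma measure_iUnion_bandwidth_le {Ω : Type*} [MeasurableSpace Ω] {μ : Measure Ω}
    {bad : ℝ → Set Ω} {q δ : ℝ} {g : ℕ → ℝ} (hq : 0 < q) (hδ : 0 ≤ δ) (hg : ∀ t, 0 < g t)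
    (hg2 : ∀ t, 2 * g (t + 1) ≤ g t) (hbad0 : μ (bad q) ≤ ENNReal.ofReal δ)
    (hbad : ∀ t, q ≤ g t → μ (bad (g t)) ≤ ENNReal.ofReal (δ * (q / g t))) :
    μ (⋃ t, bad (max q (g t))) ≤ ENNReal.ofReal (3 * δ) := by
  set a : ℕ → ℝ := fun t => q / g t with ha
  have ha0 : ∀ t, 0 ≤ a t := fun t => (div_pos hq (hg t)).le
  have ha2 : ∀ t, 2 * a t ≤ a (t + 1) := fun t => by
    simp only [ha]
    rw [← mul_div_assoc, div_le_div_iff₀ (hg t) (hg (t + 1))]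
    nlinarith [hg2 t]
  -- Only rounds whose bandwidth exceeds the floor `q` need events of their own; all others use
  -- bandwidth `q` and share `bad q`.
  set B : ℕ → Set Ω := fun t => if a t < 1 then bad (g t) else ∅ with hB
  have hsub : (⋃ t, bad (max q (g t))) ⊆ bad q ∪ ⋃ t, B t := by
    intro ω hω
    obtain ⟨t, ht⟩ := mem_iUnion.1 hω
    rcases lt_or_ge (a t) 1 with h | h
    · right
      refine mem_iUnion.2 ⟨t, ?_⟩
      have : q ≤ g t := by
        have := (div_lt_one (hg t)).1 h
        exact this.le
      rw [max_eq_right this] at ht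
      simp only [hB]
      rw [if_pos h]
      exact ht
    · left
      have : g t ≤ q := (one_le_div (hg t)).1 h
      rwa [max_eq_left this] at ht
  have hBle : ∀ t, μ (B t) ≤ ENNReal.ofReal (δ * (if a t < 1 then a t else 0)) := fun t => by
    simp only [hB]
    split_ifs with h
    · exact hbad t ((div_lt_one (hg t)).1 h).le
    · simp
  have hsum : ∑' t, μ (B t) ≤ ENNReal.ofReal (2 * δ) := by
    refine ENNReal.tsum_le_of_sum_range_le fun N => ?_
    refine (Finset.sum_le_sum fun t _ => hBle t).trans ?_
    rw [← ENNReal.ofReal_sum_of_nonneg fun t _ => ?_]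
    · refine ENNReal.ofReal_le_ofReal ?_
      rw [← Finset.mul_sum, mul_comm 2]
      exact mul_le_mul_of_nonneg_left (sum_lt_one_le_two ha0 ha2 N) hδ
    · refine mul_nonneg hδ ?_
      split_ifs
      · exact ha0 t
      · exact le_rfl
  calc μ (⋃ t, bad (max q (g t))) ≤ μ (bad q) + μ (⋃ t, B t) :=
        (measure_mono hsub).trans (measure_union_le _ _)
    _ ≤ ENNReal.ofReal δ + ENNReal.ofReal (2 * δ) :=
        add_le_add hbad0 ((measure_iUnion_le _).trans hsum)
    _ = ENNReal.ofReal (3 * δ) := by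
        rw [← ENNReal.ofReal_add hδ (by positivity)]; congr 1; ring

/-! ### Rates -/

/-- The optimal rate `N ^ (-α / (2 α + 1))`. -/
def optRate (α : ℕ) (N : ℝ) : ℝ := N ^ (-(α : ℝ) / (2 * (α : ℝ) + 1))

/-- The uniform deviation rate `N ^ (-(α - 1) / (2 α + 1)) * √(log N)` of the Hessian. -/
def devRate (α : ℕ) (N : ℝ) : ℝ := N ^ (-((α : ℝ) - 1) / (2 * (α : ℝ) + 1)) * √(Real.log N)

lemma optRate_pos {α : ℕ} {N : ℝ} (hN : 0 < N) : 0 < optRate α N := Real.rpow_pos_of_pos hN _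

lemma devRate_nonneg {α : ℕ} {N : ℝ} (hN : 0 < N) : 0 ≤ devRate α N :=
  mul_nonneg (Real.rpow_pos_of_pos hN _).le (Real.sqrt_nonneg _)

/-- Variance balance: at bandwidth `h = N ^ (-1 / (2 α + 1))` the gradient noise `(N h) ^ (-1/2)`
equals the optimal rate. The bias `h ^ α` equals it too, by `rpow_pow_eq_optRate`. -/
lemma mul_optRate_sq {α : ℕ} {N : ℝ} (hN : 0 < N) :
    N * optRate α N ^ 2 * N ^ (-(1 / (2 * (α : ℝ) + 1))) = 1 := by
  have h : (2 * (α : ℝ) + 1) ≠ 0 := by positivity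
  have e : 1 + -(α : ℝ) / (2 * (α : ℝ) + 1) * (2 : ℕ) + -(1 / (2 * (α : ℝ) + 1)) = 0 := by
    push_cast
    field_simp
    ring
  calc N * optRate α N ^ 2 * N ^ (-(1 / (2 * (α : ℝ) + 1)))
      = N ^ (1 : ℝ) * N ^ (-(α : ℝ) / (2 * (α : ℝ) + 1) * (2 : ℕ)) *
          N ^ (-(1 / (2 * (α : ℝ) + 1))) := by
        rw [optRate, Real.rpow_mul_natCast hN.le, Real.rpow_one]
    _ = 1 := by rw [← Real.rpow_add hN, ← Real.rpow_add hN, e, Real.rpow_zero]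

/-- At the same bandwidth, Bernstein's exponent `N * h ^ 3 * η ^ 2` with `η` a multiple of `devRate`
is a multiple of `log N`, enough to beat a polynomial number of lattice points. -/
lemma mul_devRate_sq {α : ℕ} {N : ℝ} (hN : 1 ≤ N) :
    N * (N ^ (-(1 / (2 * (α : ℝ) + 1)))) ^ 3 * devRate α N ^ 2 = Real.log N := by
  have hN0 : 0 < N := by linarith
  have h : (2 * (α : ℝ) + 1) ≠ 0 := by positivity
  have e : 1 + -(1 / (2 * (α : ℝ) + 1)) * (3 : ℕ) +
      -((α : ℝ) - 1) / (2 * (α : ℝ) + 1) * (2 : ℕ) = 0 := by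
    push_cast
    field_simp
    ring
  calc N * (N ^ (-(1 / (2 * (α : ℝ) + 1)))) ^ 3 * devRate α N ^ 2
      = N ^ (1 : ℝ) * N ^ (-(1 / (2 * (α : ℝ) + 1)) * (3 : ℕ)) *
          N ^ (-((α : ℝ) - 1) / (2 * (α : ℝ) + 1) * (2 : ℕ)) * Real.log N := by
        rw [devRate, mul_pow, Real.sq_sqrt (Real.log_nonneg hN), Real.rpow_mul_natCast hN0.le,
          Real.rpow_mul_natCast hN0.le, Real.rpow_one, mul_assoc]
        ring
    _ = Real.log N := by
        rw [← Real.rpow_add hN0, ← Real.rpow_add hN0, e, Real.rpow_zero, one_mul]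

lemma rpow_pow_eq_optRate {α : ℕ} {N : ℝ} (hN : 0 ≤ N) :
    (N ^ (-(1 / (2 * (α : ℝ) + 1)))) ^ α = optRate α N := by
  rw [optRate, ← Real.rpow_mul_natCast hN]
  congr 1
  ring

lemma tendsto_rpow_of_neg {a : ℝ} (ha : a < 0) : Tendsto (fun N : ℝ => N ^ a) atTop (𝓝 0) := by
  have := tendsto_rpow_neg_atTop (y := -a) (by linarith)
  simpa using this

lemma tendsto_optRate {α : ℕ} (hα : 2 ≤ α) : Tendsto (optRate α) atTop (𝓝 0) := by
  have h2 : (2 : ℝ) ≤ α := by exact_mod_cast hα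
  exact tendsto_rpow_of_neg (div_neg_of_neg_of_pos (by linarith) (by linarith))

/-- The logarithm is traded for a loss of `1/8` in the numerator of the exponent: `α - 1` becomes `α
- 9/8`. -/
lemma eventually_devRate_le {α : ℕ} :
    ∀ᶠ N in atTop, devRate α N ≤ N ^ (-((α : ℝ) - 9 / 8) / (2 * (α : ℝ) + 1)) := by
  have hpos : 0 < 1 / 4 / (2 * (α : ℝ) + 1) := by positivity
  have h1 := (isLittleO_log_rpow_atTop hpos).bound one_pos
  filter_upwards [h1, eventually_ge_atTop 1] with N hN hN1
  have hN0 : 0 < N := by linarith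
  rw [one_mul, Real.norm_eq_abs, Real.norm_eq_abs, abs_of_nonneg (Real.log_nonneg hN1),
    abs_of_pos (Real.rpow_pos_of_pos hN0 _)] at hN
  have h2 : √(Real.log N) ≤ N ^ (1 / 8 / (2 * (α : ℝ) + 1)) := by
    refine Real.sqrt_le_iff.2 ⟨(Real.rpow_pos_of_pos hN0 _).le, hN.trans (le_of_eq ?_)⟩
    rw [← Real.rpow_natCast, ← Real.rpow_mul hN0.le]
    congr 1
    push_cast
    ring
  refine (mul_le_mul_of_nonneg_left h2 (Real.rpow_pos_of_pos hN0 _).le).trans (le_of_eq ?_)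
  rw [← Real.rpow_add hN0]
  congr 1
  ring

lemma tendsto_devRate {α : ℕ} (hα : 2 ≤ α) : Tendsto (devRate α) atTop (𝓝 0) := by
  have h2 : (2 : ℝ) ≤ α := by exact_mod_cast hα
  refine squeeze_zero' ?_ eventually_devRate_le
    (tendsto_rpow_of_neg (div_neg_of_neg_of_pos (by linarith) (by linarith)))
  filter_upwards [eventually_gt_atTop 0] with N hN using devRate_nonneg hN

/-- In units of `1 / (2 α + 1)` the decay exponents are `3 (α - 9/8)` and `α`; their difference `2 α
- 27/8` is positive for `α ≥ 2`. -/
lemma eventually_devRate_cube_le {α : ℕ} (hα : 2 ≤ α) {c : ℝ} (hc : 0 < c) :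
    ∀ᶠ N in atTop, devRate α N ^ 3 ≤ c * optRate α N := by
  have h2 : (2 : ℝ) ≤ α := by exact_mod_cast hα
  have hlim : Tendsto (fun N : ℝ => N ^ (-(2 * (α : ℝ) - 27 / 8) / (2 * (α : ℝ) + 1))) atTop (𝓝 0) :=
    tendsto_rpow_of_neg (div_neg_of_neg_of_pos (by linarith) (by linarith))
  filter_upwards [eventually_devRate_le (α := α), eventually_gt_atTop 0,
    hlim.eventually (ge_mem_nhds hc)] with N h1 hN h3
  calc devRate α N ^ 3 ≤ (N ^ (-((α : ℝ) - 9 / 8) / (2 * (α : ℝ) + 1))) ^ 3 :=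
        pow_le_pow_left₀ (devRate_nonneg hN) h1 3
    _ = N ^ (-(2 * (α : ℝ) - 27 / 8) / (2 * (α : ℝ) + 1)) * optRate α N := by
        rw [optRate, ← Real.rpow_natCast, ← Real.rpow_mul hN.le, ← Real.rpow_add hN]
        congr 1
        push_cast
        ring
    _ ≤ c * optRate α N := mul_le_mul_of_nonneg_right h3 (optRate_pos hN).le

/-- The comparison of exponents is `3 α / 4 + α - 9/8 ≥ α`, true for `α ≥ 2`. -/
lemma eventually_mul_devRate_le {α : ℕ} (hα : 2 ≤ α) :
    ∀ᶠ N in atTop, optRate α N ^ (3 / 4 : ℝ) * devRate α N ≤ optRate α N := by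
  have h2 : (2 : ℝ) ≤ α := by exact_mod_cast hα
  filter_upwards [eventually_devRate_le (α := α), eventually_ge_atTop 1] with N h1 hN
  have hN0 : 0 < N := by linarith
  refine (mul_le_mul_of_nonneg_left h1 (Real.rpow_pos_of_pos (optRate_pos hN0) _).le).trans ?_
  rw [optRate, ← Real.rpow_mul hN0.le, ← Real.rpow_add hN0]
  refine Real.rpow_le_rpow_of_exponent_le hN ?_
  rw [div_mul_eq_mul_div, ← add_div]
  exact div_le_div_of_nonneg_right (by linarith) (by linarith)

/-! ### Bandwidths -/

/-- The second term of the bandwidth. -/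
def decayBandwidth (α : ℕ) (m : ℝ) (t : ℕ) : ℝ := m ^ (-(2 : ℝ) ^ t / (3 * (α : ℝ)))

lemma decayBandwidth_succ {α : ℕ} {m : ℝ} (hm : 0 < m) (t : ℕ) :
    decayBandwidth α m (t + 1) = decayBandwidth α m t ^ 2 := by
  rw [decayBandwidth, decayBandwidth, ← Real.rpow_mul_natCast hm.le]
  congr 1
  push_cast
  ring

/-- Fixes the unit of the recursion, `v = m ^ (-1/6)`: `v ^ 2` is the initial rate, and the bias of
round `t` is the square of `v ^ 2 ^ t`. -/
lemma decayBandwidth_pow {α : ℕ} (hα : 2 ≤ α) {m : ℝ} (hm : 0 < m) (t : ℕ) :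
    decayBandwidth α m t ^ α = ((m ^ (-(1 / 6) : ℝ)) ^ 2 ^ t) ^ 2 := by
  have h2 : (α : ℝ) ≠ 0 := by positivity
  rw [decayBandwidth, ← Real.rpow_mul_natCast hm.le, ← Real.rpow_mul_natCast hm.le,
    ← Real.rpow_mul_natCast hm.le]
  congr 1
  push_cast
  field_simp
  norm_num

lemma decayBandwidth_pos {α : ℕ} {m : ℝ} (hm : 0 < m) (t : ℕ) : 0 < decayBandwidth α m t :=
  Real.rpow_pos_of_pos hm _

lemma decayBandwidth_le {α : ℕ} {m : ℝ} (hm : 1 ≤ m) (t : ℕ) :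
    decayBandwidth α m t ≤ decayBandwidth α m 0 := by
  refine Real.rpow_le_rpow_of_exponent_le hm ?_
  refine div_le_div_of_nonneg_right (neg_le_neg ?_) (by positivity)
  exact pow_le_pow_right₀ one_le_two (Nat.zero_le t)

lemma tendsto_decayBandwidth_zero {α : ℕ} (hα : 2 ≤ α) :
    Tendsto (fun m : ℝ => decayBandwidth α m 0) atTop (𝓝 0) := by
  have h2 : (2 : ℝ) ≤ α := by exact_mod_cast hα
  exact tendsto_rpow_of_neg (div_neg_of_neg_of_pos (by norm_num) (by linarith))

lemma bandwidth_eq {α : ℕ} {lam : ℝ} (hlam : 0 < lam) (n m t : ℕ) :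
    bandwidth α lam n m t = max (lam ^ (1 / (2 * (α : ℝ) + 1)) *
      (n : ℝ) ^ (-(1 / (2 * (α : ℝ) + 1)))) (decayBandwidth α m t) := by
  rw [bandwidth, decayBandwidth, Real.div_rpow hlam.le (Nat.cast_nonneg n),
    Real.rpow_neg (Nat.cast_nonneg n), div_eq_mul_inv]

/-! ### A bound uniform over the rounds -/

section BadEvent

variable {p : ℕ} {Ω : Type*}

/-- The event that some deviation of the Hessian exceeds `η` or some deviation of the gradient
exceeds `τ`. -/
def badEvent (P : Measure (Triple p)) (n : ℕ) (D : ℕ → Ω → Triple p) (H : ℝ → ℝ) (β : Vec p)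
    (h η τ : ℝ) : Set Ω :=
  {ω | ¬ ∀ b : Vec p, ‖b - β‖ ≤ 1 → ∀ j k, |hessDev P n D H β h b j k ω| ≤ η} ∪
    {ω | ¬ ∀ j, |gradDev P n D H β h β j ω| ≤ τ}

/-- Makes the discretisation error `1 / (h ^ 3 * N)` at most a multiple of `devRate`. -/
lemma one_le_mul_devRate {α : ℕ} {N : ℝ} (hN : 1 ≤ N) (hlog : 1 ≤ Real.log N)
    (hx : devRate α N ≤ 1) : 1 ≤ N * (N ^ (-(1 / (2 * (α : ℝ) + 1)))) ^ 3 * devRate α N := by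
  have hN0 : 0 < N := by linarith
  rw [← mul_devRate_sq hN (α := α)] at hlog
  refine hlog.trans (mul_le_mul_of_nonneg_left ?_ (by positivity))
  have := devRate_nonneg (α := α) hN0
  nlinarith

lemma inv_le_rpow {α : ℕ} {N : ℝ} (hN : 1 ≤ N) : 1 / N ≤ N ^ (-(1 / (2 * (α : ℝ) + 1))) := by
  rw [one_div, ← Real.rpow_neg_one]
  refine Real.rpow_le_rpow_of_exponent_le hN (neg_le_neg ?_)
  exact (div_le_one (by positivity)).2 (by linarith [Nat.cast_nonneg (α := ℝ) α])

/-- The bound is proportional to the ratio of the floor to `h`, the form that can be summed over the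
bandwidths. Of the two coefficients, the Hessian's vanishes as `n → ∞` and the gradient's is small
for large `M`. -/
lemma measure_badEvent_le [MeasurableSpace Ω] {μ : Measure Ω} {P : Measure (Triple p)}
    {D : ℕ → Ω → Triple p} {H : ℝ → ℝ} {β : Vec p} {α n : ℕ} {C r l a M h : ℝ} (hC : 0 < C)
    (hr : r ≤ 1) (hl : 0 < l) (ha : 0 < a) (haC : C * (p + 2) / l ^ 3 ≤ a ^ 2) (hM : 0 < M)
    (hess : ∀ (n : ℕ) (h η : ℝ), 0 < n → 0 < h → 0 < η → η * h ≤ r →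
      μ {ω | ¬ ∀ b : Vec p, ‖b - β‖ ≤ 1 → ∀ j k, |hessDev P n D H β h b j k ω| ≤
        η + C / (h ^ 3 * n)} ≤ ENNReal.ofReal (C * (n : ℝ) ^ p * Real.exp (-(n * h ^ 3 * η ^ 2 / C))))
    (grad : ∀ (n : ℕ) (h τ : ℝ), 0 < n → 0 < h → 0 < τ →
      μ {ω | ¬ ∀ j, |gradDev P n D H β h β j ω| ≤ τ} ≤ ENNReal.ofReal (C / (n * h * τ ^ 2)))
    (hn : 1 ≤ (n : ℝ)) (hlog : 1 ≤ Real.log n) (hx : devRate α n ≤ 1) (hax : a * devRate α n ≤ r)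
    (hqh : l * (n : ℝ) ^ (-(1 / (2 * (α : ℝ) + 1))) ≤ h) (hh : h ≤ r) :
    μ (badEvent P n D H β h ((a + C / l ^ 3) * devRate α n) (M * optRate α n)) ≤
      ENNReal.ofReal ((C / (l * n) + C / (M ^ 2 * l)) *
        (l * (n : ℝ) ^ (-(1 / (2 * (α : ℝ) + 1))) / h)) := by
  have hn0 : 0 < (n : ℝ) := by linarith
  have hnn : 0 < n := by exact_mod_cast hn0
  have hq1 := inv_le_rpow (α := α) hn
  have hx1 := one_le_mul_devRate (α := α) hn hlog hx
  have hx2 := mul_devRate_sq (α := α) hn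
  have hQ2 := mul_optRate_sq (α := α) hn0
  have hQ := optRate_pos (α := α) hn0
  have hx0 : 0 < devRate α n := by
    refine lt_of_le_of_ne (devRate_nonneg hn0) fun h => ?_
    rw [← h, mul_zero] at hx1
    linarith
  have hq0 : 0 < (n : ℝ) ^ (-(1 / (2 * (α : ℝ) + 1))) := Real.rpow_pos_of_pos hn0 _
  obtain ⟨q, hq⟩ : ∃ q, q = (n : ℝ) ^ (-(1 / (2 * (α : ℝ) + 1))) := ⟨_, rfl⟩
  obtain ⟨x, hxx⟩ : ∃ x, x = devRate α (n : ℝ) := ⟨_, rfl⟩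
  obtain ⟨Q, hQQ⟩ : ∃ Q, Q = optRate α (n : ℝ) := ⟨_, rfl⟩
  rw [← hq] at hq1 hx1 hx2 hQ2 hq0 hqh ⊢
  rw [← hxx] at hx1 hx2 hx0 hx hax ⊢
  rw [← hQQ] at hQ2 hQ ⊢
  have hh0 : 0 < h := lt_of_lt_of_le (by positivity) hqh
  have hh3 : l ^ 3 * q ^ 3 ≤ h ^ 3 := by
    rw [← mul_pow]; exact pow_le_pow_left₀ (by positivity) hqh 3
  -- the Hessian
  have h1 : μ {ω | ¬ ∀ b : Vec p, ‖b - β‖ ≤ 1 → ∀ j k, |hessDev P n D H β h b j k ω| ≤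
      (a + C / l ^ 3) * x} ≤ ENNReal.ofReal (C / (l * n) * (l * q / h)) := by
    refine (measure_mono ?_).trans ((hess n h (a * x) hnn hh0 (by positivity) ?_).trans
      (ENNReal.ofReal_le_ofReal ?_))
    · have hle : C / (h ^ 3 * n) ≤ C / l ^ 3 * x := by
        rw [div_mul_eq_mul_div, div_le_div_iff₀ (by positivity) (by positivity), mul_assoc]
        refine mul_le_mul_of_nonneg_left ?_ hC.le
        calc l ^ 3 = l ^ 3 * 1 := (mul_one _).symm
          _ ≤ l ^ 3 * (n * q ^ 3 * x) := by gcongr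
          _ = x * (l ^ 3 * q ^ 3 * n) := by ring
          _ ≤ x * (h ^ 3 * n) := by gcongr
      intro ω hω hcon
      refine hω fun b hb j k => (hcon b hb j k).trans ?_
      rw [add_mul]
      exact add_le_add le_rfl hle
    · nlinarith [mul_pos ha hx0]
    -- Exponent `p + 2`: `p` powers of `n` cancel the lattice points. Of the remaining `1 / n ^ 2`,
    -- one factor goes into the coefficient and the other is at most `q / h`, as `h ≤ 1`.
    · have hexp : (p + 2) * Real.log n ≤ n * h ^ 3 * (a * x) ^ 2 / C := by
        rw [le_div_iff₀ hC]
        have e1 : C * (p + 2) ≤ a ^ 2 * l ^ 3 := (div_le_iff₀ (by positivity)).1 haC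
        calc (p + 2) * Real.log n * C = C * (p + 2) * (n * q ^ 3 * x ^ 2) := by rw [hx2]; ring
          _ ≤ a ^ 2 * l ^ 3 * (n * q ^ 3 * x ^ 2) := by gcongr
          _ = n * (l ^ 3 * q ^ 3) * (a * x) ^ 2 := by ring
          _ ≤ n * h ^ 3 * (a * x) ^ 2 := by gcongr
      have e2 : Real.exp (-(n * h ^ 3 * (a * x) ^ 2 / C)) ≤ ((n : ℝ) ^ (p + 2))⁻¹ := by
        rw [Real.exp_neg]
        refine inv_anti₀ (by positivity) ?_
        calc ((n : ℝ) ^ (p + 2)) = Real.exp ((p + 2) * Real.log n) := by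
              rw [← Real.exp_log (pow_pos hn0 (p + 2)), Real.log_pow]; push_cast; ring_nf
          _ ≤ _ := Real.exp_le_exp.2 hexp
      calc C * (n : ℝ) ^ p * Real.exp (-(n * h ^ 3 * (a * x) ^ 2 / C))
          ≤ C * (n : ℝ) ^ p * ((n : ℝ) ^ (p + 2))⁻¹ := by gcongr
        _ = C / n * (1 / n) := by rw [pow_add]; field_simp
        _ ≤ C / n * (q / h) := by
            refine mul_le_mul_of_nonneg_left (hq1.trans ?_) (by positivity)
            rw [le_div_iff₀ hh0]
            nlinarith
        _ = C / (l * n) * (l * q / h) := by field_simp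
  have h2 : μ {ω | ¬ ∀ j, |gradDev P n D H β h β j ω| ≤ M * Q} ≤
      ENNReal.ofReal (C / (M ^ 2 * l) * (l * q / h)) := by
    refine (grad n h (M * Q) hnn hh0 (by positivity)).trans (ENNReal.ofReal_le_ofReal (le_of_eq ?_))
    have : (C / (M ^ 2 * l) * (l * q / h)) = C * (n * Q ^ 2 * q) / (n * h * (M * Q) ^ 2) := by
      field_simp
    rw [this, hQ2, mul_one]
  refine (measure_union_le _ _).trans ((add_le_add h1 h2).trans ?_)
  rw [← ENNReal.ofReal_add (by positivity) (by positivity), add_mul]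

end BadEvent

/-! ### The iterates off the bad events, and the choice of the constants. -/

section Iterates

variable {p : ℕ} {Ω : Type*}

/-- Off the bad events everything is deterministic and `error_recursion` applies, with `C * (1 + a)`
as its constant and `M₀ = C * (l ^ α + M)`, where `l = lam ^ (1 / (2 α + 1))`. The invariant also
keeps every iterate in the ball where the one-round bound is valid. -/
lemma norm_iterate_sub_le {P : Measure (Triple p)} {D : ℕ → Ω → Triple p} {H : ℝ → ℝ} {β : Vec p}
    {α : ℕ} {C r lam a M A s K : ℝ} (hα : 2 ≤ α) (hC : 1 ≤ C)
    (hstep : ∀ (m L : ℕ) (h η τ : ℝ) (ω : Ω) (b : Vec p), 0 < h → h ≤ r → 0 ≤ η → η ≤ r → 0 ≤ τ →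
      ‖b - β‖ ≤ r →
      (∀ b' : Vec p, ‖b' - β‖ ≤ 1 → ∀ j k, |hessDev P (L * m) D H β h b' j k ω| ≤ η) →
      (∀ j, |gradDev P (L * m) D H β h β j ω| ≤ τ) →
      ‖newton H h m L (fun i => observe β (D i ω)) b - β‖ ≤
        C * (h ^ α + ‖b - β‖ ^ 2 + η * ‖b - β‖ + τ))
    (hlam : 0 < lam) (ha : 0 ≤ a) (hM : 0 ≤ M)
    (hA : A = 2 * (C * ((lam ^ (1 / (2 * (α : ℝ) + 1))) ^ α + M) + 1))
    (hs : s = 1 / (12 * (C * (1 + a)))) (hK1 : 1 ≤ K) (hK : 2 * (C * (1 + a)) ≤ (s * K) ^ 2)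
    {m L n : ℕ} (hn : n = L * m) (hm : 1 ≤ m) (hL : 1 ≤ L)
    (hr : ∀ t, bandwidth α lam n m t ≤ r) (har : a * devRate α n ≤ r)
    (hQA : 24 * (C * (1 + a)) * A * optRate α n ≤ 1)
    (hCx : C * (1 + a) * devRate α n ≤ 1 / 8)
    (hx3 : C * (1 + a) * devRate α n ^ 3 ≤ 4 * optRate α n)
    (hKv : K * (m : ℝ) ^ (-(1 / 6) : ℝ) ≤ 1)
    (hsum : A * optRate α n + (s * (K * (m : ℝ) ^ (-(1 / 6) : ℝ))) ^ 2 +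
      s * (K * (m : ℝ) ^ (-(1 / 6) : ℝ)) * devRate α n ≤ r)
    {ω : Ω} (hω : ∀ t, ω ∉ badEvent P n D H β (bandwidth α lam n m t) (a * devRate α n)
      (M * optRate α n))
    {b₀ : Vec p} (hb₀ : ‖b₀ - β‖ ≤ (s * (K * (m : ℝ) ^ (-(1 / 6) : ℝ))) ^ 2) (t : ℕ) :
    ‖iterate H (bandwidth α lam n m) m L (fun i => observe β (D i ω)) b₀ t - β‖ ≤
      A * optRate α n + (s * (K * (m : ℝ) ^ (-(1 / 6) : ℝ)) ^ 2 ^ t) ^ 2 +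
      s * (K * (m : ℝ) ^ (-(1 / 6) : ℝ)) ^ 2 ^ t * devRate α n := by
  have hm0 : (0 : ℝ) < m := by exact_mod_cast hm
  have hn1 : 1 ≤ n := by rw [hn]; exact Nat.mul_pos hL hm
  have hn0 : (0 : ℝ) < n := by exact_mod_cast hn1
  have hQ := optRate_pos (α := α) hn0
  have hx := devRate_nonneg (α := α) hn0
  have hl : 0 < lam ^ (1 / (2 * (α : ℝ) + 1)) := Real.rpow_pos_of_pos hlam _
  have hC0 : 0 ≤ C := by linarith
  have hCa : C ≤ C * (1 + a) := by nlinarith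
  refine error_recursion (e := fun t => ‖iterate H (bandwidth α lam n m) m L
    (fun i => observe β (D i ω)) b₀ t - β‖) (hC.trans hCa) (by positivity) hQ hx hs hA hQA hCx hx3
    hK1 hK (Real.rpow_pos_of_pos hm0 _) hKv hsum (fun t => norm_nonneg _) hb₀ ?_ t
  intro t ht
  have hb : 0 < bandwidth α lam n m (t + 1) := by
    rw [bandwidth_eq hlam]
    exact lt_max_of_lt_right (decayBandwidth_pos hm0 _)
  have hnot := hω (t + 1)
  simp only [badEvent, Set.mem_union, Set.mem_ofPred_eq, not_or, not_not] at hnot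
  rw [hn] at hnot
  have key := hstep m L (bandwidth α lam n m (t + 1)) (a * devRate α n) (M * optRate α n) ω
    (iterate H (bandwidth α lam n m) m L (fun i => observe β (D i ω)) b₀ t) hb (hr _)
    (by positivity) har (by positivity) ht (by rw [hn]; exact hnot.1) (by rw [hn]; exact hnot.2)
  refine key.trans ?_
  have hpow : bandwidth α lam n m (t + 1) ^ α ≤ (lam ^ (1 / (2 * (α : ℝ) + 1))) ^ α * optRate α n +
      (((m : ℝ) ^ (-(1 / 6) : ℝ)) ^ 2 ^ (t + 1)) ^ 2 := by
    rw [bandwidth_eq hlam, ← rpow_pow_eq_optRate hn0.le, ← mul_pow, ← decayBandwidth_pow hα hm0]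
    have h1 : 0 ≤ lam ^ (1 / (2 * (α : ℝ) + 1)) * (n : ℝ) ^ (-(1 / (2 * (α : ℝ) + 1))) := by
      positivity
    have h2 := (decayBandwidth_pos (α := α) hm0 (t + 1)).le
    rcases max_choice (lam ^ (1 / (2 * (α : ℝ) + 1)) * (n : ℝ) ^ (-(1 / (2 * (α : ℝ) + 1))))
      (decayBandwidth α m (t + 1)) with h | h <;> rw [h]
    · exact le_add_of_nonneg_right (pow_nonneg h2 _)
    · exact le_add_of_nonneg_left (pow_nonneg h1 _)
  obtain ⟨e, he⟩ : ∃ e, e = ‖iterate H (bandwidth α lam n m) m L (fun i => observe β (D i ω)) b₀ t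
    - β‖ := ⟨_, rfl⟩
  have he0 : 0 ≤ e := by rw [he]; exact norm_nonneg _
  simp only [← he]
  have h1 := mul_le_mul_of_nonneg_left hpow hC0
  have h2 : 0 ≤ (C * (1 + a) - C) * e ^ 2 := mul_nonneg (by linarith) (sq_nonneg e)
  have h3 : 0 ≤ C * (e * devRate α n) := by positivity
  have h4 : 0 ≤ (C * (1 + a) - C) * (((m : ℝ) ^ (-(1 / 6) : ℝ)) ^ 2 ^ (t + 1)) ^ 2 :=
    mul_nonneg (by linarith) (sq_nonneg _)
  linarith

end Iterates

/-- The quantifier over `t` stands inside the event and `A`, `s`, `K` do not depend on `k`; this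
permits a number of rounds that grows with `k`. -/
theorem exists_uniform_bound {p : ℕ} {Ω : Type*} [MeasurableSpace Ω] (μ : Measure Ω)
    [IsProbabilityMeasure μ] (P : Measure (Triple p)) [IsProbabilityMeasure P]
    (D : ℕ → Ω → Triple p) (hD : IsSample μ D P) (β : Vec p) (α : ℕ) (H : ℝ → ℝ)
    (ρ : Vec p → ℝ → ℝ) (hId : Identification P β) (hH : KernelAssumption α H)
    (hρ : DensityAssumption P β α ρ) (hF : NoiseAssumption P α) (hV : EigenvalueAssumption P ρ)
    (hZ : BoundedCovariates P) {lam : ℝ} (hlam : 0 < lam) {m L n : ℕ → ℕ} (hL : ∀ k, 1 ≤ L k)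
    (hn : ∀ k, n k = L k * m k) (hm : Tendsto m atTop atTop) {β₀ : ℕ → Ω → Vec p}
    (hβ₀ : IsBigOP μ (fun k ω => ‖β₀ k ω - β‖) (fun k => (m k : ℝ) ^ (-(1 : ℝ) / 3))) {ε : ℝ}
    (hε : 0 < ε) :
    ∃ A s K : ℝ, 0 ≤ A ∧ 0 < s ∧ 1 ≤ K ∧ ∀ᶠ k in atTop,
      μ {ω | ¬ ∀ t, ‖iterate H (bandwidth α lam (n k) (m k)) (m k) (L k)
          (fun i => observe β (D i ω)) (β₀ k ω) t - β‖ ≤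
        A * optRate α (n k) + (s * (K * (m k : ℝ) ^ (-(1 / 6) : ℝ)) ^ 2 ^ t) ^ 2 +
        s * (K * (m k : ℝ) ^ (-(1 / 6) : ℝ)) ^ 2 ^ t * devRate α (n k)} ≤ ENNReal.ofReal ε := by
  obtain ⟨C, hC, r, hr, hr1, step, hess, grad⟩ :=
    exists_round_bounds μ P D hD β α H ρ hId hH hρ hF hV hZ
  have hα := hH.two_le
  have hC0 : 0 < C := by linarith
  obtain ⟨l, hl⟩ : ∃ l, l = lam ^ (1 / (2 * (α : ℝ) + 1)) := ⟨_, rfl⟩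
  have hl0 : 0 < l := by rw [hl]; exact Real.rpow_pos_of_pos hlam _
  obtain ⟨M, hM0, hM⟩ : ∃ M, 0 < M ∧ C / (M ^ 2 * l) ≤ ε / 12 := by
    refine ⟨12 * C / (l * ε) + 1, by positivity, ?_⟩
    have h0 : 0 < 12 * C / (l * ε) := by positivity
    have h1 : 12 * C = 12 * C / (l * ε) * (l * ε) := by field_simp
    rw [div_le_div_iff₀ (by positivity) (by norm_num)]
    have h2 : 12 * C / (l * ε) ≤ (12 * C / (l * ε) + 1) ^ 2 := by nlinarith
    calc C * 12 = 12 * C / (l * ε) * (l * ε) := by rw [← h1]; ring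
      _ ≤ (12 * C / (l * ε) + 1) ^ 2 * (l * ε) := by gcongr
      _ = _ := by ring
  obtain ⟨a₀, ha₀, ha₀C⟩ : ∃ a₀ : ℝ, 0 < a₀ ∧ C * (p + 2) / l ^ 3 ≤ a₀ ^ 2 := by
    have h0 : 0 < C * (p + 2) / l ^ 3 := by positivity
    exact ⟨C * (p + 2) / l ^ 3 + 1, by positivity, by nlinarith⟩
  obtain ⟨a, ha⟩ : ∃ a, a = a₀ + C / l ^ 3 := ⟨_, rfl⟩
  have ha0 : 0 < a := by rw [ha]; positivity
  have ha₀a : a₀ ≤ a := by rw [ha]; exact le_add_of_nonneg_right (by positivity)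
  obtain ⟨C', hC'⟩ : ∃ C', C' = C * (1 + a) := ⟨_, rfl⟩
  have hC'0 : 0 < C' := by rw [hC']; positivity
  obtain ⟨s, hs⟩ : ∃ s, s = 1 / (12 * C') := ⟨_, rfl⟩
  have hs0 : 0 < s := by rw [hs]; positivity
  obtain ⟨A, hA⟩ : ∃ A, A = 2 * (C * (l ^ α + M) + 1) := ⟨_, rfl⟩
  have hA0 : 0 ≤ A := by rw [hA]; positivity
  obtain ⟨M₁, hM₁⟩ := hβ₀ (ε / 2) (by positivity)
  -- `K` must dominate both the bandwidth bias in the recursion and the constant `M₁` of the initial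
  -- estimator.
  obtain ⟨K, hK1, hKC, hKM⟩ : ∃ K : ℝ, 1 ≤ K ∧ 2 * C' ≤ (s * K) ^ 2 ∧ M₁ ≤ (s * K) ^ 2 := by
    have h0 : 0 ≤ (2 * C' + |M₁|) / s ^ 2 := by positivity
    have h1 : 2 * C' + |M₁| = s ^ 2 * ((2 * C' + |M₁|) / s ^ 2) := by field_simp
    have h2 : 2 * C' + |M₁| ≤ (s * (1 + (2 * C' + |M₁|) / s ^ 2)) ^ 2 := by
      rw [mul_pow]
      refine h1.le.trans (mul_le_mul_of_nonneg_left ?_ (sq_nonneg s))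
      nlinarith
    exact ⟨1 + (2 * C' + |M₁|) / s ^ 2, by linarith, by linarith [abs_nonneg M₁],
      by linarith [le_abs_self M₁]⟩
  refine ⟨A, s, K, hA0, hs0, hK1, ?_⟩
  have hmR : Tendsto (fun k => (m k : ℝ)) atTop atTop := tendsto_natCast_atTop_atTop.comp hm
  have hnR : Tendsto (fun k => (n k : ℝ)) atTop atTop := by
    refine tendsto_atTop_mono (fun k => ?_) hmR
    rw [hn k]
    exact_mod_cast Nat.le_mul_of_pos_left _ (hL k)
  have limQ := (tendsto_optRate hα).comp hnR
  have limx := (tendsto_devRate hα).comp hnR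
  have limv : Tendsto (fun k => (m k : ℝ) ^ (-(1 / 6) : ℝ)) atTop (𝓝 0) :=
    (tendsto_rpow_of_neg (by norm_num)).comp hmR
  have limq : Tendsto (fun k => (n k : ℝ) ^ (-(1 / (2 * (α : ℝ) + 1)))) atTop (𝓝 0) :=
    (tendsto_rpow_of_neg (neg_lt_zero.2 (by positivity))).comp hnR
  have limg : Tendsto (fun k => decayBandwidth α (m k) 0) atTop (𝓝 0) :=
    (tendsto_decayBandwidth_zero hα).comp hmR
  have small : ∀ (c δ : ℝ) (f : ℕ → ℝ), 0 < δ → Tendsto f atTop (𝓝 0) →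
      ∀ᶠ k in atTop, c * f k ≤ δ := fun c δ f hδ hf => by
    have := hf.const_mul c
    rw [mul_zero] at this
    exact this.eventually (ge_mem_nhds hδ)
  have limsum : Tendsto (fun k => A * optRate α (n k) + (s * (K * (m k : ℝ) ^ (-(1 / 6) : ℝ))) ^ 2 +
      s * (K * (m k : ℝ) ^ (-(1 / 6) : ℝ)) * devRate α (n k)) atTop (𝓝 0) := by
    have h := ((limQ.const_mul A).add (((limv.const_mul K).const_mul s).pow 2)).add
      (((limv.const_mul K).const_mul s).mul limx)
    simpa using h
  filter_upwards [hM₁, hm.eventually_ge_atTop 1, hnR.eventually_ge_atTop 1,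
    (Real.tendsto_log_atTop.comp hnR).eventually_ge_atTop 1, small 1 1 _ one_pos limx,
    small a r _ hr limx, small C' (1 / 8) _ (by norm_num) limx,
    hnR.eventually (eventually_devRate_cube_le hα (c := 4 / C') (by positivity)),
    small (24 * C' * A) 1 _ one_pos limQ, small K 1 _ one_pos limv,
    limsum.eventually (ge_mem_nhds hr), small l r _ hr limq, small 1 r _ hr limg,
    small 1 (1 / 2) _ (by norm_num) limg,
    (((tendsto_const_nhds (x := C / l)).div_atTop hnR).eventually
      (ge_mem_nhds (by positivity : 0 < ε / 12)))]
    with k h₀ hm1 hn1 hlog hx1 hxa hxC hx3 hQA hKv hsum hlq hg hg2 hCn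
  simp only [Function.comp_apply, one_mul] at hlog hx1 hxa hxC hQA hg hg2
  have hm0 : (0 : ℝ) < m k := by exact_mod_cast hm1
  have hm1' : (1 : ℝ) ≤ m k := by exact_mod_cast hm1
  have hn0 : (0 : ℝ) < n k := by linarith
  have hxpos := devRate_nonneg (α := α) hn0
  have hgt : ∀ t, decayBandwidth α (m k) t ≤ decayBandwidth α (m k) 0 := decayBandwidth_le hm1'
  have hgpos : ∀ t, 0 < decayBandwidth α (m k) t := decayBandwidth_pos hm0
  obtain ⟨q, hq⟩ : ∃ q, q = l * (n k : ℝ) ^ (-(1 / (2 * (α : ℝ) + 1))) := ⟨_, rfl⟩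
  have hq0 : 0 < q := by rw [hq]; exact mul_pos hl0 (Real.rpow_pos_of_pos hn0 _)
  have hband : ∀ t, bandwidth α lam (n k) (m k) t = max q (decayBandwidth α (m k) t) := fun t => by
    rw [bandwidth_eq hlam, hq, hl]
  have hprob : ∀ h, q ≤ h → h ≤ r → μ (badEvent P (n k) D H β h (a * devRate α (n k))
      (M * optRate α (n k))) ≤ ENNReal.ofReal ((C / (l * n k) + C / (M ^ 2 * l)) * (q / h)) := by
    intro h h1 h2
    rw [ha, hq]
    exact measure_badEvent_le hC0 hr1 hl0 ha₀ ha₀C hM0 hess grad hn1 hlog hx1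
      ((mul_le_mul_of_nonneg_right ha₀a hxpos).trans hxa) (by rw [← hq]; exact h1) h2
  have hunion := measure_iUnion_bandwidth_le (μ := μ)
    (bad := fun h => badEvent P (n k) D H β h (a * devRate α (n k)) (M * optRate α (n k)))
    (q := q) (δ := C / (l * n k) + C / (M ^ 2 * l)) (g := decayBandwidth α (m k)) hq0
    (by positivity) hgpos
    -- Each decay bandwidth is the square of the previous one; once the first is at most `1/2`,
    -- squaring at least halves.
    (fun t => by
      rw [decayBandwidth_succ hm0]
      nlinarith [hgt t, hgpos t])
    (by
      have := hprob q le_rfl (hq ▸ hlq)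
      rwa [div_self hq0.ne', mul_one] at this)
    (fun t ht => hprob _ ht ((hgt t).trans hg))
  refine (measure_mono (t := {ω | M₁ * (m k : ℝ) ^ (-(1 : ℝ) / 3) < |‖β₀ k ω - β‖|} ∪
    ⋃ t, badEvent P (n k) D H β (max q (decayBandwidth α (m k) t)) (a * devRate α (n k))
      (M * optRate α (n k))) ?_).trans ((measure_union_le _ _).trans
      ((add_le_add h₀ hunion).trans ?_))
  · intro ω hω
    by_contra hcon
    rw [Set.mem_union, not_or, Set.mem_iUnion, not_exists] at hcon
    obtain ⟨hc1, hc2⟩ := hcon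
    rw [Set.mem_ofPred_eq, not_lt, abs_of_nonneg (norm_nonneg _)] at hc1
    refine hω fun t => norm_iterate_sub_le hα hC step hlam ha0.le hM0.le (by rw [hA, hl])
      (by rw [hs, hC']) hK1 (by rw [← hC']; exact hKC) (hn k) hm1 (hL k) (fun t => ?_) hxa
      (by rw [← hC']; exact hQA) (by rw [← hC']; exact hxC) ?_ hKv hsum
      (fun t => by rw [hband t]; exact hc2 t) ?_ t
    · rw [hband t]
      exact max_le (hq ▸ hlq) ((hgt t).trans hg)
    · rw [← hC']
      calc C' * devRate α (n k) ^ 3 ≤ C' * (4 / C' * optRate α (n k)) := by gcongr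
        _ = 4 * optRate α (n k) := by field_simp
    · refine hc1.trans ?_
      have e : (m k : ℝ) ^ (-(1 : ℝ) / 3) = ((m k : ℝ) ^ (-(1 / 6) : ℝ)) ^ 2 := by
        rw [← Real.rpow_mul_natCast hm0.le]; congr 1; norm_num
      rw [e, ← mul_assoc, mul_pow]
      exact mul_le_mul_of_nonneg_right hKM (sq_nonneg _)
  -- Budget: `ε / 2` for the initial estimator and `3 * (ε / 12 + ε / 12)` for the bad events of all
  -- rounds.
  · rw [← ENNReal.ofReal_add (by positivity) (by positivity)]
    refine ENNReal.ofReal_le_ofReal ?_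
    have : C / (l * n k) = C / l / n k := by rw [div_div]
    rw [this]
    linarith

/-! ### The number of rounds -/

lemma roundBound_arg_pos {α : ℕ} (hα : 2 ≤ α) {lam : ℝ} {n m : ℕ}
    (hn : Real.log lam < Real.log n) (hm : 0 < Real.log m) :
    0 < 6 * (α : ℝ) / (2 * (α : ℝ) + 1) * ((Real.log n - Real.log lam) / Real.log m) := by
  have : (0 : ℝ) < α := by exact_mod_cast (by omega : 0 < α)
  have := sub_pos.2 hn
  positivity

lemma roundBound_le {α : ℕ} (hα : 2 ≤ α) {lam : ℝ} {n m : ℕ} (hn : |Real.log lam| < Real.log n)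
    (hm : 1 ≤ Real.log m) : roundBound α lam n m ≤ Real.logb 2 (6 * Real.log n) := by
  have h1 := abs_lt.1 hn
  refine Real.logb_le_logb_of_le one_lt_two (roundBound_arg_pos hα h1.2 (by linarith)) ?_
  have h2 : 6 * (α : ℝ) / (2 * (α : ℝ) + 1) ≤ 3 := by
    rw [div_le_iff₀ (by positivity)]; linarith
  have h3 : (Real.log n - Real.log lam) / Real.log m ≤ 2 * Real.log n :=
    (div_le_self (by linarith) hm).trans (by linarith)
  have h4 : 0 ≤ (Real.log n - Real.log lam) / Real.log m :=
    div_nonneg (by linarith) (by linarith)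
  calc _ ≤ 3 * (2 * Real.log n) := mul_le_mul h2 h3 h4 (by norm_num)
    _ = 6 * Real.log n := by ring

lemma ceil_roundBound_le {α : ℕ} (hα : 2 ≤ α) {lam : ℝ} {n m : ℕ}
    (hn : |Real.log lam| < Real.log n) (hm : 1 ≤ Real.log m) (hlog : 1 ≤ Real.log (Real.log n)) :
    ((⌈roundBound α lam n m⌉₊ : ℕ) : ℝ) ≤
      (Real.log 6 + Real.log 2 + 1) / Real.log 2 * Real.log (Real.log n) := by
  have hn0 : 0 < Real.log n := (abs_nonneg _).trans_lt hn
  have h2 : 0 < Real.log 2 := Real.log_pos one_lt_two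
  have h6 : 0 < Real.log 6 := Real.log_pos (by norm_num)
  have e : Real.logb 2 (6 * Real.log n) = (Real.log 6 + Real.log (Real.log n)) / Real.log 2 := by
    rw [Real.logb, Real.log_mul (by norm_num) hn0.ne']
  have h0 : 0 ≤ Real.logb 2 (6 * Real.log n) := by
    rw [e]; exact div_nonneg (by linarith) h2.le
  have h1 : ((⌈roundBound α lam n m⌉₊ : ℕ) : ℝ) ≤ (⌈Real.logb 2 (6 * Real.log n)⌉₊ : ℕ) := by
    exact_mod_cast Nat.ceil_mono (roundBound_le hα hn hm)
  refine (h1.trans (Nat.ceil_lt_add_one h0).le).trans ?_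
  rw [e, div_add_one h2.ne', div_mul_eq_mul_div]
  refine div_le_div_of_nonneg_right ?_ h2.le
  nlinarith

/-- The threshold is the one at which `m ^ (-2 ^ T / 6)` falls below `(n / λ) ^ (-α / (2 α + 1))`.
Replacing `1/6` by `1/8` costs the exponent `3/4` and gives room to absorb `K ^ 2 ^ T`, which is
unbounded when `T` grows. -/
lemma pow_two_pow_le_of_roundBound_le {α : ℕ} (hα : 2 ≤ α) {lam u : ℝ} {n m T : ℕ}
    (hn1 : 1 ≤ n) (hn : Real.log lam < Real.log n) (hm : 0 < Real.log m) (hu : 0 ≤ u)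
    (hum : u ≤ (m : ℝ) ^ (-(1 / 8) : ℝ)) (hT : roundBound α lam n m ≤ T) :
    u ^ 2 ^ T ≤ Real.exp (3 / 4 * (α / (2 * α + 1)) * Real.log lam) *
      optRate α n ^ (3 / 4 : ℝ) := by
  have hn0 : (0 : ℝ) < n := by exact_mod_cast hn1
  have hm0 : (0 : ℝ) < m := by
    rcases Nat.eq_zero_or_pos m with h | h
    · simp [h] at hm
    · exact_mod_cast h
  have hle : 6 * (α : ℝ) / (2 * (α : ℝ) + 1) * ((Real.log n - Real.log lam) / Real.log m) ≤
      (2 : ℝ) ^ T := by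
    rw [roundBound] at hT
    rw [← Real.rpow_natCast]
    exact (Real.logb_le_iff_le_rpow one_lt_two (roundBound_arg_pos hα hn hm)).1 hT
  refine (pow_le_pow_left₀ hu hum _).trans ?_
  rw [← Real.rpow_mul_natCast hm0.le, Real.rpow_def_of_pos hm0, optRate, ← Real.rpow_mul hn0.le,
    Real.rpow_def_of_pos hn0, ← Real.exp_add, Real.exp_le_exp]
  have h1 := mul_le_mul_of_nonneg_left hle hm.le
  have h2 : Real.log m * (6 * (α : ℝ) / (2 * (α : ℝ) + 1) *
      ((Real.log n - Real.log lam) / Real.log m)) =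
      6 * (α / (2 * (α : ℝ) + 1)) * (Real.log n - Real.log lam) := by
    field_simp
  rw [h2] at h1
  push_cast
  have h3 : -(α : ℝ) / (2 * α + 1) = -(α / (2 * α + 1)) := neg_div _ _
  rw [h3]
  linarith

/-! ### Stochastic order of the iterates -/

lemma isBigOP_of_forall_bound {Ω : Type*} [MeasurableSpace Ω] {μ : Measure Ω} {E : ℕ → Ω → ℝ}
    {a : ℕ → ℝ} (hE : ∀ k ω, 0 ≤ E k ω)
    (h : ∀ ε : ℝ, 0 < ε → ∃ M : ℝ, ∃ b : ℕ → ℝ, (∀ᶠ k in atTop, b k ≤ M * a k) ∧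
      ∀ᶠ k in atTop, μ {ω | ¬ E k ω ≤ b k} ≤ ENNReal.ofReal ε) : IsBigOP μ E a := by
  intro ε hε
  obtain ⟨M, b, hb, hμ⟩ := h ε hε
  refine ⟨M, ?_⟩
  filter_upwards [hb, hμ] with k h1 h2
  refine (measure_mono fun ω hω => ?_).trans h2
  rw [Set.mem_ofPred_eq, abs_of_nonneg (hE k ω)] at hω
  exact not_le.2 (h1.trans_lt hω)

end

end MultiRoundSMSE

/-! ### The rates for fixed and for growing numbers of rounds. -/

theorem theorem2 {p : ℕ} {Ω : Type*} [MeasurableSpace Ω] (μ : Measure Ω) [IsProbabilityMeasure μ]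
    (P : Measure (MultiRoundSMSE.Triple p)) [IsProbabilityMeasure P]
    (D : ℕ → Ω → MultiRoundSMSE.Triple p) (hD : MultiRoundSMSE.IsSample μ D P)
    (βstar : MultiRoundSMSE.Vec p) (α : ℕ) (H : ℝ → ℝ) (ρ : MultiRoundSMSE.Vec p → ℝ → ℝ)
    (hId : MultiRoundSMSE.Identification P βstar)
    (hH : MultiRoundSMSE.KernelAssumption α H)
    (hρ : MultiRoundSMSE.DensityAssumption P βstar α ρ)
    (hF : MultiRoundSMSE.NoiseAssumption P α)
    (hV : MultiRoundSMSE.EigenvalueAssumption P ρ)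
    (hZ : MultiRoundSMSE.BoundedCovariates P)
    (lam : ℝ) (hlam : 0 < lam)
    (m L n : ℕ → ℕ) (hL : ∀ k, 1 ≤ L k) (hn : ∀ k, n k = L k * m k)
    (hm : Tendsto m atTop atTop)
    (β₀ : ℕ → Ω → MultiRoundSMSE.Vec p)
    (hβ₀ : MultiRoundSMSE.IsBigOP μ (fun k ω => ‖β₀ k ω - βstar‖)
      (fun k => (m k : ℝ) ^ (-(1 : ℝ) / 3)))
    (βhat : ℕ → ℕ → Ω → MultiRoundSMSE.Vec p)
    (hβhat : ∀ t k ω, βhat t k ω =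
      MultiRoundSMSE.iterate H (MultiRoundSMSE.bandwidth α lam (n k) (m k)) (m k) (L k)
        (fun i => MultiRoundSMSE.observe βstar (D i ω)) (β₀ k ω) t) :
    (∀ t : ℕ, 1 ≤ t →
      MultiRoundSMSE.IsBigOP μ (fun k ω => ‖βhat t k ω - βstar‖)
        (fun k => (n k : ℝ) ^ (-(α : ℝ) / (2 * (α : ℝ) + 1))
          + (m k : ℝ) ^ (-(2 : ℝ) ^ t / 3)
          + (m k : ℝ) ^ (-(2 : ℝ) ^ (t - 1) / 3)
            * (n k : ℝ) ^ (-((α : ℝ) - 1) / (2 * (α : ℝ) + 1)) * √(Real.log (n k)))) ∧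
    (∀ T : ℕ → ℕ, (∀ᶠ k in atTop, MultiRoundSMSE.roundBound α lam (n k) (m k) ≤ (T k : ℝ)) →
      MultiRoundSMSE.IsBigOP μ (fun k ω => ‖βhat (T k) k ω - βstar‖)
        (fun k => (n k : ℝ) ^ (-(α : ℝ) / (2 * (α : ℝ) + 1)))) ∧
    (fun k => ((⌈MultiRoundSMSE.roundBound α lam (n k) (m k)⌉₊ : ℕ) : ℝ))
      =O[atTop] (fun k => Real.log (Real.log (n k))) := by
  open MultiRoundSMSE in
  have hα := hH.two_le
  have hmR : Tendsto (fun k => (m k : ℝ)) atTop atTop := tendsto_natCast_atTop_atTop.comp hm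
  have hnR : Tendsto (fun k => (n k : ℝ)) atTop atTop := by
    refine tendsto_atTop_mono (fun k => ?_) hmR
    rw [hn k]
    exact_mod_cast Nat.le_mul_of_pos_left _ (hL k)
  have hlogm := Real.tendsto_log_atTop.comp hmR
  have hlogn := Real.tendsto_log_atTop.comp hnR
  -- All probability is contained here; (i) and (ii) become comparisons of deterministic sequences.
  have hbound : ∀ (T : ℕ → ℕ) (a : ℕ → ℝ), (∀ A s K : ℝ, 0 ≤ A → 0 < s → 1 ≤ K →
      ∃ M : ℝ, ∀ᶠ k in atTop, A * optRate α (n k) +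
        (s * (K * (m k : ℝ) ^ (-(1 / 6) : ℝ)) ^ 2 ^ T k) ^ 2 +
        s * (K * (m k : ℝ) ^ (-(1 / 6) : ℝ)) ^ 2 ^ T k * devRate α (n k) ≤ M * a k) →
      IsBigOP μ (fun k ω => ‖βhat (T k) k ω - βstar‖) a := by
    intro T a h
    refine isBigOP_of_forall_bound (fun k ω => norm_nonneg _) fun ε hε => ?_
    obtain ⟨A, s, K, hA, hs, hK, hev⟩ := exists_uniform_bound μ P D hD βstar α H ρ hId hH hρ hF hV
      hZ hlam hL hn hm hβ₀ hε
    obtain ⟨M, hM⟩ := h A s K hA hs hK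
    refine ⟨M, _, hM, hev.mono fun k hk => (measure_mono fun ω hω => ?_).trans hk⟩
    rw [Set.mem_ofPred_eq, hβhat] at hω
    exact fun hcon => hω (hcon (T k))
  refine ⟨fun t ht => hbound (fun _ => t) _ fun A s K hA hs hK => ?_, fun T hT =>
    hbound T _ fun A s K hA hs hK => ?_, ?_⟩
  -- For fixed `t` the factor `K ^ 2 ^ t` is a constant and can go into `M`.
  · refine ⟨A + (s * K ^ 2 ^ t) ^ 2 + s * K ^ 2 ^ t, ?_⟩
    filter_upwards [hm.eventually_ge_atTop 1, hnR.eventually_gt_atTop 0] with k hm1 hn0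
    have hm0 : (0 : ℝ) < m k := by exact_mod_cast hm1
    obtain ⟨t, rfl⟩ : ∃ t', t = t' + 1 := ⟨t - 1, by omega⟩
    have e1 : (m k : ℝ) ^ (-(2 : ℝ) ^ (t + 1 - 1) / 3) =
        ((m k : ℝ) ^ (-(1 / 6) : ℝ)) ^ 2 ^ (t + 1) := by
      rw [← Real.rpow_mul_natCast hm0.le]; congr 1; push_cast; ring
    have e2 : (m k : ℝ) ^ (-(2 : ℝ) ^ (t + 1) / 3) =
        (((m k : ℝ) ^ (-(1 / 6) : ℝ)) ^ 2 ^ (t + 1)) ^ 2 := by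
      rw [← pow_mul, ← Real.rpow_mul_natCast hm0.le]; congr 1; push_cast; ring
    have hQ := optRate_pos (α := α) hn0
    have hx := devRate_nonneg (α := α) hn0
    have hw : 0 ≤ ((m k : ℝ) ^ (-(1 / 6) : ℝ)) ^ 2 ^ (t + 1) := by positivity
    rw [e1, e2, mul_assoc (_ ^ _) _ √_, mul_pow K, ← mul_assoc s]
    change _ ≤ _ * (optRate α (n k) + _ + _ * devRate α (n k))
    generalize ((m k : ℝ) ^ (-(1 / 6) : ℝ)) ^ 2 ^ (t + 1) = w at hw ⊢
    have hb : 0 ≤ s * K ^ 2 ^ (t + 1) := by positivity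
    generalize s * K ^ 2 ^ (t + 1) = b at hb ⊢
    have hwx := mul_nonneg hw hx
    have h1 : A * optRate α (n k) ≤ (A + b ^ 2 + b) * optRate α (n k) := by
      gcongr; nlinarith
    have h2 : b ^ 2 * w ^ 2 ≤ (A + b ^ 2 + b) * w ^ 2 := by gcongr; linarith
    have h3 : b * (w * devRate α (n k)) ≤ (A + b ^ 2 + b) * (w * devRate α (n k)) := by
      gcongr; nlinarith
    linarith [mul_pow b w 2]
  · obtain ⟨c, hc⟩ : ∃ c, c = Real.exp (3 / 4 * (α / (2 * α + 1)) * Real.log lam) := ⟨_, rfl⟩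
    have hc0 : 0 < c := by rw [hc]; exact Real.exp_pos _
    refine ⟨A + (s * c) ^ 2 + s * c, ?_⟩
    -- `1/24 = 1/6 - 1/8`: once `K * m ^ (-1/24) ≤ 1`, the constant `K` is absorbed before the power
    -- `2 ^ T` is taken.
    have hKm : Tendsto (fun k => K * (m k : ℝ) ^ (-(1 / 24) : ℝ)) atTop (𝓝 0) := by
      have := ((tendsto_rpow_of_neg (a := -(1 / 24)) (by norm_num)).comp hmR).const_mul K
      simpa using this
    filter_upwards [hT, hm.eventually_ge_atTop 1, hnR.eventually_ge_atTop 1,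
      hlogm.eventually_gt_atTop 0, hlogn.eventually_gt_atTop (Real.log lam),
      hKm.eventually (ge_mem_nhds one_pos),
      ((tendsto_optRate hα).comp hnR).eventually (ge_mem_nhds one_pos),
      hnR.eventually (eventually_mul_devRate_le hα)] with k hTk hm1 hn1 hlm hln hKk hQ1 hQx
    have hm0 : (0 : ℝ) < m k := by exact_mod_cast hm1
    have hn0 : (0 : ℝ) < n k := by linarith
    have hQ := optRate_pos (α := α) hn0
    have hx := devRate_nonneg (α := α) hn0
    have hu : K * (m k : ℝ) ^ (-(1 / 6) : ℝ) ≤ (m k : ℝ) ^ (-(1 / 8) : ℝ) := by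
      have e : (m k : ℝ) ^ (-(1 / 6) : ℝ) =
          (m k : ℝ) ^ (-(1 / 24) : ℝ) * (m k : ℝ) ^ (-(1 / 8) : ℝ) := by
        rw [← Real.rpow_add hm0]; norm_num
      rw [e, ← mul_assoc]
      exact mul_le_of_le_one_left (by positivity) hKk
    have hpow := pow_two_pow_le_of_roundBound_le hα (by exact_mod_cast hn1) hln hlm (by positivity)
      hu hTk
    rw [← hc] at hpow
    change _ ≤ _ * optRate α (n k)
    have hsq : (optRate α (n k) ^ (3 / 4 : ℝ)) ^ 2 ≤ optRate α (n k) := by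
      rw [← Real.rpow_mul_natCast hQ.le]
      conv_rhs => rw [← Real.rpow_one (optRate α (n k))]
      exact Real.rpow_le_rpow_of_exponent_ge hQ hQ1 (by norm_num)
    calc A * optRate α (n k) + (s * (K * (m k : ℝ) ^ (-(1 / 6) : ℝ)) ^ 2 ^ T k) ^ 2 +
          s * (K * (m k : ℝ) ^ (-(1 / 6) : ℝ)) ^ 2 ^ T k * devRate α (n k)
        ≤ A * optRate α (n k) + (s * (c * optRate α (n k) ^ (3 / 4 : ℝ))) ^ 2 +
          s * (c * optRate α (n k) ^ (3 / 4 : ℝ)) * devRate α (n k) := by gcongr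
      _ = A * optRate α (n k) + (s * c) ^ 2 * (optRate α (n k) ^ (3 / 4 : ℝ)) ^ 2 +
          s * c * (optRate α (n k) ^ (3 / 4 : ℝ) * devRate α (n k)) := by ring
      _ ≤ A * optRate α (n k) + (s * c) ^ 2 * optRate α (n k) + s * c * optRate α (n k) := by
          gcongr
      _ = _ := by ring
  · refine Asymptotics.IsBigO.of_bound ((Real.log 6 + Real.log 2 + 1) / Real.log 2) ?_
    filter_upwards [hlogn.eventually_gt_atTop |Real.log lam|, hlogm.eventually_ge_atTop 1,
      (Real.tendsto_log_atTop.comp hlogn).eventually_ge_atTop 1] with k h1 h2 h3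
    have h3' : 1 ≤ Real.log (Real.log (n k)) := h3
    rw [Real.norm_of_nonneg (Nat.cast_nonneg _), Real.norm_of_nonneg (by linarith)]
    exact ceil_roundBound_le hα h1 h2 h3'
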